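/- \textbf{Translation surfaces and saddle connections.} A translation surface is obtained from Euclidean polygons in $\mathbb C$ by identifying parallel edges through translations; the forms $dz$ define a holomorphic $1$-form $\omega$. Its singular points are the zeros of $\omega$, that is, the points with cone angle greater than $2\pi$. A saddle connection is a straight (geodesic) segment of positive length joining two singular points, with no singular point in its interior. It is closed if it joins a singular point to itself. \textbf{Translation cover.} Let $\Pi\subset\mathbb R^3$ be an oriented polyhedral surface tiled by regular $p$-gons of one size and invariant under the translations of a rank-three lattice $\Lambda$, with $\Pi/\Lambda$ compact and connected. The polygons define a flat cone metric on $X=\Pi/\Lambda$, with singularities only at the vertices; let $k$ be the order of the group of rotations by which parallel transport along loops avoiding the vertices acts on tangent vectors. The translation cover of $X$ is the translation surface obtained from $k$ copies of $X$, each rotated by $2\pi/k$ from the previous one, by identifying the edges of the polygons by translations (equivalently: lay out one face of $X$ in the plane, attach to each edge of a placed face a copy of the adjacent face of $X$, and regard two placed copies of the same face as equal if they differ by a translation). It is well defined up to a rotation. \textbf{The surfaces.} Let $D=\{(1,1,1),(1,-1,-1),(-1,1,-1),(-1,-1,1)\}$. \begin{itemize} \item \emph{Mucube} ($p=4$): unit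 cubes $[0,1]^3+\lambda$, $\lambda\in\Lambda=2\mathbb Z^3$, are joined in the six axis directions by square prisms (unit cubes); $\Pi$ is the boundary of this solid. \item \emph{Muoctahedron} ($p=6$): truncated octahedra centred at the points of $\Lambda=4\mathbb Z^3$, with vertices the permutations of $(0,\pm1,\pm2)$ (translated), are glued along their square faces; $\Pi$ consists of their hexagonal faces. \item \emph{Mutetrahedron} ($p=6$): truncate the tetrahedron with vertices $3d$, $d\in D$, at a third of its edges, and take the translates of the result by $\Lambda$, generated by $(0,4,4),(4,0,4),(4,4,0)$; all its triangular faces are glued to regular tetrahedra; $\Pi$ consists of the hexagonal faces. \item \emph{Octa-4} ($p=3$): octahedra congruent to the one with vertices $\pm3e_i$ are centred at the points of $\Lambda$ and of $(4,4,4)+\Lambda$, where $\Lambda$ is generated by $(0,8,8),(8,0,8),(8,8,0)$; for all $\lambda\in\Lambda$, $d\in D$, those centred at $\lambda$ and at $\lambda+4d$ are joined, along their facing triangular faces, by triangular antiprisms with equilateral faces; $\Pi$ is the boundary of this solid. \item \emph{Truncated Octa-8} ($p=4$): truncated octahedra with vertices the permutations of $(0,\pm1,\pm2)$ are translated to the points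 of $\Lambda$, generated by $(2+\sqrt{2/3})\,d$ with $d\in\{\pm1\}^3$; any two of them whose centres differ by such a vector $(2+\sqrt{2/3})\,d$ are joined, along their facing hexagonal faces, by a hexagonal prism with square lateral faces; $\Pi$ is the boundary of this solid. \end{itemize} \textbf{Theorem.} The translation covers of (the quotients $\Pi/\Lambda$ of) Mucube, Muoctahedron, Mutetrahedron, Octa-4 and Truncated Octa-8 have no closed saddle connections: no saddle connection on any of these five translation surfaces joins a singular point to itself. -/

import Mathlib

/-!
Triply periodic polyhedral surfaces tiled by regular polygons, their translation covers, and
saddle connections on these covers.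
-/

noncomputable section

/-! ### Translation surfaces glued from regular polygons -/

/-- The vertex number `j` of the regular `p`-gon inscribed in the unit circle of the complex plane
and turned by the angle `θ`; the vertices are numbered counterclockwise. -/
def regularVertex (p : ℕ) (θ : ℝ) (j : Fin p) : ℂ :=
  Complex.exp (((θ + 2 * Real.pi * (j : ℕ) / p : ℝ) : ℂ) * Complex.I)

/-- A collection of regular Euclidean `p`-gons in the plane (one for each `c : Face`, turned by
the angle `rotation c`), together with the information which edge is glued to which.
The edge number `i` of a polygon goes from its vertex `i` to its vertex `i + 1`
(addition in `Fin p` is modulo `p`). -/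
structure RegularPolygonGluing (p : ℕ) [NeZero p] where
  Face : Type
  rotation : Face → ℝ
  Glued : Face × Fin p → Face × Fin p → Prop

namespace RegularPolygonGluing

variable {p : ℕ} [NeZero p] (S : RegularPolygonGluing p)

/-- The vertex number `j` of the polygon `c`. -/
def vertex (c : S.Face) (j : Fin p) : ℂ := regularVertex p (S.rotation c) j

/-- The closed polygon `c`, as a subset of the plane. -/
def polygon (c : S.Face) : Set ℂ := convexHull ℝ (Set.range (S.vertex c))

/-- The disjoint union of the closed polygons. -/
def PolygonPoint : Type := {x : S.Face × ℂ // x.2 ∈ S.polygon x.1}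

/-- If the edge `i` of the polygon of `x` is glued to the edge `j` of the polygon of `y`, then
the points of the two edges are identified by the translation that takes the initial point of the
first edge to the end point of the second edge. -/
def Identified (x y : S.PolygonPoint) : Prop :=
  ∃ i j : Fin p, S.Glued (x.1.1, i) (y.1.1, j) ∧
    x.1.2 ∈ segment ℝ (S.vertex x.1.1 i) (S.vertex x.1.1 (i + 1)) ∧
    y.1.2 = x.1.2 + (S.vertex y.1.1 (j + 1) - S.vertex x.1.1 i)

/-- The points of the surface: the quotient of the disjoint union of the polygons by the
equivalence relation generated by the identification of the edges. -/
def Point : Type := Quot S.Identified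

/-- The point `z` of the plane belongs to the closed polygon `c` and represents the point `P` of
the surface. -/
def Represents (c : S.Face) (z : ℂ) (P : S.Point) : Prop :=
  ∃ h : z ∈ S.polygon c, Quot.mk S.Identified ⟨(c, z), h⟩ = P

/-- The corners of polygons that come together at a point (none unless it is a vertex). -/
def corners (P : S.Point) : Set (S.Face × Fin p) :=
  {e | S.Represents e.1 (S.vertex e.1 e.2) P}

/-- The cone angle at a vertex: each corner contributes the interior angle `(p - 2) * π / p` of
a regular `p`-gon. (At a point that is not a vertex this expression is `0`.) -/
def vertexAngle (P : S.Point) : ℝ := (S.corners P).ncard * (((p : ℝ) - 2) * Real.pi / p)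

/-- A point is singular (a zero of the holomorphic `1`-form, which in the polygons is `dz`)
if its cone angle exceeds `2 * π`; this can only happen at a vertex. -/
def IsSingular (P : S.Point) : Prop := 2 * Real.pi < S.vertexAngle P

/-- A path `γ`, considered on the interval `[0, 1]`, is a saddle connection with holonomy vector
`z ≠ 0` if its two ends are singular points, no interior point is singular, and it runs straight
in the direction `z` with constant speed: near each `t`, the piece after `t` and the piece
before `t` are each given inside a closed polygon by `s ↦ x + s * z`, respectively
`s ↦ x - s * z`. (At a regular point the surface has total angle `2 * π`, so there is just one way
to go on in the direction `z`, and it makes the angle `π` with the way back in the direction `-z`.)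
Segments that run along the edges of polygons, or through regular vertices, are included. -/
def IsSaddleConnectionWithHolonomy (γ : ℝ → S.Point) (z : ℂ) : Prop :=
  z ≠ 0 ∧
  (∀ t ∈ Set.Ico (0 : ℝ) 1, ∃ (c : S.Face) (x : ℂ) (ε : ℝ), 0 < ε ∧
    ∀ s ∈ Set.Icc (0 : ℝ) ε, S.Represents c (x + (s : ℂ) * z) (γ (t + s))) ∧
  (∀ t ∈ Set.Ioc (0 : ℝ) 1, ∃ (c : S.Face) (x : ℂ) (ε : ℝ), 0 < ε ∧
    ∀ s ∈ Set.Icc (0 : ℝ) ε, S.Represents c (x - (s : ℂ) * z) (γ (t - s))) ∧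
  S.IsSingular (γ 0) ∧ S.IsSingular (γ 1) ∧ ∀ t ∈ Set.Ioo (0 : ℝ) 1, ¬ S.IsSingular (γ t)

/-- `γ`, considered on `[0, 1]`, is a saddle connection. -/
def IsSaddleConnection (γ : ℝ → S.Point) : Prop :=
  ∃ z : ℂ, S.IsSaddleConnectionWithHolonomy γ z

/-- `γ` is a closed saddle connection: it joins a singular point to itself. -/
def IsClosedSaddleConnection (γ : ℝ → S.Point) : Prop :=
  S.IsSaddleConnection γ ∧ γ 0 = γ 1

end RegularPolygonGluing

/-! ### Triply periodic polyhedral surfaces and their translation covers -/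

/-- A triply periodic polyhedral surface in `ℝ³` tiled by regular `p`-gons, all of one size.
`Face` numbers the polygons up to translations of the lattice `Λ`
spanned by the three vectors `period`, and `vertex f` lists the vertices of a representative of the
face `f`, counterclockwise as seen from the outer side of the surface. The surface in `ℝ³` consists
of all translates of these polygons by vectors of `Λ`. -/
structure PeriodicPolyhedralSurface (p : ℕ) [NeZero p] where
  Face : Type
  vertex : Face → Fin p → (Fin 3 → ℝ)
  period : Fin 3 → (Fin 3 → ℝ)

namespace PeriodicPolyhedralSurface

variable {p : ℕ} [NeZero p] (X : PeriodicPolyhedralSurface p)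

/-- In the quotient of the surface by `Λ`, the edge `i` of the face `f` is the edge `j` of the face
`g`: some translation in `Λ` takes the second edge to the first, reversing the orientation that the
edges have as parts of the oriented boundaries of the two faces. -/
def SameEdge (e e' : X.Face × Fin p) : Prop :=
  ∃ m : Fin 3 → ℤ,
    X.vertex e.1 e.2 = X.vertex e'.1 (e'.2 + 1) + ∑ a, (m a : ℝ) • X.period a ∧
    X.vertex e.1 (e.2 + 1) = X.vertex e'.1 e'.2 + ∑ a, (m a : ℝ) • X.period a

/-- A face laid out in the plane, turned by the angle `π * m / p`, where `m` is its second
component. -/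
abbrev PlacedFace : Type := X.Face × Fin (2 * p)

/-- The angle by which a placed face is turned. -/
def placedAngle (c : X.PlacedFace) : ℝ := Real.pi * (c.2 : ℕ) / p

/-- The oriented edge number `i` of a placed face, as a vector in the plane. -/
def edgeVector (c : X.PlacedFace) (i : Fin p) : ℂ :=
  regularVertex p (X.placedAngle c) (i + 1) - regularVertex p (X.placedAngle c) i

/-- Edges of placed faces are glued if they are the same edge of the quotient surface and the
gluing is by a translation (that is, as sides of the two polygons, they are opposite vectors). -/
def PlacedGlued (e e' : X.PlacedFace × Fin p) : Prop :=
  X.SameEdge (e.1.1, e.2) (e'.1.1, e'.2) ∧ X.edgeVector e.1 e.2 = - X.edgeVector e'.1 e'.2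

/-- Two placed faces are adjacent if an edge of one is glued to an edge of the other. -/
def Adjacent (c c' : X.PlacedFace) : Prop := ∃ i j : Fin p, X.PlacedGlued (c, i) (c', j)

/-- The translation cover (unfolding) of the quotient of the surface by `Λ`: starting with the face
`f₀` in a standard position, one adds the neighbours of the faces already placed,
each turned such that its edge is glued by a translation, until nothing new appears. If
the rotational part of the holonomy of the flat cone metric has order `k`, then each face occurs in
exactly `k` positions, which differ by rotations by multiples of `2 * π / k`. Another choice of
`f₀` gives the same translation surface up to a rotation. -/
def translationCover (f₀ : X.Face) : RegularPolygonGluing p where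
  Face := {c : X.PlacedFace // Relation.ReflTransGen X.Adjacent (f₀, 0) c}
  rotation c := X.placedAngle c.1
  Glued e e' := X.PlacedGlued (e.1.1, e.2) (e'.1.1, e'.2)

end PeriodicPolyhedralSurface

/-! ### The five polyhedral surfaces -/

/-- The point with coordinate `x` on the axis `a` and coordinates `y`, `z` on the next two axes in
the cyclic order. -/
def axisPoint (a : Fin 3) (x y z : ℤ) : Fin 3 → ℤ :=
  fun b => if b = a then x else if b = a + 1 then y else z

/-- The sign vectors with product `1`. They point to the vertices of a regular
tetrahedron; coordinatewise multiplication by one of them is a rotation. -/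
def tetraSign : Fin 4 → (Fin 3 → ℤ) :=
  ![![1, 1, 1], ![1, -1, -1], ![-1, 1, -1], ![-1, -1, 1]]

/-- The corners of the square `[0, 1]²`, counterclockwise. -/
def unitSquare : Fin 4 → ℤ × ℤ := ![(0, 0), (1, 0), (1, 1), (0, 1)]

/-- The faces of Mucube: for each axis `a`, the four lateral faces of the square prism
(a unit cube) that is attached to the cube `[0, 1]³` at its face where coordinate `a` is `1`. -/
def mucubeVertex (f : Fin 3 × Fin 4) : Fin 4 → (Fin 3 → ℤ) :=
  ![axisPoint f.1 1 (unitSquare f.2).1 (unitSquare f.2).2,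
    axisPoint f.1 1 (unitSquare (f.2 + 1)).1 (unitSquare (f.2 + 1)).2,
    axisPoint f.1 2 (unitSquare (f.2 + 1)).1 (unitSquare (f.2 + 1)).2,
    axisPoint f.1 2 (unitSquare f.2).1 (unitSquare f.2).2]

/-- Mucube `{4, 6}`: cubes at the points of a cubic lattice, joined along the six directions of the
coordinate axes by square prisms; the surface is the boundary of this solid. -/
def mucube : PeriodicPolyhedralSurface 4 where
  Face := Fin 3 × Fin 4
  vertex f i a := (mucubeVertex f i a : ℝ)
  period := ![![2, 0, 0], ![0, 2, 0], ![0, 0, 2]]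

/-- The hexagonal face in the direction `(1, 1, 1)` of the truncated octahedron whose vertices are
the permutations of `(0, ±1, ±2)`. -/
def hexagon : Fin 6 → (Fin 3 → ℤ) :=
  ![![0, 1, 2], ![1, 0, 2], ![2, 0, 1], ![2, 1, 0], ![1, 2, 0], ![0, 2, 1]]

/-- The eight hexagonal faces of the truncated octahedron: those in the directions `tetraSign d`
and those in the opposite directions. -/
def muoctahedronVertex (f : Fin 4 ⊕ Fin 4) (i : Fin 6) : Fin 3 → ℤ :=
  match f with
  | Sum.inl d => tetraSign d * hexagon i
  | Sum.inr d => -(tetraSign d * hexagon (-i))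

/-- Muoctahedron `{6, 4}`: truncated octahedra at the points of a cubic lattice, glued along their
square faces; the surface consists of the hexagonal faces. -/
def muoctahedron : PeriodicPolyhedralSurface 6 where
  Face := Fin 4 ⊕ Fin 4
  vertex f i a := (muoctahedronVertex f i a : ℝ)
  period := ![![4, 0, 0], ![0, 4, 0], ![0, 0, 4]]

/-- The hexagonal face in the direction `(-1, -1, -1)` of the tetrahedron with the vertices
`3 * tetraSign d`, truncated at a third of the edges. -/
def truncatedHexagon : Fin 6 → (Fin 3 → ℤ) :=
  ![![1, -3, -1], ![-1, -3, 1], ![-3, -1, 1], ![-3, 1, -1], ![-1, 1, -3], ![1, -1, -3]]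

/-- Mutetrahedron `{6, 6}`: truncated tetrahedra, glued along all their triangular faces to regular
tetrahedra, in the pattern of the diamond net; the surface consists of the hexagonal faces of the
truncated tetrahedra. -/
def mutetrahedron : PeriodicPolyhedralSurface 6 where
  Face := Fin 4
  vertex d i a := ((tetraSign d * truncatedHexagon i) a : ℝ)
  period := ![![0, 4, 4], ![4, 0, 4], ![4, 4, 0]]

/-- The point `x` on the axis `i`. -/
def onAxis (x : ℤ) (i : Fin 3) : Fin 3 → ℤ := Pi.single i x

/-- The vertex on the axis `i` of the face in the direction `tetraSign d` of the octahedron with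
vertices `±3` on the axes. -/
def octaLow (d : Fin 4) (i : Fin 3) : Fin 3 → ℤ := tetraSign d * onAxis 3 i

/-- The vertex on the far triangle, opposite to `octaLow d i`, of the triangular antiprism
(a regular octahedron) that is attached to the face `octaLow d`. -/
def octaHigh (d : Fin 4) (i : Fin 3) : Fin 3 → ℤ := (fun a => 4 * tetraSign d a) - octaLow d i

/-- The faces of Octa-4. First, for each `d`, the six lateral triangles of the antiprism that joins
the octahedron centred at `0` to the one centred at `4 * tetraSign d`; then the four free faces of
the octahedron centred at `0`, in the directions `-tetraSign d`, and the four free faces of the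
octahedron centred at `(4, 4, 4)`, in the directions `tetraSign d`. -/
def octa4Vertex (f : (Fin 4 × Fin 3 ⊕ Fin 4 × Fin 3) ⊕ (Fin 4 ⊕ Fin 4)) :
    Fin 3 → (Fin 3 → ℤ) :=
  match f with
  | Sum.inl (Sum.inl (d, k)) => ![octaLow d (k + 1), octaLow d (k + 2), octaHigh d k]
  | Sum.inl (Sum.inr (d, k)) => ![octaHigh d (k + 2), octaHigh d (k + 1), octaLow d k]
  | Sum.inr (Sum.inl d) => fun i => -octaLow d (-i)
  | Sum.inr (Sum.inr d) => fun i => ![4, 4, 4] + octaLow d i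

/-- Octa-4 `{3, 8}`: octahedra at the vertices of the diamond net, joined along its edges by
triangular antiprisms; the surface is the boundary of this solid. -/
def octa4 : PeriodicPolyhedralSurface 3 where
  Face := (Fin 4 × Fin 3 ⊕ Fin 4 × Fin 3) ⊕ (Fin 4 ⊕ Fin 4)
  vertex f i a := (octa4Vertex f i a : ℝ)
  period := ![![0, 8, 8], ![8, 0, 8], ![8, 8, 0]]

/-- The corners of the square with vertices `(±1, 0)`, `(0, ±1)`, counterclockwise. -/
def diagonalSquare : Fin 4 → ℤ × ℤ := ![(1, 0), (0, 1), (-1, 0), (0, -1)]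

/-- The faces of Truncated Octa-8. First the square faces of the truncated octahedron, on the
positive and on the negative side of each axis; then, for each `d`, the six lateral squares of the
hexagonal prism that is attached to its hexagonal face in the direction `tetraSign d`. A vertex is
given by a pair `(u, w)` of integral vectors that stands for `u + √(2/3) * w`: the
prism has the edges `√(2/3) * tetraSign d`, of length `√2`. -/
def truncatedOcta8Vertex (f : (Fin 3 ⊕ Fin 3) ⊕ Fin 4 × Fin 6) :
    Fin 4 → (Fin 3 → ℤ) × (Fin 3 → ℤ) :=
  match f with
  | Sum.inl (Sum.inl a) => fun i =>
      (axisPoint a 2 (diagonalSquare i).1 (diagonalSquare i).2, 0)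
  | Sum.inl (Sum.inr a) => fun i =>
      (axisPoint a (-2) (diagonalSquare (-i)).1 (diagonalSquare (-i)).2, 0)
  | Sum.inr (d, k) =>
      ![(tetraSign d * hexagon k, 0), (tetraSign d * hexagon (k + 1), 0),
        (tetraSign d * hexagon (k + 1), tetraSign d), (tetraSign d * hexagon k, tetraSign d)]

/-- Truncated Octa-8 `{4, 5}`: truncated octahedra at the points of a body-centred cubic lattice,
joined along the eight directions of the diagonals by hexagonal prisms; the surface is the boundary
of this solid. -/
def truncatedOcta8 : PeriodicPolyhedralSurface 4 where
  Face := (Fin 3 ⊕ Fin 3) ⊕ Fin 4 × Fin 6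
  vertex f i a := ((truncatedOcta8Vertex f i).1 a : ℝ) +
    Real.sqrt (2 / 3) * ((truncatedOcta8Vertex f i).2 a : ℝ)
  period := fun b => (2 + Real.sqrt (2 / 3)) • ![![-1, 1, 1], ![1, -1, 1], ![1, 1, -1]] b

end

/-! The oriented edges of each tiling are labelled by elements of a small permutation group `G`, so
that passing to the next edge of a face is right multiplication by `R` and crossing an edge is right
multiplication by `E` (`EdgeLabelling`). A straight path on the translation cover is then followed
in a model made of unit squares that are glued by two permutations `h` (to the right) and `v`
(upwards). A square face becomes one square, two adjacent triangles become one, and a hexagon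
accounts for three, after an affine change of coordinates. The map to the model takes straight paths
to straight paths, and the singular points are exactly the preimages of certain marked corners. It
need not be injective: it suffices that the image of a saddle connection does not close up.

In the model a closed straight path has integral holonomy. Euclid's algorithm, in the form of
changes of the lattice basis, makes it horizontal (`exists_horizontal`). Such a change replaces `h`
and `v` by words in them; it keeps the numbering of the lower left corners and the commutator of `h`
and `v`, whose cycles are the corners. A horizontal path from a corner runs along sides of squares,
so what remains is a statement about permutations: if `h` comes from the original pair by such
moves, then `q` and `h q` are never in the same cycle of the commutator (`NoReturn`, `not_closed`).
For hexagons the unmarked corners, the centres, have to be passed as well. Each surface needs a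
property of `(h, v)` that survives all moves and implies this.

For square and triangular faces, `h` and `v` are right multiplications by `a` and `b`, and a return
means that `a` is a power of the commutator `c₀`. For Octa-4, `c₀` is an involution, and `a = 1` or
`a = c₀` would force `c₀ = 1` (`noReturn_of_sq_eq_one`). For Mucube and Truncated Octa-8, `c₀` has
order 3 or 5, and a return would make the subgroup generated by `a` and `b` normalize the cyclic
group of `c₀`, which it does not (`noReturn_of_prime_order`).

For hexagonal faces the squares have a type in `ZMod 3`, and corners of different types are
different; so only an `h` that preserves types can return. For Mutetrahedron the model consists of
flat tori: `h` and `v` commute, and their cubes are distinct involutions, so no `h` reached by moves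
has a fixed point of nonzero type (`noReturn_of_commutingPair`). For Muoctahedron the half turn
about the centre of a hexagon makes the translation of the centres along `h` an involution. A finite
list of signs shows that this involution is odd, whereas a return makes it conjugate to a power of a
4-cycle, and the involutive powers of that are even (`noReturn_of_rotationPair`). -/

noncomputable section

open Set Equiv

/-! ### Surfaces covered by unit squares -/

/-- A set `N` covered by closed unit squares `cell q`, glued along their sides by translations; the
lower left corners of two squares agree only if the squares are in the same cycle of `c`. -/
structure SquareChart (N Q : Type) (c : Perm Q) where
  cell : Q → ℝ → ℝ → N
  right : Perm Q
  up : Perm Q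
  pos : N → AddCircle (1 : ℝ) × AddCircle (1 : ℝ)
  cell_right : ∀ q, ∀ y ∈ Icc (0 : ℝ) 1, cell q 1 y = cell (right q) 0 y
  cell_up : ∀ q, ∀ x ∈ Icc (0 : ℝ) 1, cell q x 1 = cell (up q) x 0
  pos_cell : ∀ q, ∀ x ∈ Icc (0 : ℝ) 1, ∀ y ∈ Icc (0 : ℝ) 1,
    pos (cell q x y) = ((x : AddCircle (1 : ℝ)), (y : AddCircle (1 : ℝ)))
  cell_injective : ∀ q q', ∀ x ∈ Ico (0 : ℝ) 1, ∀ y ∈ Ico (0 : ℝ) 1, x ≠ 0 ∨ y ≠ 0 →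
    cell q x y = cell q' x y → q = q'
  corner : ∀ q q', cell q 0 0 = cell q' 0 0 → c.SameCycle q q'

/-- On a short initial interval an affine function does not change its sign. -/
theorem affine_nonneg_or_nonpos (u w ε : ℝ) (hε : 0 < ε) :
    ∃ δ, 0 < δ ∧ δ ≤ ε ∧
      ((∀ s ∈ Icc (0 : ℝ) δ, 0 ≤ u + s * w) ∨ ∀ s ∈ Icc (0 : ℝ) δ, u + s * w ≤ 0) := by
  have pos : ∀ u w : ℝ, 0 < u → ∃ δ, 0 < δ ∧ δ ≤ ε ∧ ∀ s ∈ Icc (0 : ℝ) δ, 0 ≤ u + s * w := by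
    intro u w hu
    have hw : 0 < |w| + 1 := by positivity
    refine ⟨min ε (u / (|w| + 1)), lt_min hε (by positivity), min_le_left _ _, fun s hs => ?_⟩
    have h1 : s * (|w| + 1) ≤ u := (le_div_iff₀ hw).1 (hs.2.trans (min_le_right _ _))
    nlinarith [neg_abs_le w, hs.1]
  rcases lt_trichotomy u 0 with hu | rfl | hu
  · obtain ⟨δ, h0, h1, h⟩ := pos (-u) (-w) (by linarith)
    exact ⟨δ, h0, h1, Or.inr fun s hs => by linarith [h s hs]⟩
  · refine ⟨ε, hε, le_rfl, (le_total 0 w).imp (fun hw s hs => ?_) fun hw s hs => ?_⟩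
    · have := mul_nonneg hs.1 hw; linarith
    · have := mul_nonpos_of_nonneg_of_nonpos hs.1 hw; linarith
  · obtain ⟨δ, h0, h1, h⟩ := pos u w hu
    exact ⟨δ, h0, h1, Or.inl h⟩

/-- A function on an interval that is constant near each point, on both sides, is constant. -/
theorem eq_of_locally_eq {α : Type*} (f : ℝ → α) (a b : ℝ) (hab : a ≤ b)
    (hr : ∀ t ∈ Ico a b, ∃ ε > 0, ∀ s ∈ Icc (0 : ℝ) ε, f (t + s) = f t)
    (hl : ∀ t ∈ Ioc a b, ∃ ε > 0, ∀ s ∈ Icc (0 : ℝ) ε, f (t - s) = f t) : f b = f a := by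
  let S := {t | t ∈ Icc a b ∧ ∀ u ∈ Icc a t, f u = f a}
  have haS : a ∈ S := ⟨⟨le_rfl, hab⟩, fun u hu => by rw [le_antisymm hu.2 hu.1]⟩
  have hbdd : BddAbove S := ⟨b, fun t ht => ht.1.2⟩
  set m := sSup S with hm
  have ham : a ≤ m := le_csSup hbdd haS
  have hmb : m ≤ b := csSup_le ⟨a, haS⟩ fun t ht => ht.1.2
  have hlt : ∀ u, a ≤ u → u < m → f u = f a := by
    intro u hau hu
    obtain ⟨t, ht, hut⟩ := exists_lt_of_lt_csSup ⟨a, haS⟩ hu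
    exact ht.2 u ⟨hau, hut.le⟩
  have hfm : f m = f a := by
    rcases ham.eq_or_lt with h | h
    · rw [← h]
    · obtain ⟨ε, hε, he⟩ := hl m ⟨h, hmb⟩
      have h1 : 0 < min ε (m - a) := lt_min hε (by linarith)
      rw [← he (min ε (m - a)) ⟨h1.le, min_le_left _ _⟩]
      exact hlt _ (by linarith [min_le_right ε (m - a)]) (by linarith)
  rcases hmb.eq_or_lt with h | h
  · rw [← h, hfm]
  · exfalso
    obtain ⟨ε, hε, he⟩ := hr m ⟨ham, h⟩
    have h1 : 0 < min ε (b - m) := lt_min hε (by linarith)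
    have : m + min ε (b - m) ∈ S := by
      refine ⟨⟨by linarith, by linarith [min_le_right ε (b - m)]⟩, fun u hu => ?_⟩
      rcases lt_or_ge u m with h2 | h2
      · exact hlt u hu.1 h2
      · rw [← hfm, ← he (u - m) ⟨by linarith, by linarith [hu.2, min_le_left ε (b - m)]⟩]
        congr 1; ring
    linarith [le_csSup hbdd this]

namespace SquareChart

variable {N Q : Type} {c : Perm Q} (C : SquareChart N Q c)

/-- A path whose initial piece is straight of velocity `(a, b)` inside one of the squares. -/
def Ray (γ : ℝ → N) (a b : ℝ) : Prop :=
  ∃ (q : Q) (x y ε : ℝ), 0 < ε ∧ ∀ s ∈ Icc (0 : ℝ) ε,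
    x + s * a ∈ Icc (0 : ℝ) 1 ∧ y + s * b ∈ Icc (0 : ℝ) 1 ∧ γ s = C.cell q (x + s * a) (y + s * b)

/-- A path on `[0, 1]` that is straight of velocity `(a, b)`. -/
def Straight (γ : ℝ → N) (a b : ℝ) : Prop :=
  (∀ t ∈ Ico (0 : ℝ) 1, C.Ray (fun s => γ (t + s)) a b) ∧
    ∀ t ∈ Ioc (0 : ℝ) 1, C.Ray (fun s => γ (t - s)) (-a) (-b)

/-! ### Changes of the lattice basis -/

theorem cell_right_symm (q : Q) {y : ℝ} (hy : y ∈ Icc (0 : ℝ) 1) :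
    C.cell (C.right.symm q) 1 y = C.cell q 0 y := by
  rw [C.cell_right _ y hy, Equiv.apply_symm_apply]

theorem cell_up_symm (q : Q) {x : ℝ} (hx : x ∈ Icc (0 : ℝ) 1) :
    C.cell (C.up.symm q) x 1 = C.cell q x 0 := by
  rw [C.cell_up _ x hx, Equiv.apply_symm_apply]

/-- The chart for the lattice basis `(e, e + f)` in place of `(e, f)`. -/
def shearRight : SquareChart N Q c where
  cell q x y := if x + y ≤ 1 then C.cell q (x + y) y else C.cell (C.right q) (x + y - 1) y
  right := C.right
  up := C.up * C.right
  pos P := ((C.pos P).1 - (C.pos P).2, (C.pos P).2)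
  cell_right q y hy := by
    have h1 : C.cell (C.right q) (0 + y) y = C.cell (C.right q) (1 + y - 1) y := by ring_nf
    rw [if_pos (by linarith [hy.2] : (0 : ℝ) + y ≤ 1), h1]
    split_ifs with h
    · have : y = 0 := le_antisymm (by linarith) hy.1
      subst this
      simpa using C.cell_right q 0 (by simp)
    · rfl
  cell_up q x hx := by
    rw [if_pos (by linarith [hx.2] : x + (0 : ℝ) ≤ 1), Perm.mul_apply]
    split_ifs with h
    · have : x = 0 := le_antisymm (by linarith) hx.1
      subst this
      rw [zero_add, C.cell_right q 1 (by simp), C.cell_up _ 0 (by simp), add_zero]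
    · rw [add_sub_cancel_right, C.cell_up _ x hx, add_zero]
  pos_cell q x hx y hy := by
    split_ifs with h
    · rw [C.pos_cell _ _ ⟨by linarith [hx.1, hy.1], h⟩ _ hy]
      simp
    · rw [C.pos_cell _ _ ⟨by linarith, by linarith [hx.2, hy.2]⟩ _ hy]
      simp [AddCircle.coe_period]
  cell_injective q q' x hx y hy h0 h := by
    split_ifs at h with h1
    · rcases h1.lt_or_eq with h2 | h2
      · refine C.cell_injective q q' _ ⟨add_nonneg hx.1 hy.1, h2⟩ y hy ?_ h
        by_contra! h3
        rcases h0 with h0 | h0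
        · exact h0 (by linarith)
        · exact h0 h3.2
      · rw [h2, C.cell_right _ y ⟨hy.1, hy.2.le⟩, C.cell_right _ y ⟨hy.1, hy.2.le⟩] at h
        refine C.right.injective (C.cell_injective _ _ 0 (by simp) y hy (Or.inr ?_) h)
        rintro rfl
        linarith [hx.2]
    · refine C.right.injective (C.cell_injective _ _ (x + y - 1)
        ⟨by linarith, by linarith [hx.2, hy.2]⟩ y hy (Or.inl ?_) h)
      linarith
  corner q q' h := by
    refine C.corner q q' ?_
    simpa using h

/-- The chart for the lattice basis `(e + f, f)` in place of `(e, f)`. -/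
def shearUp : SquareChart N Q c where
  cell q x y := if x + y ≤ 1 then C.cell q x (x + y) else C.cell (C.up q) x (x + y - 1)
  right := C.right * C.up
  up := C.up
  pos P := ((C.pos P).1, (C.pos P).2 - (C.pos P).1)
  cell_right q y hy := by
    rw [if_pos (by linarith [hy.2] : (0 : ℝ) + y ≤ 1), Perm.mul_apply]
    split_ifs with h
    · have : y = 0 := le_antisymm (by linarith) hy.1
      subst this
      rw [add_zero, C.cell_up q 1 (by simp), C.cell_right _ 0 (by simp), add_zero]
    · rw [add_sub_cancel_left, C.cell_right _ y hy, zero_add]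
  cell_up q x hx := by
    have h1 : C.cell (C.up q) x (x + 0) = C.cell (C.up q) x (x + 1 - 1) := by ring_nf
    rw [if_pos (by linarith [hx.2] : x + (0 : ℝ) ≤ 1), h1]
    split_ifs with h
    · have : x = 0 := le_antisymm (by linarith) hx.1
      subst this
      simpa using C.cell_up q 0 (by simp)
    · rfl
  pos_cell q x hx y hy := by
    split_ifs with h
    · rw [C.pos_cell _ _ hx _ ⟨by linarith [hx.1, hy.1], h⟩]
      simp
    · rw [C.pos_cell _ _ hx _ ⟨by linarith, by linarith [hx.2, hy.2]⟩]
      simp [AddCircle.coe_period]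
  cell_injective q q' x hx y hy h0 h := by
    split_ifs at h with h1
    · rcases h1.lt_or_eq with h2 | h2
      · refine C.cell_injective q q' x hx _ ⟨add_nonneg hx.1 hy.1, h2⟩ ?_ h
        by_contra! h3
        rcases h0 with h0 | h0
        · exact h0 h3.1
        · exact h0 (by linarith)
      · rw [h2, C.cell_up _ x ⟨hx.1, hx.2.le⟩, C.cell_up _ x ⟨hx.1, hx.2.le⟩] at h
        refine C.up.injective (C.cell_injective _ _ x hx 0 (by simp) (Or.inl ?_) h)
        rintro rfl
        linarith [hy.2]
    · refine C.up.injective (C.cell_injective _ _ x hx (x + y - 1)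
        ⟨by linarith, by linarith [hx.2, hy.2]⟩ (Or.inr ?_) h)
      linarith
  corner q q' h := by
    refine C.corner q q' ?_
    simpa using h

/-- The chart for the lattice basis `(f, -e)` in place of `(e, f)`. -/
def quarterTurn : SquareChart N Q c where
  cell q x y := C.cell (C.right.symm q) (1 - y) x
  right := C.right * C.up * C.right⁻¹
  up := C.right⁻¹
  pos P := ((C.pos P).2, -(C.pos P).1)
  cell_right q y hy := by
    have hy' : 1 - y ∈ Icc (0 : ℝ) 1 := ⟨by linarith [hy.2], by linarith [hy.1]⟩
    rw [C.cell_up _ _ hy']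
    simp
  cell_up q x hx := by
    rw [sub_self, sub_zero, C.cell_right_symm _ hx]
    rfl
  pos_cell q x hx y hy := by
    rw [C.pos_cell _ _ ⟨by linarith [hy.2], by linarith [hy.1]⟩ _ hx]
    simp [AddCircle.coe_period]
  cell_injective q q' x hx y hy h0 h := by
    rcases hy.1.eq_or_lt with h1 | h1
    · subst h1
      rw [sub_zero, C.cell_right_symm _ ⟨hx.1, hx.2.le⟩, C.cell_right_symm _ ⟨hx.1, hx.2.le⟩] at h
      exact C.cell_injective q q' 0 (by simp) x hx (Or.inr (h0.resolve_right (by simp))) h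
    · refine C.right.symm.injective (C.cell_injective _ _ (1 - y)
        ⟨by linarith [hy.2], by linarith⟩ x hx (Or.inl ?_) h)
      linarith [hy.2]
  corner q q' h := by
    rw [sub_zero, C.cell_right_symm _ (by simp), C.cell_right_symm _ (by simp)] at h
    exact C.corner q q' h

/-- A change of basis leaves the lower left corner of each number in place. Thus statements about
corners of the original chart can be read off from the gluing maps of the new one. -/
theorem shearRight_cell_zero (q : Q) : C.shearRight.cell q 0 0 = C.cell q 0 0 := by
  simp [shearRight]

theorem shearUp_cell_zero (q : Q) : C.shearUp.cell q 0 0 = C.cell q 0 0 := by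
  simp [shearUp]

theorem quarterTurn_cell_zero (q : Q) : C.quarterTurn.cell q 0 0 = C.cell q 0 0 := by
  simp [quarterTurn, C.cell_right_symm q (y := 0) (by simp)]

variable {C}

/-- The cells of the new chart are separated by the diagonals `x = y` of the old squares. A short
initial piece of the ray stays on one side of this diagonal, hence in one new cell. -/
theorem Ray.shearRight {γ : ℝ → N} {a b : ℝ} (h : C.Ray γ a b) : C.shearRight.Ray γ (a - b) b := by
  obtain ⟨q, x, y, ε, hε, h⟩ := h
  obtain ⟨δ, hδ, hδε, hs | hs⟩ := affine_nonneg_or_nonpos (x - y) (a - b) ε hε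
  · refine ⟨q, x - y, y, δ, hδ, fun s hs' => ?_⟩
    obtain ⟨hx, hy, e⟩ := h s ⟨hs'.1, hs'.2.trans hδε⟩
    refine ⟨⟨hs s hs', by linarith [hx.2, hy.1]⟩, hy, ?_⟩
    have e1 : x - y + s * (a - b) + (y + s * b) = x + s * a := by ring
    simp only [SquareChart.shearRight, e1]
    rw [e, if_pos hx.2]
  · refine ⟨C.right.symm q, x - y + 1, y, δ, hδ, fun s hs' => ?_⟩
    obtain ⟨hx, hy, e⟩ := h s ⟨hs'.1, hs'.2.trans hδε⟩
    refine ⟨⟨by linarith [hx.1, hy.2], by linarith [hs s hs']⟩, hy, ?_⟩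
    have e1 : x - y + 1 + s * (a - b) + (y + s * b) = x + s * a + 1 := by ring
    simp only [SquareChart.shearRight, e1]
    rw [e, Equiv.apply_symm_apply, add_sub_cancel_right]
    split_ifs with h1
    · have h2 : x + s * a = 0 := le_antisymm (by linarith) hx.1
      rw [h2, zero_add, C.cell_right_symm _ hy]
    · rfl

theorem Ray.shearUp {γ : ℝ → N} {a b : ℝ} (h : C.Ray γ a b) : C.shearUp.Ray γ a (b - a) := by
  obtain ⟨q, x, y, ε, hε, h⟩ := h
  obtain ⟨δ, hδ, hδε, hs | hs⟩ := affine_nonneg_or_nonpos (y - x) (b - a) ε hε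
  · refine ⟨q, x, y - x, δ, hδ, fun s hs' => ?_⟩
    obtain ⟨hx, hy, e⟩ := h s ⟨hs'.1, hs'.2.trans hδε⟩
    refine ⟨hx, ⟨hs s hs', by linarith [hx.1, hy.2]⟩, ?_⟩
    have e1 : x + s * a + (y - x + s * (b - a)) = y + s * b := by ring
    simp only [SquareChart.shearUp, e1]
    rw [e, if_pos hy.2]
  · refine ⟨C.up.symm q, x, y - x + 1, δ, hδ, fun s hs' => ?_⟩
    obtain ⟨hx, hy, e⟩ := h s ⟨hs'.1, hs'.2.trans hδε⟩
    refine ⟨hx, ⟨by linarith [hx.2, hy.1], by linarith [hs s hs']⟩, ?_⟩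
    have e1 : x + s * a + (y - x + 1 + s * (b - a)) = y + s * b + 1 := by ring
    simp only [SquareChart.shearUp, e1]
    rw [e, Equiv.apply_symm_apply, add_sub_cancel_right]
    split_ifs with h1
    · have h2 : y + s * b = 0 := le_antisymm (by linarith) hy.1
      rw [h2, zero_add, C.cell_up_symm _ hx]
    · rfl

theorem Ray.quarterTurn {γ : ℝ → N} {a b : ℝ} (h : C.Ray γ a b) : C.quarterTurn.Ray γ b (-a) := by
  obtain ⟨q, x, y, ε, hε, h⟩ := h
  refine ⟨C.right q, y, 1 - x, ε, hε, fun s hs => ?_⟩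
  obtain ⟨hx, hy, e⟩ := h s hs
  refine ⟨hy, ⟨by linarith [hx.2], by linarith [hx.1]⟩, ?_⟩
  have e1 : 1 - (1 - x + s * -a) = x + s * a := by ring
  simp only [SquareChart.quarterTurn, e1, Equiv.symm_apply_apply]
  exact e

theorem Straight.shearRight {γ : ℝ → N} {a b : ℝ} (h : C.Straight γ a b) :
    C.shearRight.Straight γ (a - b) b :=
  ⟨fun t ht => (h.1 t ht).shearRight, fun t ht => by
    have := (h.2 t ht).shearRight
    rwa [neg_sub_neg, ← neg_sub] at this⟩

theorem Straight.shearUp {γ : ℝ → N} {a b : ℝ} (h : C.Straight γ a b) :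
    C.shearUp.Straight γ a (b - a) :=
  ⟨fun t ht => (h.1 t ht).shearUp, fun t ht => by
    have := (h.2 t ht).shearUp
    rwa [neg_sub_neg, ← neg_sub] at this⟩

theorem Straight.quarterTurn {γ : ℝ → N} {a b : ℝ} (h : C.Straight γ a b) :
    C.quarterTurn.Straight γ b (-a) :=
  ⟨fun t ht => (h.1 t ht).quarterTurn, fun t ht => (h.2 t ht).quarterTurn⟩

/-- Along a straight path the position changes linearly. -/
theorem Straight.pos_eq {γ : ℝ → N} {a b : ℝ} (h : C.Straight γ a b) {t : ℝ}
    (ht : t ∈ Icc (0 : ℝ) 1) :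
    C.pos (γ t) = C.pos (γ 0) + (((t * a : ℝ) : AddCircle (1 : ℝ)), ((t * b : ℝ) : AddCircle (1 : ℝ))) := by
  have key := eq_of_locally_eq (fun t => C.pos (γ t) -
    (((t * a : ℝ) : AddCircle (1 : ℝ)), ((t * b : ℝ) : AddCircle (1 : ℝ)))) 0 t ht.1 ?_ ?_
  · have := sub_eq_iff_eq_add.1 key
    simpa only [zero_mul, QuotientAddGroup.mk_zero, Prod.mk_zero_zero, sub_zero] using this
  · intro u hu
    obtain ⟨q, x, y, ε, hε, h⟩ := h.1 u ⟨hu.1, hu.2.trans_le ht.2⟩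
    have h0 := h 0 ⟨le_rfl, hε.le⟩
    refine ⟨ε, hε, fun s hs => ?_⟩
    obtain ⟨hx, hy, e⟩ := h s hs
    simp only [zero_mul, add_zero] at h0
    simp only [e, h0.2.2, C.pos_cell _ _ hx _ hy, C.pos_cell _ _ h0.1 _ h0.2.1, Prod.mk_sub_mk,
      ← AddCircle.coe_sub]
    exact Prod.ext (congrArg ((↑) : ℝ → AddCircle (1 : ℝ)) (by ring))
      (congrArg ((↑) : ℝ → AddCircle (1 : ℝ)) (by ring))
  · intro u hu
    obtain ⟨q, x, y, ε, hε, h⟩ := h.2 u ⟨hu.1, hu.2.trans ht.2⟩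
    have h0 := h 0 ⟨le_rfl, hε.le⟩
    refine ⟨ε, hε, fun s hs => ?_⟩
    obtain ⟨hx, hy, e⟩ := h s hs
    simp only [zero_mul, add_zero, sub_zero] at h0
    simp only [e, h0.2.2, C.pos_cell _ _ hx _ hy, C.pos_cell _ _ h0.1 _ h0.2.1, Prod.mk_sub_mk,
      ← AddCircle.coe_sub]
    exact Prod.ext (congrArg ((↑) : ℝ → AddCircle (1 : ℝ)) (by ring))
      (congrArg ((↑) : ℝ → AddCircle (1 : ℝ)) (by ring))

end SquareChart

end

/-! ### Straight paths from corner to corner and Euclid's algorithm -/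

noncomputable section

open Set Equiv

theorem AddCircle.exists_int_of_coe_eq {x y : ℝ} (h : (x : AddCircle (1 : ℝ)) = y) :
    ∃ n : ℤ, x = y + n := by
  have h1 : ((x - y : ℝ) : AddCircle (1 : ℝ)) = 0 := by rw [AddCircle.coe_sub, h, sub_self]
  obtain ⟨n, hn⟩ := (AddCircle.coe_eq_zero_iff (1 : ℝ)).1 h1
  refine ⟨n, ?_⟩
  simp only [zsmul_eq_mul, mul_one] at hn
  linarith

theorem AddCircle.eq_of_coe_eq {x y : ℝ} (h : (x : AddCircle (1 : ℝ)) = y) (h1 : x - y < 1)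
    (h2 : y - x < 1) : x = y := by
  obtain ⟨n, hn⟩ := AddCircle.exists_int_of_coe_eq h
  have h3 : (n : ℝ) < 1 := by linarith
  have h4 : (-1 : ℝ) < n := by linarith
  have h5 : n = 0 := by
    have h3' : n < 1 := by exact_mod_cast h3
    have h4' : -1 < n := by exact_mod_cast h4
    omega
  simpa [h5] using hn

namespace SquareChart

variable {N Q : Type} {c : Perm Q} {C : SquareChart N Q c} {γ : ℝ → N}

theorem eq_zero_or_one_of_coe_eq_zero {u : ℝ} (hu : u ∈ Icc (0 : ℝ) 1)
    (h : (u : AddCircle (1 : ℝ)) = 0) : u = 0 ∨ u = 1 := by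
  rcases hu.2.lt_or_eq with h1 | h1
  · exact Or.inl (AddCircle.eq_of_coe_eq (by simpa using h) (by linarith) (by linarith [hu.1]))
  · exact Or.inr h1

/-- A point at an integral position is a corner. -/
theorem exists_cell_zero_of_pos_eq_zero {q : Q} {x y : ℝ} (hx : x ∈ Icc (0 : ℝ) 1)
    (hy : y ∈ Icc (0 : ℝ) 1) (h : C.pos (C.cell q x y) = 0) :
    ∃ q', C.cell q x y = C.cell q' 0 0 := by
  rw [C.pos_cell q x hx y hy, Prod.mk_eq_zero] at h
  rcases eq_zero_or_one_of_coe_eq_zero hx h.1 with rfl | rfl <;>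
    rcases eq_zero_or_one_of_coe_eq_zero hy h.2 with rfl | rfl
  · exact ⟨q, rfl⟩
  · exact ⟨_, C.cell_up q 0 (by simp)⟩
  · exact ⟨_, C.cell_right q 0 (by simp)⟩
  · exact ⟨_, (C.cell_right q 1 (by simp)).trans (C.cell_up _ 0 (by simp))⟩

/-- The position is linear along the path, so at time `t` it is `(t, 0)` in the torus. This forces
`x = t` and `y = 0` or `y = 1`; in the second case the path runs on the lower side of the square
above. -/
theorem Straight.forward {C : SquareChart N Q c} (h : C.Straight γ 1 0) (h0 : C.pos (γ 0) = 0) {t : ℝ}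
    (ht : t ∈ Ico (0 : ℝ) 1) :
    ∃ (q : Q) (ε : ℝ), 0 < ε ∧ t + ε ≤ 1 ∧ ∀ s ∈ Icc (0 : ℝ) ε, γ (t + s) = C.cell q (t + s) 0 := by
  have hp := h.pos_eq ⟨ht.1, ht.2.le⟩
  obtain ⟨q, x, y, ε, hε, h⟩ := h.1 t ht
  simp only [mul_one, mul_zero, add_zero] at h
  obtain ⟨hx, hy, e⟩ := h 0 ⟨le_rfl, hε.le⟩
  have hx1 := (h ε ⟨hε.le, le_rfl⟩).1.2
  rw [add_zero] at e hx
  rw [add_zero] at e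
  rw [e, C.pos_cell _ _ hx _ hy, h0, zero_add, mul_one, mul_zero] at hp
  have hxt : x = t :=
    AddCircle.eq_of_coe_eq (congrArg Prod.fst hp) (by linarith [ht.1]) (by linarith [hx.1, ht.2])
  subst hxt
  have hp2 : (y : AddCircle (1 : ℝ)) = (0 : ℝ) := congrArg Prod.snd hp
  rcases hy.2.lt_or_eq with h1 | h1
  · have := AddCircle.eq_of_coe_eq hp2 (by linarith) (by linarith [hy.1])
    subst this
    exact ⟨q, ε, hε, hx1, fun s hs => (h s hs).2.2⟩
  · subst h1
    exact ⟨C.up q, ε, hε, hx1, fun s hs => (h s hs).2.2.trans (C.cell_up _ _ (h s hs).1)⟩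

theorem Straight.backward {C : SquareChart N Q c} (h : C.Straight γ 1 0) (h0 : C.pos (γ 0) = 0) {t : ℝ}
    (ht : t ∈ Ioc (0 : ℝ) 1) :
    ∃ (q : Q) (ε : ℝ), 0 < ε ∧ 0 ≤ t - ε ∧ ∀ s ∈ Icc (0 : ℝ) ε, γ (t - s) = C.cell q (t - s) 0 := by
  have hp := h.pos_eq ⟨ht.1.le, ht.2⟩
  obtain ⟨q, x, y, ε, hε, h⟩ := h.2 t ht
  simp only [mul_neg, mul_one, mul_zero, add_zero, neg_zero, ← sub_eq_add_neg] at h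
  obtain ⟨hx, hy, e⟩ := h 0 ⟨le_rfl, hε.le⟩
  have hx1 := (h ε ⟨hε.le, le_rfl⟩).1.1
  rw [sub_zero] at e hx
  rw [sub_zero] at e
  rw [e, C.pos_cell _ _ hx _ hy, h0, zero_add, mul_one, mul_zero] at hp
  have hxt : x = t :=
    AddCircle.eq_of_coe_eq (congrArg Prod.fst hp) (by linarith [hx.2, ht.1]) (by linarith [ht.2])
  subst hxt
  have hp2 : (y : AddCircle (1 : ℝ)) = (0 : ℝ) := congrArg Prod.snd hp
  rcases hy.2.lt_or_eq with h1 | h1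
  · have := AddCircle.eq_of_coe_eq hp2 (by linarith) (by linarith [hy.1])
    subst this
    exact ⟨q, ε, hε, hx1, fun s hs => (h s hs).2.2⟩
  · subst h1
    exact ⟨C.up q, ε, hε, hx1, fun s hs => (h s hs).2.2.trans (C.cell_up _ _ (h s hs).1)⟩

/-- A straight path of velocity `(1, 0)` that starts at a corner runs along the side of a square. -/
theorem Straight.exists_side {C : SquareChart N Q c} (h : C.Straight γ 1 0) (h0 : C.pos (γ 0) = 0) :
    ∃ q, γ 0 = C.cell q 0 0 ∧ γ 1 = C.cell (C.right q) 0 0 := by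
  obtain ⟨q₀, ε₀, hε₀, hε₀', h₀⟩ := h.forward h0 (t := 0) (by simp)
  obtain ⟨q₁, ε₁, hε₁, hε₁', h₁⟩ := h.backward h0 (t := 1) (by simp)
  have inj : ∀ {q q' : Q} {t : ℝ}, 0 < t → t < 1 → C.cell q t 0 = C.cell q' t 0 → q = q' :=
    fun ht0 ht1 e => C.cell_injective _ _ _ ⟨ht0.le, ht1⟩ 0 (by simp) (Or.inl ht0.ne') e
  -- The set of all numbers of squares whose lower side carries the point is followed along the
  -- path. Away from the two ends it is a singleton, and it is locally constant.
  have label : ∀ {q : Q} {t : ℝ}, 0 < t → t < 1 → γ t = C.cell q t 0 →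
      {q' | γ t = C.cell q' t 0} = {q} := fun ht0 ht1 e =>
    Set.ext fun q' => ⟨fun e' => inj ht0 ht1 (e'.symm.trans e), by rintro rfl; exact e⟩
  -- The bound 1/4 keeps the two end pieces disjoint, so that the interval between them is nonempty
  -- and lies inside `(0, 1)`.
  have ha : 0 < min ε₀ (1 / 4) := lt_min hε₀ (by norm_num)
  have ha' := min_le_right ε₀ (1 / 4)
  have hb : 0 < min ε₁ (1 / 4) := lt_min hε₁ (by norm_num)
  have hb' := min_le_right ε₁ (1 / 4)
  have key := eq_of_locally_eq (fun t => {q | γ t = C.cell q t 0}) (min ε₀ (1 / 4))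
    (1 - min ε₁ (1 / 4)) (by linarith) ?_ ?_
  · have e₀ := h₀ _ ⟨ha.le, min_le_left _ _⟩
    have e₁ := h₁ _ ⟨hb.le, min_le_left _ _⟩
    rw [zero_add] at e₀
    rw [label (by linarith) (by linarith) e₀, label (by linarith) (by linarith) e₁] at key
    have hq : q₁ = q₀ := Set.singleton_eq_singleton_iff.1 key
    subst hq
    refine ⟨q₁, by simpa using h₀ 0 ⟨le_rfl, hε₀.le⟩, ?_⟩
    have := h₁ 0 ⟨le_rfl, hε₁.le⟩
    rw [sub_zero] at this
    rw [this, C.cell_right q₁ 0 (by simp)]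
  · intro t ht
    have ht0 : 0 < t := ha.trans_le ht.1
    have ht1 : t < 1 := by linarith [ht.2]
    obtain ⟨q, ε, hε, hε', hq⟩ := h.forward h0 ⟨ht0.le, ht1⟩
    refine ⟨ε / 2, by linarith, fun s hs => ?_⟩
    rw [label (by linarith [hs.1]) (by linarith [hs.2]) (hq s ⟨hs.1, by linarith [hs.2]⟩),
      label ht0 ht1 (by simpa using hq 0 ⟨le_rfl, hε.le⟩)]
  · intro t ht
    have ht0 : 0 < t := ha.trans ht.1
    have ht1 : t < 1 := by linarith [ht.2]
    obtain ⟨q, ε, hε, hε', hq⟩ := h.backward h0 ⟨ht0, ht1.le⟩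
    refine ⟨ε / 2, by linarith, fun s hs => ?_⟩
    rw [label (by linarith [hs.2]) (by linarith [hs.1]) (hq s ⟨hs.1, by linarith [hs.2]⟩),
      label ht0 ht1 (by simpa using hq 0 ⟨le_rfl, hε.le⟩)]

theorem Ray.rescale {a b r : ℝ} (hr : 0 < r) (h : C.Ray γ a b) :
    C.Ray (fun s => γ (s * r)) (a * r) (b * r) := by
  obtain ⟨q, x, y, ε, hε, h⟩ := h
  refine ⟨q, x, y, ε / r, by positivity, fun s hs => ?_⟩
  have := h (s * r) ⟨mul_nonneg hs.1 hr.le, (le_div_iff₀ hr).1 hs.2⟩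
  convert this using 3 <;> ring_nf

/-- The piece number `k` of `n` equal pieces of a straight path. -/
theorem Straight.piece {a b : ℝ} {n k : ℕ} (hk : k < n) (h : C.Straight γ a b) :
    C.Straight (fun t => γ ((k + t) / n)) (a / n) (b / n) := by
  have hn : (0 : ℝ) < n := by exact_mod_cast (Nat.zero_le k).trans_lt hk
  have hkn : (k : ℝ) + 1 ≤ n := by exact_mod_cast hk
  have hk0 : (0 : ℝ) ≤ k := Nat.cast_nonneg k
  refine ⟨fun t ht => ?_, fun t ht => ?_⟩
  · have h1 := (h.1 ((k + t) / n) ⟨div_nonneg (by linarith [ht.1]) hn.le,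
      (div_lt_one hn).2 (by linarith [ht.2])⟩).rescale (inv_pos.2 hn)
    convert h1 using 2 with s
    · ring_nf
    · exact div_eq_mul_inv _ _
    · exact div_eq_mul_inv _ _
  · have h1 := (h.2 ((k + t) / n) ⟨div_pos (by linarith [ht.1]) hn,
      (div_le_one hn).2 (by linarith [ht.2])⟩).rescale (inv_pos.2 hn)
    convert h1 using 2 with s
    · ring_nf
    · ring
    · ring

/-- A property of the gluing maps of a chart that is preserved by the changes of the lattice basis. -/
structure MoveInvariant (P : Perm Q → Perm Q → Prop) : Prop where
  shearRight : ∀ h v, P h v → P h (v * h)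
  shearUp : ∀ h v, P h v → P (h * v) v
  quarterTurn : ∀ h v, P h v → P (h * v * h⁻¹) h⁻¹

theorem exists_horizontal_nat {P : Perm Q → Perm Q → Prop} (hP : MoveInvariant P) (n : ℕ) :
    ∀ (C : SquareChart N Q c) (a b : ℕ), a + b ≤ n → (a ≠ 0 ∨ b ≠ 0) → P C.right C.up →
      C.Straight γ a b → ∃ C' : SquareChart N Q c, P C'.right C'.up ∧
        (∀ q, C'.cell q 0 0 = C.cell q 0 0) ∧ ∃ m : ℕ, 0 < m ∧ C'.Straight γ m 0 := by
  induction n with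
  | zero => intro C a b hab h0; omega
  | succ n ih =>
    intro C a b hab h0 hC h
    rcases Nat.eq_zero_or_pos b with rfl | hb
    · exact ⟨C, hC, fun _ => rfl, a, by omega, by simpa using h⟩
    rcases Nat.eq_zero_or_pos a with rfl | ha
    · exact ⟨C.quarterTurn, hP.quarterTurn _ _ hC, C.quarterTurn_cell_zero, b, hb,
        by simpa using h.quarterTurn⟩
    rcases le_total b a with hle | hle
    · obtain ⟨C', h1, h2, h3⟩ := ih C.shearRight (a - b) b (by omega) (by omega)
        (hP.shearRight _ _ hC) (by simpa [Nat.cast_sub hle] using h.shearRight)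
      exact ⟨C', h1, fun q => (h2 q).trans (C.shearRight_cell_zero q), h3⟩
    · obtain ⟨C', h1, h2, h3⟩ := ih C.shearUp a (b - a) (by omega) (by omega)
        (hP.shearUp _ _ hC) (by simpa [Nat.cast_sub hle] using h.shearUp)
      exact ⟨C', h1, fun q => (h2 q).trans (C.shearUp_cell_zero q), h3⟩

/-- Euclid's algorithm makes the direction of a straight path horizontal. -/
theorem exists_horizontal {P : Perm Q → Perm Q → Prop} (hP : MoveInvariant P)
    (C : SquareChart N Q c) (a b : ℤ) (hab : a ≠ 0 ∨ b ≠ 0) (hC : P C.right C.up)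
    (h : C.Straight γ a b) : ∃ C' : SquareChart N Q c, P C'.right C'.up ∧
      (∀ q, C'.cell q 0 0 = C.cell q 0 0) ∧ ∃ m : ℕ, 0 < m ∧ C'.Straight γ m 0 := by
  have turn : ∀ a b : ℤ, (∀ C : SquareChart N Q c, P C.right C.up → C.Straight γ (b : ℤ) (-a : ℤ) →
        ∃ C' : SquareChart N Q c, P C'.right C'.up ∧
        (∀ q, C'.cell q 0 0 = C.cell q 0 0) ∧ ∃ m : ℕ, 0 < m ∧ C'.Straight γ m 0) →
      ∀ C : SquareChart N Q c, P C.right C.up → C.Straight γ a b →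
        ∃ C' : SquareChart N Q c, P C'.right C'.up ∧
        (∀ q, C'.cell q 0 0 = C.cell q 0 0) ∧ ∃ m : ℕ, 0 < m ∧ C'.Straight γ m 0 := by
    intro a b H C hC h
    obtain ⟨C', h1, h2, h3⟩ := H C.quarterTurn (hP.quarterTurn _ _ hC)
      (by simpa using h.quarterTurn)
    exact ⟨C', h1, fun q => (h2 q).trans (C.quarterTurn_cell_zero q), h3⟩
  have base : ∀ a b : ℤ, (a ≠ 0 ∨ b ≠ 0) → 0 ≤ a → 0 ≤ b →
      ∀ C : SquareChart N Q c, P C.right C.up → C.Straight γ a b →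
        ∃ C' : SquareChart N Q c, P C'.right C'.up ∧
        (∀ q, C'.cell q 0 0 = C.cell q 0 0) ∧ ∃ m : ℕ, 0 < m ∧ C'.Straight γ m 0 := by
    intro a b hab ha hb C hC h
    lift a to ℕ using ha
    lift b to ℕ using hb
    exact exists_horizontal_nat hP (a + b) C a b le_rfl (by simpa using hab) hC (by simpa using h)
  -- In the four quadrants 0, 3, 1 and 2 quarter turns lead to nonnegative components.
  rcases le_total 0 a with ha | ha <;> rcases le_total 0 b with hb | hb
  · exact base a b hab ha hb C hC h
  · exact turn a b (turn _ _ (turn _ _ (base _ _ (by omega) (by omega) (by omega)))) C hC h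
  · exact turn a b (base _ _ (by omega) (by omega) (by omega)) C hC h
  · exact turn a b (turn _ _ (base _ _ (by omega) (by omega) (by omega))) C hC h

/-- A horizontal path from a corner in `S` does not come back to this corner when it meets a corner
in `S` for the first time. -/
def NoReturn (c : Perm Q) (S : Set Q) (h : Perm Q) : Prop :=
  ∀ q ∈ S, (h q ∈ S → ¬ c.SameCycle q (h q)) ∧
    (h q ∉ S → h (h q) ∈ S ∧ ¬ c.SameCycle q (h (h q)))

/-- After the path has been made horizontal it consists of `k` unit sides. No interior point is a
corner in `S`, so `k = 1` if the first side ends in `S`. Otherwise the path goes straight through an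
unmarked corner, the next one is in `S`, and `k = 2`. In both cases the end of the path is the
corner excluded by `NoReturn`. -/
theorem not_closed {P : Perm Q → Perm Q → Prop} (hP : MoveInvariant P) {S : Set Q}
    (hS : ∀ q, q ∉ S → c q = q) (hret : ∀ h v, P h v → NoReturn c S h)
    (C : SquareChart N Q c) (hC : P C.right C.up) {a b : ℝ} (hab : a ≠ 0 ∨ b ≠ 0)
    (h : C.Straight γ a b) (hγ0 : ∃ q ∈ S, γ 0 = C.cell q 0 0)
    (hγ : ∀ t ∈ Ioo (0 : ℝ) 1, ¬ ∃ q ∈ S, γ t = C.cell q 0 0) : γ 0 ≠ γ 1 := by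
  intro hclosed
  obtain ⟨q₀, hq₀, e₀⟩ := hγ0
  -- A number outside `S` is a cycle of its own: only one square has its lower left corner there,
  -- and the continuation of the path is determined.
  have hfix : ∀ {q q'}, c.SameCycle q q' → q' ∉ S → q' = q := by
    intro q q' hqq hq'
    exact (Perm.SameCycle.eq_of_right hqq (hS q' hq')).symm
  have hmem : ∀ {q q'}, c.SameCycle q q' → q ∈ S → q' ∈ S := by
    intro q q' hqq hq
    by_contra hq'
    exact hq' (hfix hqq hq' ▸ hq)
  -- The path returns to its initial position in the torus, so its holonomy is integral.
  have hp := h.pos_eq (t := 1) (by simp)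
  rw [← hclosed, left_eq_add, Prod.mk_eq_zero, one_mul, one_mul] at hp
  obtain ⟨m, hm⟩ := AddCircle.exists_int_of_coe_eq (x := a) (y := 0) (by simpa using hp.1)
  obtain ⟨n, hn⟩ := AddCircle.exists_int_of_coe_eq (x := b) (y := 0) (by simpa using hp.2)
  rw [zero_add] at hm hn
  subst hm hn
  obtain ⟨C', hC', hcell, k, hk, h'⟩ := exists_horizontal hP C m n (by simpa using hab) hC h
  have hk' : (0 : ℝ) < k := by exact_mod_cast hk
  have step : ∀ j, j < k → C'.pos (γ (j / k)) = 0 → ∃ q, γ (j / k) = C'.cell q 0 0 ∧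
      γ ((j + 1) / k) = C'.cell (C'.right q) 0 0 := by
    intro j hj h0
    have := h'.piece hj
    rw [div_self hk'.ne', zero_div] at this
    simpa using this.exists_side (by simpa using h0)
  have pos0 : ∀ q, C'.pos (C'.cell q 0 0) = 0 := fun q => by
    rw [C'.pos_cell q 0 (by simp) 0 (by simp)]; simp
  have inner : ∀ j, 0 < j → j < k → ∀ q ∈ S, γ (j / k) ≠ C'.cell q 0 0 := by
    intro j hj0 hj q hq e
    exact hγ (j / k) ⟨div_pos (by exact_mod_cast hj0) hk', (div_lt_one hk').2 (by exact_mod_cast hj)⟩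
      ⟨q, hq, e.trans (hcell q)⟩
  rw [← hcell] at e₀
  obtain ⟨q₁, e₁, e₁'⟩ := step 0 hk (by simp [e₀, pos0])
  simp only [Nat.cast_zero, zero_div, zero_add] at e₁ e₁'
  have hq₁ : q₁ ∈ S := hmem (C'.corner _ _ (e₀.symm.trans e₁)) hq₀
  obtain ⟨r1, r2⟩ := hret _ _ hC' q₁ hq₁
  by_cases hS1 : C'.right q₁ ∈ S
  · have hk1 : k = 1 := by
      by_contra hk1
      exact inner 1 one_pos (by omega) _ hS1 (by simpa using e₁')
    subst hk1
    rw [Nat.cast_one, div_one, ← hclosed, e₁] at e₁'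
    exact r1 hS1 (C'.corner _ _ e₁')
  · obtain ⟨r2, r3⟩ := r2 hS1
    have hk1 : 1 < k := by
      by_contra hk1
      have hk1 : k = 1 := by omega
      subst hk1
      rw [Nat.cast_one, div_one, ← hclosed, e₁] at e₁'
      exact hS1 (hmem (C'.corner _ _ e₁') hq₁)
    obtain ⟨q₂, e₂, e₂'⟩ := step 1 hk1 (by simp only [Nat.cast_one, e₁', pos0])
    simp only [Nat.cast_one] at e₂ e₂'
    rw [e₁'] at e₂
    -- The square along which the second side runs is known only up to the cycle at its corner; here
    -- this cycle is trivial.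
    have hq₂ : q₂ = C'.right q₁ := (hfix (C'.corner _ _ e₂).symm hS1).symm
    subst hq₂
    have hk2 : k = 2 := by
      by_contra hk2
      refine inner 2 two_pos (by omega) _ r2 ?_
      rw [← e₂']; norm_num
    subst hk2
    rw [show ((1 : ℝ) + 1) / (2 : ℕ) = 1 by norm_num, ← hclosed, e₁] at e₂'
    exact r3 (C'.corner _ _ e₂')

end SquareChart

end

/-! ### The square-tiled model given by two permutations -/

noncomputable section

open Set Equiv

namespace SquareChart

variable {Q : Type}

/-- The unit squares numbered by `Q`, glued along their sides by the permutations `h` and `v`. -/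
def ofPerms (h v : Perm Q) :
    SquareChart (Set Q × AddCircle (1 : ℝ) × AddCircle (1 : ℝ)) Q (v * h * v⁻¹ * h⁻¹) :=
  -- No quotient is formed. A point is its position in the torus together with the set of squares
  -- that describe it: a point on the right or upper side is renumbered by the neighbouring square,
  -- and a corner remembers only a cycle of the commutator.
  let lift : Q → ℝ → ℝ → Q := fun q x y => (if y = 1 then v else 1) ((if x = 1 then h else 1) q)
  { cell := fun q x y => (if (x = 0 ∨ x = 1) ∧ (y = 0 ∨ y = 1) then
      {q' | (v * h * v⁻¹ * h⁻¹).SameCycle (lift q x y) q'} else {lift q x y}, x, y)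
    right := h
    up := v
    pos := fun P => P.2
    cell_right := fun q y hy => by
      simp [lift, AddCircle.coe_period]
    cell_up := fun q x hx => by
      -- The two ways to the square diagonally opposite, `v * h` and `h * v`, differ by the
      -- commutator, hence end in the same cycle.
      have key : ∀ q', (v * h * v⁻¹ * h⁻¹).SameCycle (v (h q)) q' ↔
          (v * h * v⁻¹ * h⁻¹).SameCycle (h (v q)) q' := fun q' => by
        rw [← Perm.sameCycle_apply_left (x := h (v q))]
        simp
      by_cases h1 : x = 1
      · subst h1
        simp [lift, AddCircle.coe_period, key]
      · simp [lift, AddCircle.coe_period, h1]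
    pos_cell := fun q x hx y hy => rfl
    cell_injective := fun q q' x hx y hy h0 e => by
      have e1 := congrArg Prod.fst e
      have hn : ¬((x = 0 ∨ x = 1) ∧ (y = 0 ∨ y = 1)) := by
        rintro ⟨hx', hy'⟩
        have hx0 := hx'.resolve_right hx.2.ne
        have hy0 := hy'.resolve_right hy.2.ne
        exact h0.elim (fun h => h hx0) (fun h => h hy0)
      simp only [lift, if_neg hx.2.ne, if_neg hy.2.ne, if_neg hn, Perm.one_apply] at e1
      exact Set.singleton_eq_singleton_iff.1 e1
    corner := fun q q' e => by
      have e1 := congrArg Prod.fst e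
      simp only [lift, true_or, and_self, if_true, zero_ne_one, if_false, Perm.one_apply] at e1
      have : q' ∈ {q' | (v * h * v⁻¹ * h⁻¹).SameCycle q' q'} := Perm.SameCycle.refl _ _
      have h2 : q' ∈ {q'' | (v * h * v⁻¹ * h⁻¹).SameCycle q q''} := by
        rw [e1]; exact Perm.SameCycle.refl _ _
      exact h2 }

end SquareChart

/-! ### Square-tiled surfaces with a simply transitive group of translations -/

section Regular

variable {G : Type} [Group G]

open SquareChart

/-- Two right multiplications by elements with a given commutator, whose factors generate a subgroup
that contains `g`. -/
def RightMulPair (c₀ g : G) (h v : Perm G) : Prop :=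
  ∃ a b : G, h = Equiv.mulRight a ∧ v = Equiv.mulRight b ∧ a⁻¹ * b⁻¹ * a * b = c₀ ∧
    ∀ H : Subgroup G, a ∈ H → b ∈ H → g ∈ H

/-- The moves are invertible substitutions in `a` and `b`: they keep the generated subgroup and,
with this order of the factors, the commutator itself and not only its conjugacy class. -/
theorem moveInvariant_rightMulPair (c₀ g : G) : MoveInvariant (RightMulPair c₀ g) where
  shearRight := by
    rintro _ _ ⟨a, b, rfl, rfl, hc, hH⟩
    refine ⟨a, a * b, rfl, by ext x; simp [mul_assoc], by rw [← hc]; group, fun H ha hb =>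
      hH H ha ?_⟩
    simpa using H.mul_mem (H.inv_mem ha) hb
  shearUp := by
    rintro _ _ ⟨a, b, rfl, rfl, hc, hH⟩
    refine ⟨b * a, b, by ext x; simp [mul_assoc], rfl, by rw [← hc]; group, fun H ha hb =>
      hH H ?_ hb⟩
    simpa using H.mul_mem (H.inv_mem hb) ha
  quarterTurn := by
    rintro _ _ ⟨a, b, rfl, rfl, hc, hH⟩
    refine ⟨a⁻¹ * b * a, a⁻¹, by ext x; simp [mul_assoc], by ext x; simp, by rw [← hc]; group,
      fun H ha hb => hH H (by simpa using H.inv_mem hb) ?_⟩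
    have := H.mul_mem (H.mul_mem (H.inv_mem hb) ha) hb
    simpa [mul_assoc] using this

theorem sameCycle_mulRight {c₀ q q' : G} (h : (Equiv.mulRight c₀).SameCycle q q') :
    q⁻¹ * q' ∈ Subgroup.zpowers c₀ := by
  obtain ⟨i, hi⟩ := h
  refine ⟨i, ?_⟩
  have : (Equiv.mulRight c₀) ^ i = Equiv.mulRight (c₀ ^ i) := by
    simp
  rw [this] at hi
  simp [← hi]

theorem mulRight_commutator (a b : G) :
    Equiv.mulRight b * Equiv.mulRight a * (Equiv.mulRight b)⁻¹ * (Equiv.mulRight a)⁻¹ =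
      Equiv.mulRight (a⁻¹ * b⁻¹ * a * b) := by
  ext x; simp [mul_assoc]

/-- A return means `a = 1` or `a = c₀`. In the first case the commutator is trivial. In the second,
`b⁻¹ * a * b = a * c₀ = 1`, so `a` is trivial as well. -/
theorem noReturn_of_sq_eq_one {c₀ g : G} (h1 : c₀ ≠ 1) (h2 : c₀ * c₀ = 1) {h v : Perm G}
    (hP : RightMulPair c₀ g h v) : NoReturn (Equiv.mulRight c₀) univ h := by
  obtain ⟨a, b, rfl, rfl, hc, -⟩ := hP
  refine fun q _ => ⟨fun _ hs => ?_, fun h => absurd (mem_univ _) h⟩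
  have ha := sameCycle_mulRight hs
  rw [Equiv.coe_mulRight, inv_mul_cancel_left] at ha
  have ha' : a = 1 ∨ a = c₀ := by
    obtain ⟨i, rfl⟩ := ha
    rcases Int.even_or_odd' i with ⟨j, rfl | rfl⟩
    · left; simp [zpow_mul, pow_two, h2]
    · right; simp [zpow_add, zpow_mul, pow_two, h2]
  rcases ha' with rfl | rfl
  · exact h1 (by rw [← hc]; group)
  · have : b⁻¹ * a * b = 1 := by
      calc b⁻¹ * a * b = a * (a⁻¹ * b⁻¹ * a * b) := by group
        _ = 1 := by rw [hc, h2]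
    exact h1 (by simpa using (conj_eq_one_iff (a := b⁻¹) (b := a)).1 (by simpa using this))

/-- If `a` is a power of `c₀`, then so is its conjugate `b⁻¹ * a * b = a * c₀`. Both are nontrivial,
hence both generate the group of prime order `⟨c₀⟩`. So `a` and `b` normalize this group, and with
them `g`; but the conjugate of `c₀` by `g` is not a power of `c₀`. -/
theorem noReturn_of_prime_order {c₀ g : G} {n : ℕ} (hn : n.Prime) (h1 : c₀ ≠ 1) (h2 : c₀ ^ n = 1)
    (hg : ∀ i < n, g * c₀ * g⁻¹ ≠ c₀ ^ i) {h v : Perm G}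
    (hP : RightMulPair c₀ g h v) : NoReturn (Equiv.mulRight c₀) univ h := by
  obtain ⟨a, b, rfl, rfl, hc, hH⟩ := hP
  refine fun q _ => ⟨fun _ hs => ?_, fun h => absurd (mem_univ _) h⟩
  have ha := sameCycle_mulRight hs
  rw [Equiv.coe_mulRight, inv_mul_cancel_left] at ha
  have : Fact n.Prime := ⟨hn⟩
  have ho : orderOf c₀ = n := orderOf_eq_prime h2 h1
  have hgen : ∀ d ∈ Subgroup.zpowers c₀, d ≠ 1 → Subgroup.zpowers d = Subgroup.zpowers c₀ := by
    intro d hd hd1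
    have hle : Subgroup.zpowers d ≤ Subgroup.zpowers c₀ := by simpa using hd
    have hfin : Finite (Subgroup.zpowers c₀) := Nat.finite_of_card_ne_zero (by
      rw [Nat.card_zpowers, ho]; exact hn.ne_zero)
    have hd2 : d ^ n = 1 := by
      obtain ⟨i, rfl⟩ := hd
      rw [← zpow_natCast, ← zpow_mul, mul_comm, zpow_mul, zpow_natCast, h2, one_zpow]
    refine SetLike.coe_injective (Set.eq_of_subset_of_ncard_le hle ?_ (Set.toFinite _))
    have e1 : (Subgroup.zpowers d : Set G).ncard = n :=
      (Nat.card_zpowers d).trans (orderOf_eq_prime hd2 hd1)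
    have e2 : (Subgroup.zpowers c₀ : Set G).ncard = n := (Nat.card_zpowers c₀).trans ho
    rw [e1, e2]
  have ha1 : a ≠ 1 := by
    rintro rfl
    exact h1 (by rw [← hc]; group)
  -- This is the definition of the commutator, solved for the conjugate of `a`.
  have hd : b⁻¹ * a * b = a * c₀ := by rw [← hc]; group
  have hd1 : b⁻¹ * a * b ≠ 1 := by
    intro h
    exact ha1 (by simpa using (conj_eq_one_iff (a := b⁻¹) (b := a)).1 (by simpa using h))
  have hda : Subgroup.zpowers (b⁻¹ * a * b) = Subgroup.zpowers c₀ :=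
    hgen _ (by rw [hd]; exact mul_mem ha (Subgroup.mem_zpowers c₀)) hd1
  have haa := hgen a ha ha1
  have hconj : ∀ i : ℤ, (b⁻¹ * a * b) ^ i = b⁻¹ * a ^ i * b := fun i => by
    simpa using conj_zpow (a := b⁻¹) (b := a) (i := i)
  have hb : b⁻¹ ∈ Subgroup.normalizer (Subgroup.zpowers c₀ : Set G) := by
    rw [Subgroup.mem_normalizer_iff]
    intro x
    simp only [inv_inv]
    constructor
    · intro hx
      rw [← haa] at hx
      obtain ⟨i, rfl⟩ := hx
      rw [← hda]
      exact ⟨i, hconj i⟩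
    · intro hx
      rw [← hda] at hx
      obtain ⟨i, hi⟩ := hx
      simp only [hconj] at hi
      have : x = a ^ i := by simpa using hi.symm
      rw [this]
      exact zpow_mem ha i
  have ha' : a ∈ Subgroup.normalizer (Subgroup.zpowers c₀ : Set G) := Subgroup.le_normalizer ha
  have hgn := hH _ ha' (by simpa using inv_mem hb)
  have := (Subgroup.mem_normalizer_iff.1 hgn c₀).1 (Subgroup.mem_zpowers c₀)
  have hfo : IsOfFinOrder c₀ := isOfFinOrder_iff_pow_eq_one.2 ⟨n, hn.pos, h2⟩
  obtain ⟨i, hi⟩ := (hfo.mem_powers_iff_mem_zpowers).2 this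
  refine hg (i % n) (Nat.mod_lt _ hn.pos) ?_
  rw [← hi, ← ho, pow_mod_orderOf]

end Regular

end

noncomputable section

open Set Equiv

/-! ### Singular points of translation covers -/

/-- The point of the unit circle at the angle `π * n / p`. -/
def unitPoint (p n : ℕ) : ℂ := Complex.exp (((Real.pi * n / p : ℝ) : ℂ) * Complex.I)

section unitPoint

variable {p : ℕ}

theorem unitPoint_add (m n : ℕ) : unitPoint p (m + n) = unitPoint p m * unitPoint p n := by
  rw [unitPoint, unitPoint, unitPoint, ← Complex.exp_add]
  congr 1
  push_cast
  ring

theorem unitPoint_zero : unitPoint p 0 = 1 := by simp [unitPoint]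

theorem regularVertex_eq (m : ℕ) (j : Fin p) :
    regularVertex p (Real.pi * m / p) j = unitPoint p (m + 2 * j) := by
  rw [regularVertex, unitPoint]
  congr 3
  push_cast
  ring

variable [NeZero p]

theorem unitPoint_self : unitPoint p p = -1 := by
  have hp : (p : ℝ) ≠ 0 := Nat.cast_ne_zero.2 (NeZero.ne p)
  rw [unitPoint, mul_div_cancel_right₀ _ hp, Complex.exp_pi_mul_I]

theorem unitPoint_eq_iff {m n : ℕ} : unitPoint p m = unitPoint p n ↔ m ≡ n [MOD 2 * p] := by
  have hp : (p : ℝ) ≠ 0 := Nat.cast_ne_zero.2 (NeZero.ne p)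
  have hpi := Real.pi_ne_zero
  rw [unitPoint, unitPoint, Complex.exp_eq_exp_iff_exists_int, Nat.modEq_iff_dvd]
  have key : ∀ k : ℤ, ((Real.pi * m / p : ℝ) : ℂ) * Complex.I =
      ((Real.pi * n / p : ℝ) : ℂ) * Complex.I + k * (2 * Real.pi * Complex.I) ↔
      (n : ℤ) - m = ((2 * p : ℕ) : ℤ) * (-k) := by
    intro k
    have e : ((Real.pi * n / p : ℝ) : ℂ) * Complex.I + k * (2 * Real.pi * Complex.I) =
        ((Real.pi * n / p + k * (2 * Real.pi) : ℝ) : ℂ) * Complex.I := by push_cast; ring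
    rw [e, mul_left_inj' Complex.I_ne_zero, Complex.ofReal_inj]
    have e2 : Real.pi * m / p = Real.pi * n / p + k * (2 * Real.pi) ↔
        (m : ℝ) = n + k * (2 * p) := by
      constructor
      · intro h
        field_simp at h
        linarith
      · intro h
        rw [h]
        field_simp
    rw [e2]
    constructor
    · intro h
      have h' : (m : ℤ) = n + k * (2 * p) := by exact_mod_cast h
      push_cast
      linarith
    · intro h
      push_cast at h
      have h' : (m : ℤ) = n + k * (2 * p) := by linarith
      exact_mod_cast h'
  constructor
  · rintro ⟨k, hk⟩
    exact ⟨_, (key k).1 hk⟩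
  · rintro ⟨k, hk⟩
    exact ⟨-k, (key (-k)).2 (by simpa using hk)⟩

theorem unitPoint_congr {m n : ℕ} (h : m ≡ n [MOD 2 * p]) : unitPoint p m = unitPoint p n :=
  unitPoint_eq_iff.2 h

theorem Fin.two_mul_val_add_one_modEq (m : ℕ) (i : Fin p) :
    m + 2 * ((i + 1 : Fin p) : ℕ) ≡ m + 2 * (i : ℕ) + 2 [MOD 2 * p] := by
  have h1 : ((i + 1 : Fin p) : ℕ) ≡ i + 1 [MOD p] := by
    rw [Fin.val_add]
    refine (Nat.mod_modEq _ _).trans (Nat.ModEq.add_left _ ?_)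
    exact Nat.mod_modEq 1 p
  have := (h1.mul_left' 2).add_left m
  rwa [mul_add, mul_one, ← add_assoc] at this

theorem regularVertex_add_one_eq (m : ℕ) (j : Fin p) :
    regularVertex p (Real.pi * m / p) (j + 1) = unitPoint p (m + 2 * j + 2) := by
  rw [regularVertex_eq]
  exact unitPoint_congr (Fin.two_mul_val_add_one_modEq m j)

end unitPoint

namespace PeriodicPolyhedralSurface

variable {p : ℕ} [NeZero p] (X : PeriodicPolyhedralSurface p)

/-- The outer normal of the edge `i` of a placed face has the angle `π * (n + 1) / p`, where `n` is
the normal index. -/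
def normalIndex (c : X.PlacedFace) (i : Fin p) : ℕ := (c.2 : ℕ) + 2 * i

variable {X}

theorem edgeVector_eq (c : X.PlacedFace) (i : Fin p) :
    X.edgeVector c i = unitPoint p (X.normalIndex c i) * (unitPoint p 2 - 1) := by
  rw [edgeVector, placedAngle, regularVertex_add_one_eq, regularVertex_eq, unitPoint_add, normalIndex]
  ring

/-- Sides of equal length are opposite vectors exactly if their normals differ by the angle `π`,
which is `p` units of `π / p`. This turns the condition on the gluing into arithmetic modulo `2 *
p`. -/
theorem edgeVector_eq_neg_iff (hp : 2 ≤ p) (c c' : X.PlacedFace) (i j : Fin p) :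
    X.edgeVector c i = -X.edgeVector c' j ↔
      X.normalIndex c' j ≡ X.normalIndex c i + p [MOD 2 * p] := by
  have h2 : unitPoint p 2 - 1 ≠ 0 := by
    rw [sub_ne_zero, ← unitPoint_zero (p := p), Ne, unitPoint_eq_iff, Nat.modEq_zero_iff_dvd]
    exact fun h => by have := Nat.le_of_dvd two_pos h; omega
  rw [edgeVector_eq, edgeVector_eq, ← neg_mul, mul_left_inj' h2, ← unitPoint_eq_iff, unitPoint_add,
    unitPoint_self, mul_neg_one]
  constructor
  · intro h; rw [h, neg_neg]
  · intro h; rw [h, neg_neg]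

/-- A labelling of the oriented edges by the elements of a group in which the next edge of a face is
obtained by multiplication with `R`, and the same edge of the neighbouring face by multiplication
with `E`. -/
structure EdgeLabelling (X : PeriodicPolyhedralSurface p) (G : Type) [Group G] where
  face : X.Face → G
  R : G
  E : G
  R_pow : R ^ p = 1
  E_mul_E : E * E = 1
  sameEdge : ∀ f i g j, X.SameEdge (f, i) (g, j) →
    face f * R ^ (i : ℕ) * E = face g * R ^ (j : ℕ)

/-- Every edge belongs to a second face. -/
def IsClosedSurface (X : PeriodicPolyhedralSurface p) : Prop :=
  ∀ f i, ∃ g j, X.SameEdge (f, i) (g, j)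

variable {f₀ : X.Face}

theorem translationCover_vertex (c : (X.translationCover f₀).Face) (i : Fin p) :
    (X.translationCover f₀).vertex c i = unitPoint p (X.normalIndex c.1 i) :=
  regularVertex_eq _ _

theorem translationCover_vertex_add_one (c : (X.translationCover f₀).Face) (i : Fin p) :
    (X.translationCover f₀).vertex c (i + 1) = unitPoint p (X.normalIndex c.1 i + 2) :=
  regularVertex_add_one_eq _ _

theorem pow_val_add_one {G : Type} [Group G] {R : G} (hR : R ^ p = 1) (j : Fin p) :
    R ^ ((j + 1 : Fin p) : ℕ) = R ^ (j : ℕ) * R := by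
  rw [← pow_succ]
  have h1 : ((j + 1 : Fin p) : ℕ) ≡ j + 1 [MOD p] := by
    rw [Fin.val_add]
    exact (Nat.mod_modEq _ _).trans (Nat.ModEq.add_left _ (Nat.mod_modEq 1 p))
  exact pow_eq_pow_of_modEq h1 hR

/-- The next corner around a vertex. -/
theorem exists_next_corner (hp : 2 ≤ p) {G : Type} [Group G] (l : EdgeLabelling X G)
    (hX : X.IsClosedSurface) {P : (X.translationCover f₀).Point}
    {e : (X.translationCover f₀).Face × Fin p} (he : e ∈ (X.translationCover f₀).corners P) :
    ∃ e' ∈ (X.translationCover f₀).corners P,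
      l.face e'.1.1.1 * l.R ^ (e'.2 : ℕ) = l.face e.1.1.1 * l.R ^ (e.2 : ℕ) * (l.E * l.R) ∧
      X.normalIndex e'.1.1 e'.2 ≡ X.normalIndex e.1.1 e.2 + (p + 2) [MOD 2 * p] := by
  obtain ⟨⟨⟨f, m⟩, hc⟩, i⟩ := e
  obtain ⟨hmem, rfl⟩ := he
  obtain ⟨g, j, hgj⟩ := hX f i
  have hp0 : 0 < 2 * p := by omega
  have hj := j.2
  set n := X.normalIndex (f, m) i with hn
  -- The turning of the neighbour that makes its edge `j` opposite to the given edge: `m' + 2 * j`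
  -- has to be `n + p` modulo `2 * p`.
  let m' : Fin (2 * p) := ⟨(n + p + (2 * p - 2 * j)) % (2 * p), Nat.mod_lt _ hp0⟩
  have hm' : X.normalIndex (g, m') j ≡ n + p [MOD 2 * p] := by
    have h1 : (m' : ℕ) + 2 * j ≡ n + p + (2 * p - 2 * j) + 2 * j [MOD 2 * p] :=
      (Nat.mod_modEq _ _).add_right _
    have h2 : n + p + (2 * p - 2 * j) + 2 * j = n + p + 2 * p := by omega
    rw [h2] at h1
    exact h1.trans (by simp [Nat.ModEq])
  have hglued : X.PlacedGlued ((f, m), i) ((g, m'), j) :=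
    ⟨hgj, (edgeVector_eq_neg_iff hp _ _ _ _).2 hm'⟩
  have hc' : Relation.ReflTransGen X.Adjacent (f₀, 0) (g, m') := hc.tail ⟨i, j, hglued⟩
  have hmem' : (X.translationCover f₀).vertex ⟨(g, m'), hc'⟩ (j + 1) ∈
      (X.translationCover f₀).polygon ⟨(g, m'), hc'⟩ := subset_convexHull ℝ _ ⟨_, rfl⟩
  have hident : (X.translationCover f₀).Identified ⟨(⟨(f, m), hc⟩, _), hmem⟩
      ⟨(⟨(g, m'), hc'⟩, _), hmem'⟩ :=
    -- The gluing reverses the orientation of the edge: the initial point of edge `i` goes to the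
    -- end point of edge `j`, so the next corner has the number `j + 1`.
    ⟨i, j, hglued, left_mem_segment _ _ _, (add_sub_cancel _ _).symm⟩
  refine ⟨(⟨(g, m'), hc'⟩, j + 1), ⟨hmem', (Quot.sound hident).symm⟩, ?_, ?_⟩
  · simp only
    rw [pow_val_add_one l.R_pow, ← mul_assoc, ← mul_assoc, ← l.sameEdge f i g j hgj]
  · exact (Fin.two_mul_val_add_one_modEq _ j).trans (by rw [← add_assoc]; exact hm'.add_right 2)

/-- One walks around the vertex. Each step multiplies the label by `E * R` and adds `p + 2` to the
normal index. Under the hypothesis the pairs of label and direction do not repeat within the first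
`k` steps, so at least `k` corners meet, with a total angle above `2 * π`. The direction is needed
because the label alone may return too early. -/
theorem isSingular_of_vertex [Finite X.Face] (hp : 2 ≤ p) {G : Type} [Group G]
    (l : EdgeLabelling X G) (hX : X.IsClosedSurface) (k : ℕ) (hk : 2 * p < k * (p - 2))
    (hl : ∀ i, 0 < i → i < k → (l.E * l.R) ^ i = 1 → ¬ 2 * p ∣ i * (p + 2))
    {P : (X.translationCover f₀).Point} (hP : ((X.translationCover f₀).corners P).Nonempty) :
    (X.translationCover f₀).IsSingular P := by
  obtain ⟨e, he⟩ := hP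
  have hseq : ∀ i : ℕ, ∃ e' ∈ (X.translationCover f₀).corners P,
      l.face e'.1.1.1 * l.R ^ (e'.2 : ℕ) = l.face e.1.1.1 * l.R ^ (e.2 : ℕ) * (l.E * l.R) ^ i ∧
      X.normalIndex e'.1.1 e'.2 ≡ X.normalIndex e.1.1 e.2 + i * (p + 2) [MOD 2 * p] := by
    intro i
    induction i with
    | zero => exact ⟨e, he, by simp, by simp [Nat.ModEq.refl]⟩
    | succ i ih =>
      obtain ⟨e', he', h1, h2⟩ := ih
      obtain ⟨e'', he'', h3, h4⟩ := exists_next_corner hp l hX he'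
      refine ⟨e'', he'', by rw [h3, h1, pow_succ, mul_assoc], h4.trans ?_⟩
      have := h2.add_right (p + 2)
      rwa [add_assoc, ← Nat.succ_mul] at this
  choose s hs hs1 hs2 using hseq
  have hfin : ((X.translationCover f₀).corners P).Finite := by
    have : Finite (X.translationCover f₀).Face := inferInstanceAs (Finite (Subtype _))
    exact Set.toFinite _
  have hcard : k ≤ ((X.translationCover f₀).corners P).ncard := by
    have hinj : ∀ i j, i < j → j < k → s i ≠ s j := by
      intro i j hij hj h
      have h1 := (hs1 i).symm.trans (h ▸ hs1 j)
      have h2 := (hs2 i).symm.trans (h ▸ hs2 j)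
      obtain ⟨d, rfl⟩ := Nat.exists_eq_add_of_lt hij
      have h3 := mul_left_cancel h1
      rw [add_assoc, pow_add, left_eq_mul] at h3
      refine hl (d + 1) (by omega) (by omega) h3 ?_
      have h4 := Nat.ModEq.add_left_cancel' _ h2
      rw [add_assoc, add_mul] at h4
      have h5 := Nat.ModEq.add_left_cancel' (i * (p + 2)) (show i * (p + 2) + 0 ≡ _ [MOD 2 * p] from h4)
      exact (Nat.modEq_zero_iff_dvd).1 h5.symm
    have := Set.ncard_le_ncard (s := s '' (Finset.range k : Set ℕ))
      (t := (X.translationCover f₀).corners P) (image_subset_iff.2 fun i _ => hs i) hfin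
    rwa [Set.InjOn.ncard_image, Set.ncard_coe_finset, Finset.card_range] at this
    intro i hi j hj hij
    simp only [Finset.coe_range, mem_Iio] at hi hj
    rcases lt_trichotomy i j with h | h | h
    · exact absurd hij (hinj i j h hj)
    · exact h
    · exact absurd hij.symm (hinj j i h hi)
  have hp0 : (0 : ℝ) < p := by exact_mod_cast (by omega : 0 < p)
  have hk' : 2 * (p : ℝ) < k * (p - 2) := by
    have : ((2 * p : ℕ) : ℝ) < (k * (p - 2) : ℕ) := by exact_mod_cast hk
    rw [Nat.cast_mul k, Nat.cast_sub hp] at this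
    push_cast at this
    exact this
  have hp2 : (0 : ℝ) ≤ p - 2 := by
    have : (2 : ℝ) ≤ p := by exact_mod_cast hp
    linarith
  have hcard' : (k : ℝ) ≤ ((X.translationCover f₀).corners P).ncard := by exact_mod_cast hcard
  rw [RegularPolygonGluing.IsSingular, RegularPolygonGluing.vertexAngle, ← mul_div_assoc,
    lt_div_iff₀ hp0]
  have h3 := mul_le_mul_of_nonneg_right hcard' (mul_nonneg hp2 Real.pi_pos.le)
  nlinarith [Real.pi_pos]

end PeriodicPolyhedralSurface

theorem RegularPolygonGluing.IsSingular.corners_nonempty {p : ℕ} [NeZero p]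
    {S : RegularPolygonGluing p} {P : S.Point} (h : S.IsSingular P) : (S.corners P).Nonempty := by
  rw [nonempty_iff_ne_empty]
  intro h0
  have := Real.pi_pos
  rw [IsSingular, vertexAngle, h0, ncard_empty, Nat.cast_zero, zero_mul] at h
  linarith

/-- A gluing of polygons whose points are mapped to a set with a chart by unit squares, such that
straight paths go to straight paths, and the singular points to the corners in `T`, has no closed
saddle connection if horizontal paths do not return. -/
theorem RegularPolygonGluing.not_exists_isClosedSaddleConnection {p : ℕ} [NeZero p]
    (S : RegularPolygonGluing p) {N Q : Type} {c : Perm Q} (C : SquareChart N Q c)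
    {H : Perm Q → Perm Q → Prop} (hH : SquareChart.MoveInvariant H) {T : Set Q}
    (hT : ∀ q, q ∉ T → c q = q) (hret : ∀ h v, H h v → SquareChart.NoReturn c T h)
    (hC : H C.right C.up) (F : S.Point → N) (A B : ℂ → ℝ) (hA : ∀ z, A (-z) = -A z)
    (hB : ∀ z, B (-z) = -B z) (hAB : ∀ z, A z = 0 → B z = 0 → z = 0)
    (hray : ∀ (γ : ℝ → S.Point) (f : S.Face) (x z : ℂ) (ε : ℝ), 0 < ε →
      (∀ s ∈ Icc (0 : ℝ) ε, S.Represents f (x + (s : ℂ) * z) (γ s)) →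
        C.Ray (fun s => F (γ s)) (A z) (B z))
    (hsing : ∀ P, S.IsSingular P ↔ ∃ q ∈ T, F P = C.cell q 0 0) :
    ¬ ∃ γ, S.IsClosedSaddleConnection γ := by
  rintro ⟨γ, ⟨z, hz, h1, h2, h3, -, h5⟩, h6⟩
  refine SquareChart.not_closed hH hT hret C hC (a := A z) (b := B z) (γ := fun t => F (γ t)) ?_
    ⟨fun t ht => ?_, fun t ht => ?_⟩ ((hsing _).1 h3) (fun t ht h => h5 t ht ((hsing _).2 h))
    (congrArg F h6)
  · by_contra! h
    exact hz (hAB z h.1 h.2)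
  · obtain ⟨f, x, ε, hε, h⟩ := h1 t ht
    exact hray (fun s => γ (t + s)) f x z ε hε h
  · obtain ⟨f, x, ε, hε, h⟩ := h2 t ht
    rw [← hA, ← hB]
    refine hray (fun s => γ (t - s)) f x (-z) ε hε fun s hs => ?_
    have := h s hs
    rwa [sub_eq_add_neg, ← mul_neg] at this

end

/-! ### Crossing edges between placed faces -/

noncomputable section

open Set Equiv

theorem unitPoint_mul (p n k : ℕ) : unitPoint p (n * k) = unitPoint p n ^ k := by
  induction k with
  | zero => simp [unitPoint_zero]
  | succ k ih => rw [Nat.mul_succ, unitPoint_add, ih, pow_succ]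

/-- An affine function that is nonnegative at the vertices of a polygon is nonnegative on it. -/
theorem RegularPolygonGluing.affine_nonneg_of_vertex {p : ℕ} [NeZero p] {S : RegularPolygonGluing p}
    {f : S.Face} (α β δ : ℝ) (h : ∀ i, 0 ≤ α * (S.vertex f i).re + β * (S.vertex f i).im + δ)
    {x : ℂ} (hx : x ∈ S.polygon f) : 0 ≤ α * x.re + β * x.im + δ := by
  have hconv : Convex ℝ {x : ℂ | 0 ≤ α * x.re + β * x.im + δ} := by
    intro x hx y hy a b ha hb hab
    simp only [mem_ofPred_eq, Complex.add_re, Complex.add_im, Complex.real_smul, Complex.re_ofReal_mul,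
      Complex.im_ofReal_mul] at hx hy ⊢
    have h1 := mul_nonneg ha hx
    have h2 := mul_nonneg hb hy
    have h3 : a * δ + b * δ = δ := by rw [← add_mul, hab, one_mul]
    linarith
  exact convexHull_min (by rintro _ ⟨i, rfl⟩; exact h i) hconv hx

theorem Complex.re_im_of_mem_segment {x v w : ℂ} (h : x ∈ segment ℝ v w) :
    ∃ t ∈ Icc (0 : ℝ) 1, x.re = v.re + t * (w.re - v.re) ∧ x.im = v.im + t * (w.im - v.im) := by
  rw [segment_eq_image'] at h
  obtain ⟨t, ht, rfl⟩ := h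
  exact ⟨t, ht, by simp, by simp⟩

namespace PeriodicPolyhedralSurface

variable {p : ℕ} [NeZero p] {X : PeriodicPolyhedralSurface p} {f₀ : X.Face}

theorem PlacedGlued.normalIndex_modEq (hp : 2 ≤ p) {c c' : X.PlacedFace} {i j : Fin p}
    (h : X.PlacedGlued (c, i) (c', j)) :
    X.normalIndex c' j ≡ X.normalIndex c i + p [MOD 2 * p] :=
  (edgeVector_eq_neg_iff hp _ _ _ _).1 h.2

theorem exists_normalIndex_modEq (c : X.PlacedFace) {n : ℕ} (hn : n ≡ c.2 [MOD 2]) :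
    ∃ i : Fin p, X.normalIndex c i ≡ n [MOD 2 * p] := by
  have hp : 0 < p := Nat.pos_of_neZero p
  -- The multiple `2 * p * c.2` of the modulus is added so that the subtraction of `c.2` in the
  -- natural numbers does not truncate.
  have hle : (c.2 : ℕ) ≤ 2 * (p * c.2) := by nlinarith [(c.2 : ℕ).zero_le]
  have hev : 2 * ((n + (2 * (p * c.2) - c.2)) / 2) = n + (2 * (p * c.2) - c.2) := by
    have : n % 2 = c.2 % 2 := hn
    omega
  refine ⟨⟨(n + (2 * (p * c.2) - c.2)) / 2 % p, Nat.mod_lt _ hp⟩, ?_⟩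
  have h1 := ((Nat.mod_modEq ((n + (2 * (p * c.2) - c.2)) / 2) p).mul_left' 2).add_left (c.2 : ℕ)
  rw [hev, show (c.2 : ℕ) + (n + (2 * (p * c.2) - c.2)) = n + 2 * p * c.2 by
    rw [mul_assoc]; omega] at h1
  exact h1.trans (by simp [Nat.ModEq])

theorem translationCover_exists_vertex (c : (X.translationCover f₀).Face) {n : ℕ}
    (hn : n ≡ c.1.2 [MOD 2]) : ∃ i, (X.translationCover f₀).vertex c i = unitPoint p n := by
  obtain ⟨i, hi⟩ := exists_normalIndex_modEq c.1 hn
  exact ⟨i, by rw [translationCover_vertex, unitPoint_congr hi]⟩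

/-- For polygons centred at `0`, the sum of the two end points of an edge is the vector to the
centre of the polygon reflected in that edge. The gluing is therefore the translation by minus this
sum. -/
theorem translationCover_identified (hp : 2 ≤ p) {x y : (X.translationCover f₀).PolygonPoint}
    (h : (X.translationCover f₀).Identified x y) :
    ∃ i j : Fin p, X.SameEdge (x.1.1.1.1, i) (y.1.1.1.1, j) ∧
      X.normalIndex y.1.1.1 j ≡ X.normalIndex x.1.1.1 i + p [MOD 2 * p] ∧
      x.1.2 ∈ segment ℝ (unitPoint p (X.normalIndex x.1.1.1 i))
        (unitPoint p (X.normalIndex x.1.1.1 i + 2)) ∧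
      y.1.2 = x.1.2 - unitPoint p (X.normalIndex x.1.1.1 i) -
        unitPoint p (X.normalIndex x.1.1.1 i + 2) := by
  obtain ⟨i, j, hg, hs, hy⟩ := h
  have hn := hg.normalIndex_modEq hp
  refine ⟨i, j, hg.1, hn, ?_, ?_⟩
  · rwa [translationCover_vertex, translationCover_vertex_add_one] at hs
  · rw [hy, translationCover_vertex_add_one, translationCover_vertex,
      unitPoint_congr (hn.add_right 2), add_assoc, add_comm p 2, ← add_assoc, unitPoint_add _ p,
      unitPoint_self]
    ring

/-- Crossing an edge changes the turning index by `p` modulo 2, so for even `p` only even multiples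
of `π / p` occur. -/
theorem even_of_reachable (hp : 2 ≤ p) (hp2 : Even p) (c : (X.translationCover f₀).Face) :
    Even (c.1.2 : ℕ) := by
  obtain ⟨c, hc⟩ := c
  induction hc with
  | refl => simp
  | tail _ h ih =>
    obtain ⟨i, j, h⟩ := h
    have h1 := (h.normalIndex_modEq hp).of_mul_right p
    have ih' : Even _ := ih
    simp only [normalIndex, Nat.ModEq] at h1
    rw [Nat.even_iff] at ih' hp2 ⊢
    simp only at ih' ⊢
    omega

namespace EdgeLabelling

variable {G : Type} [Group G] (l : EdgeLabelling X G)

/-- The label of the edge of a placed face whose outer normal has the angle `π / p`, if the face is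
turned by an even multiple of `π / p`. -/
def placed (c : X.PlacedFace) : G := l.face c.1 * (l.R ^ ((c.2 : ℕ) / 2))⁻¹

/-- One rotates from the edge of normal index `0` to the edge to be crossed by `R ^ k`, crosses by
`E`, and rotates back by `R ^ (k + r)`, because on the other side the normal is opposite. -/
theorem placed_of_glued {r : ℕ} (hpr : p = 2 * r) {c c' : X.PlacedFace} (hc : Even (c.2 : ℕ))
    (hc' : Even (c'.2 : ℕ)) {i j : Fin p} (h : X.SameEdge (c.1, i) (c'.1, j))
    (hn : X.normalIndex c' j ≡ X.normalIndex c i + p [MOD 2 * p]) :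
    ∃ k : ℕ, X.normalIndex c i = 2 * k ∧
      l.placed c' = l.placed c * l.R ^ k * l.E * (l.R ^ (k + r))⁻¹ := by
  obtain ⟨m, hm⟩ := hc
  obtain ⟨m', hm'⟩ := hc'
  refine ⟨m + i, by simp only [normalIndex]; omega, ?_⟩
  have h1 : m' + (j : ℕ) ≡ m + i + r [MOD p] := by
    refine Nat.ModEq.mul_left_cancel' two_ne_zero ?_
    simp only [normalIndex, hm, hm'] at hn
    convert hn using 1 <;> omega
  have h2 := pow_eq_pow_of_modEq h1 l.R_pow
  have h3 := l.sameEdge _ _ _ _ h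
  rw [pow_add] at h2
  have e1 : l.placed c' = l.face c'.1 * l.R ^ (j : ℕ) * (l.R ^ (m' + (j : ℕ)))⁻¹ := by
    rw [placed, hm', show (m' + m') / 2 = m' by omega, add_comm m', pow_add]
    group
  have e2 : l.placed c = l.face c.1 * (l.R ^ m)⁻¹ := by
    rw [placed, hm, show (m + m) / 2 = m by omega]
  rw [e1, ← h3, pow_add, h2, e2, pow_add]
  group

end EdgeLabelling

/-! ### Surfaces tiled by squares -/

section Square

variable {X : PeriodicPolyhedralSurface 4} {f₀ : X.Face} {G : Type} [Group G]

theorem unitPoint_four_two_mul (k : ℕ) : unitPoint 4 (2 * k) = Complex.I ^ k := by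
  rw [unitPoint_mul]
  congr 1
  have h : ((Real.pi * (2 : ℕ) / (4 : ℕ) : ℝ) : ℂ) = Real.pi / 2 := by push_cast; ring
  rw [unitPoint, h, Complex.exp_mul_I, Complex.cos_pi_div_two, Complex.sin_pi_div_two]
  simp

/-- The first coordinate in a unit square of a point of a regular square. -/
def squareX (z : ℂ) : ℝ := (z.re + z.im + 1) / 2

/-- The second coordinate in a unit square of a point of a regular square. -/
def squareY (z : ℂ) : ℝ := (z.im - z.re + 1) / 2

theorem square_mem_Icc {c : (X.translationCover f₀).Face} {x : ℂ}
    (hx : x ∈ (X.translationCover f₀).polygon c) :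
    squareX x ∈ Icc (0 : ℝ) 1 ∧ squareY x ∈ Icc (0 : ℝ) 1 := by
  have hev := even_of_reachable (by norm_num) (by decide) c
  have key : ∀ α β δ : ℝ, 0 ≤ α + δ → 0 ≤ β + δ → 0 ≤ -α + δ → 0 ≤ -β + δ →
      0 ≤ α * x.re + β * x.im + δ := by
    intro α β δ h0 h1 h2 h3
    refine RegularPolygonGluing.affine_nonneg_of_vertex α β δ (fun i => ?_) hx
    obtain ⟨m, hm⟩ := hev
    rw [translationCover_vertex, normalIndex, hm, ← two_mul, ← mul_add, unitPoint_four_two_mul,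
      Complex.I_pow_eq_pow_mod]
    have hlt := Nat.mod_lt (m + (i : ℕ)) (show 4 > 0 by norm_num)
    interval_cases (m + (i : ℕ)) % 4 <;> simp [pow_succ] <;> linarith
  have h1 := key (1 / 2) (1 / 2) (1 / 2) (by norm_num) (by norm_num) (by norm_num) (by norm_num)
  have h2 := key (-1 / 2) (-1 / 2) (1 / 2) (by norm_num) (by norm_num) (by norm_num) (by norm_num)
  have h3 := key (-1 / 2) (1 / 2) (1 / 2) (by norm_num) (by norm_num) (by norm_num) (by norm_num)
  have h4 := key (1 / 2) (-1 / 2) (1 / 2) (by norm_num) (by norm_num) (by norm_num) (by norm_num)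
  simp only [squareX, squareY, mem_Icc]
  refine ⟨⟨?_, ?_⟩, ?_, ?_⟩ <;> linarith

variable (l : EdgeLabelling X G)

/-- The chart for a surface tiled by squares whose edges are labelled by a group. -/
def squareChart := SquareChart.ofPerms (Equiv.mulRight (l.E * l.R ^ 2)) (Equiv.mulRight (l.R * l.E * l.R))

/-- The values 0, 1, 2, 3 of `k` modulo 4 are the right, upper, left and lower side. The first two
are the defining gluings of the chart (`E * R ^ 2` and `R * E * R`), the last two are the same
gluings read from the other side. -/
theorem squareChart_identified {x y : (X.translationCover f₀).PolygonPoint}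
    (h : (X.translationCover f₀).Identified x y) :
    (squareChart l).cell (l.placed x.1.1.1) (squareX x.1.2) (squareY x.1.2) =
      (squareChart l).cell (l.placed y.1.1.1) (squareX y.1.2) (squareY y.1.2) := by
  obtain ⟨i, j, he, hn, hs, hy⟩ := translationCover_identified (by norm_num) h
  obtain ⟨k, hk, hl⟩ := l.placed_of_glued (r := 2) (by norm_num)
    (even_of_reachable (by norm_num) (by decide) x.1.1)
    (even_of_reachable (by norm_num) (by decide) y.1.1) he hn
  have hR := l.R_pow
  have hR4 : ∀ g, l.R * (l.R * (l.R * (l.R * g))) = g := fun g => by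
    simpa [pow_succ, mul_assoc] using congrArg (· * g) hR
  have hRi : l.R⁻¹ = l.R * (l.R * l.R) := by
    rw [inv_eq_iff_mul_eq_one]
    simpa [mul_assoc] using hR4 1
  have hR1 := hR4 1
  rw [mul_one] at hR1
  have hX : ∀ (u : ℝ) (z : ℂ), z.re + z.im + 1 = 2 * u → squareX z = u := fun u z h => by
    rw [squareX, h]; ring
  have hY : ∀ (u : ℝ) (z : ℂ), z.im - z.re + 1 = 2 * u → squareY z = u := fun u z h => by
    rw [squareY, h]; ring
  have hEE : ∀ g, l.E * (l.E * g) = g := fun g => by rw [← mul_assoc, l.E_mul_E, one_mul]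
  have hp4 : ∀ n, l.R ^ n = l.R ^ (n % 4) := fun n => (pow_eq_pow_mod n hR)
  rw [hk, show 2 * k + 2 = 2 * (k + 1) by ring, unitPoint_four_two_mul, unitPoint_four_two_mul,
    pow_succ, Complex.I_pow_eq_pow_mod] at hs hy
  rw [pow_add, hp4 k] at hl
  obtain ⟨t, ht, hre, him⟩ := Complex.re_im_of_mem_segment hs
  set L := l.placed x.1.1.1
  set L' := l.placed y.1.1.1
  have hright : ∀ g s, s ∈ Icc (0 : ℝ) 1 → (squareChart l).cell g 1 s =
      (squareChart l).cell (g * (l.E * l.R ^ 2)) 0 s := fun g s hs =>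
    (squareChart l).cell_right g s hs
  have hup : ∀ g s, s ∈ Icc (0 : ℝ) 1 → (squareChart l).cell g s 1 =
      (squareChart l).cell (g * (l.R * l.E * l.R)) s 0 := fun g s hs =>
    (squareChart l).cell_up g s hs
  have ht' : 1 - t ∈ Icc (0 : ℝ) 1 := ⟨by linarith [ht.2], by linarith [ht.1]⟩
  have hre' := congrArg Complex.re hy
  have him' := congrArg Complex.im hy
  have hlt := Nat.mod_lt k (show 4 > 0 by norm_num)
  interval_cases k % 4
  · simp at hre him hre' him'
    have e : L' = L * (l.E * l.R ^ 2) := by rw [hl]; simp [hRi, pow_succ, mul_assoc, hR4]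
    rw [e, hX 1 x.1.2 (by linarith), hY t x.1.2 (by linarith), hX 0 y.1.2 (by linarith),
      hY t y.1.2 (by linarith), hright _ _ ht]
  · simp at hre him hre' him'
    have e : L' = L * (l.R * l.E * l.R) := by rw [hl]; simp [hRi, pow_succ, mul_assoc, hR4]
    rw [e, hX (1 - t) x.1.2 (by linarith), hY 1 x.1.2 (by linarith),
      hX (1 - t) y.1.2 (by linarith), hY 0 y.1.2 (by linarith), hup _ _ ht']
  · simp [pow_succ] at hre him hre' him'
    have e : L = L' * (l.E * l.R ^ 2) := by
      rw [hl]; simp [pow_succ, mul_assoc, hEE, hR1]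
    rw [e, hX 0 x.1.2 (by linarith), hY (1 - t) x.1.2 (by linarith), hX 1 y.1.2 (by linarith),
      hY (1 - t) y.1.2 (by linarith), hright _ _ ht']
  · simp [pow_succ] at hre him hre' him'
    have e : L = L' * (l.R * l.E * l.R) := by
      rw [hl]; simp [hRi, pow_succ, mul_assoc, hR4, hEE, hR1]
    rw [e, hX t x.1.2 (by linarith), hY 0 x.1.2 (by linarith), hX t y.1.2 (by linarith),
      hY 1 y.1.2 (by linarith), hup _ _ ht]

/-- The map of a surface tiled by squares to the model given by its labelling. -/
def squareMap (P : (X.translationCover f₀).Point) :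
    Set G × AddCircle (1 : ℝ) × AddCircle (1 : ℝ) :=
  Quot.lift (fun x : (X.translationCover f₀).PolygonPoint =>
    (squareChart l).cell (l.placed x.1.1.1) (squareX x.1.2) (squareY x.1.2))
    (fun _ _ h => squareChart_identified l h) P

theorem squareMap_of_represents {c : (X.translationCover f₀).Face} {x : ℂ}
    {P : (X.translationCover f₀).Point} (h : (X.translationCover f₀).Represents c x P) :
    squareMap l P = (squareChart l).cell (l.placed c.1) (squareX x) (squareY x) := by
  obtain ⟨hx, rfl⟩ := h
  rfl

/-- Both conditions say that the point is a vertex of a polygon. The vertices of the squares are the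
points at integral positions, and every vertex is singular since at least five right angles meet
there. -/
theorem squareMap_eq_corner [Finite X.Face] (hX : X.IsClosedSurface)
    (hl : ∀ i, 0 < i → i < 5 → (l.E * l.R) ^ i = 1 → ¬ 8 ∣ i * 6)
    (P : (X.translationCover f₀).Point) :
    (X.translationCover f₀).IsSingular P ↔
      ∃ q ∈ (univ : Set G), squareMap l P = (squareChart l).cell q 0 0 := by
  constructor
  · intro h
    obtain ⟨⟨c, i⟩, hc⟩ := h.corners_nonempty
    have hx := square_mem_Icc hc.1
    have hpos : (squareChart l).pos (squareMap l P) = 0 := by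
      rw [squareMap_of_represents l hc, (squareChart l).pos_cell _ _ hx.1 _ hx.2]
      obtain ⟨m, hm⟩ := even_of_reachable (by norm_num) (by decide) c
      simp only [squareX, squareY]
      rw [translationCover_vertex, normalIndex, hm, ← two_mul, ← mul_add, unitPoint_four_two_mul,
        Complex.I_pow_eq_pow_mod]
      have hlt := Nat.mod_lt (m + (i : ℕ)) (show 4 > 0 by norm_num)
      interval_cases (m + (i : ℕ)) % 4 <;>
        simp [pow_succ, AddCircle.coe_period]
    rw [squareMap_of_represents l hc] at hpos ⊢
    obtain ⟨q, hq⟩ := SquareChart.exists_cell_zero_of_pos_eq_zero hx.1 hx.2 hpos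
    exact ⟨q, mem_univ _, hq⟩
  · rintro ⟨q, -, hq⟩
    refine isSingular_of_vertex (by norm_num) l hX 5 (by norm_num) hl ?_
    obtain ⟨⟨⟨c, x⟩, hx⟩, rfl⟩ := Quot.exists_rep P
    have hx' := square_mem_Icc hx
    have hpos : (squareChart l).pos ((squareChart l).cell (l.placed c.1) (squareX x) (squareY x)) = 0 := by
      have : (squareChart l).cell (l.placed c.1) (squareX x) (squareY x) = _ := hq
      rw [this, (squareChart l).pos_cell _ _ (by simp) _ (by simp)]
      rfl
    rw [(squareChart l).pos_cell _ _ hx'.1 _ hx'.2, Prod.mk_eq_zero] at hpos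
    have hev := even_of_reachable (by norm_num) (by decide) c
    have hvert : ∃ i, (X.translationCover f₀).vertex c i = x := by
      have h01 := SquareChart.eq_zero_or_one_of_coe_eq_zero hx'.1 hpos.1
      have h01' := SquareChart.eq_zero_or_one_of_coe_eq_zero hx'.2 hpos.2
      have key : ∀ k : ℕ, Complex.I ^ k = x → ∃ i, (X.translationCover f₀).vertex c i = x := by
        rintro k rfl
        rw [← unitPoint_four_two_mul]
        refine translationCover_exists_vertex c ?_
        rw [Nat.even_iff] at hev
        simp [Nat.ModEq, hev]
      simp only [squareX, squareY] at h01 h01'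
      rcases h01 with h1 | h1 <;> rcases h01' with h2 | h2
      · exact key 3 (by apply Complex.ext <;> simp [pow_succ] <;> linarith)
      · exact key 2 (by apply Complex.ext <;> simp [pow_succ] <;> linarith)
      · exact key 0 (by apply Complex.ext <;> simp <;> linarith)
      · exact key 1 (by apply Complex.ext <;> simp [pow_succ] <;> linarith)
    obtain ⟨i, rfl⟩ := hvert
    exact ⟨(c, i), hx, rfl⟩

theorem square_not_exists_isClosedSaddleConnection [Finite X.Face] (hX : X.IsClosedSurface)
    (hl : ∀ i, 0 < i → i < 5 → (l.E * l.R) ^ i = 1 → ¬ 8 ∣ i * 6)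
    {H : Perm G → Perm G → Prop} (hH : SquareChart.MoveInvariant H) {c₀ : G}
    (hc₀ : (l.E * l.R ^ 2)⁻¹ * (l.R * l.E * l.R)⁻¹ * (l.E * l.R ^ 2) * (l.R * l.E * l.R) = c₀)
    (hret : ∀ h v, H h v → SquareChart.NoReturn (Equiv.mulRight c₀) univ h)
    (hC : H (Equiv.mulRight (l.E * l.R ^ 2)) (Equiv.mulRight (l.R * l.E * l.R))) :
    ¬ ∃ γ, (X.translationCover f₀).IsClosedSaddleConnection γ := by
  refine RegularPolygonGluing.not_exists_isClosedSaddleConnection _ (squareChart l) hH (T := univ)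
    (fun q hq => absurd (mem_univ q) hq) (fun h v hv => ?_) hC (squareMap l)
    (fun z => (z.re + z.im) / 2) (fun z => (z.im - z.re) / 2) (fun z => ?_) (fun z => ?_)
    (fun z h1 h2 => ?_) (fun γ c x z ε hε h => ?_) (squareMap_eq_corner l hX hl)
  · rw [mulRight_commutator, hc₀]
    exact hret h v hv
  · simp; ring
  · simp; ring
  · apply Complex.ext <;> simp <;> linarith
  · refine ⟨l.placed c.1, squareX x, squareY x, ε, hε, fun s hs => ?_⟩
    have e1 : squareX (x + s * z) = squareX x + s * ((z.re + z.im) / 2) := by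
      simp [squareX]; ring
    have e2 : squareY (x + s * z) = squareY x + s * ((z.im - z.re) / 2) := by
      simp [squareY]; ring
    obtain ⟨hx, -⟩ := h s hs
    have hmem := square_mem_Icc hx
    rw [← e1, ← e2]
    exact ⟨hmem.1, hmem.2, squareMap_of_represents l (h s hs)⟩

end Square

end PeriodicPolyhedralSurface

end

noncomputable section

open Set Equiv

/-! ### The gluing of the five surfaces -/

/-- The permutation with a given table of values. -/
def tablePerm {n : ℕ} (f : Fin n → Fin n) : Perm (Fin n) :=
  -- The default value does not matter: for a bijective table the search always succeeds, and for
  -- any other table the test below fails.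
  let g : Fin n → Fin n := fun x => ((List.finRange n).find? fun y => f y = x).getD x
  if h : (∀ x, g (f x) = x) ∧ ∀ x, f (g x) = x then ⟨f, g, h.1, h.2⟩ else 1

namespace PeriodicPolyhedralSurface

/-- The edge `i` of the face `f` is the edge `j` of the face `g` up to a translation by an integral
vector in `L`. -/
def IntSameEdge {p : ℕ} [NeZero p] {F : Type} (V : F → Fin p → (Fin 3 → ℤ)) (L : (Fin 3 → ℤ) → Prop)
    (f : F) (i : Fin p) (g : F) (j : Fin p) : Prop :=
  V f (i + 1) - V g j = V f i - V g (j + 1) ∧ L (V f i - V g (j + 1))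

instance {p : ℕ} [NeZero p] {F : Type} (V : F → Fin p → (Fin 3 → ℤ)) (L : (Fin 3 → ℤ) → Prop)
    [DecidablePred L] (f : F) (i : Fin p) (g : F) (j : Fin p) : Decidable (IntSameEdge V L f i g j) :=
  inferInstanceAs (Decidable (_ ∧ _))

/-- This replaces real coordinates and an existential quantifier over periods by integers and a
decidable congruence, so that the combinatorics of a surface becomes a finite computation. -/
theorem sameEdge_iff {p : ℕ} [NeZero p] {X : PeriodicPolyhedralSurface p}
    {V : X.Face → Fin p → (Fin 3 → ℤ)} {D : Fin 3 → (Fin 3 → ℤ)} {L : (Fin 3 → ℤ) → Prop}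
    (hV : ∀ f i a, X.vertex f i a = V f i a) (hD : ∀ b a, X.period b a = D b a)
    (hL : ∀ u, L u ↔ ∃ m : Fin 3 → ℤ, u = ∑ b, m b • D b) (f : X.Face) (i : Fin p) (g : X.Face)
    (j : Fin p) : X.SameEdge (f, i) (g, j) ↔ IntSameEdge V L f i g j := by
  have key : ∀ (m : Fin 3 → ℤ) (i j : Fin p),
      X.vertex f i = X.vertex g j + ∑ a, (m a : ℝ) • X.period a ↔
        V f i - V g j = ∑ b, m b • D b := by
    intro m i j
    rw [sub_eq_iff_eq_add', funext_iff, funext_iff]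
    refine forall_congr' fun a => ?_
    simp only [Pi.add_apply, Finset.sum_apply, Pi.smul_apply, smul_eq_mul, hV, hD]
    exact_mod_cast Iff.rfl
  simp only [SameEdge, key, IntSameEdge, hL]
  constructor
  · rintro ⟨m, h1, h2⟩
    exact ⟨h2.trans h1.symm, m, h1⟩
  · rintro ⟨h, m, hm⟩
    exact ⟨m, hm, h.trans hm⟩

/-- The vectors all of whose coordinates are divisible by `n`. -/
def IsCubic (n : ℤ) (u : Fin 3 → ℤ) : Prop := ∀ a, u a % n = 0

instance (n : ℤ) : DecidablePred (IsCubic n) := fun _ => inferInstanceAs (Decidable (∀ _, _))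

/-- The vectors of `n` times the face-centred cubic lattice. -/
def IsFaceCentred (n : ℤ) (u : Fin 3 → ℤ) : Prop :=
  (∀ a, u a % n = 0) ∧ (u 0 + u 1 + u 2) % (2 * n) = 0

instance (n : ℤ) : DecidablePred (IsFaceCentred n) := fun _ => inferInstanceAs (Decidable (_ ∧ _))

theorem isCubic_iff (n : ℤ) (u : Fin 3 → ℤ) : IsCubic n u ↔
    ∃ m : Fin 3 → ℤ, u = ∑ b, m b • (![![n, 0, 0], ![0, n, 0], ![0, 0, n]] : Fin 3 → Fin 3 → ℤ) b := by
  simp only [IsCubic, Fin.forall_fin_succ, Fin.sum_univ_three, funext_iff]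
  constructor
  · rintro ⟨h0, h1, h2, -⟩
    obtain ⟨x, hx⟩ := Int.dvd_of_emod_eq_zero h0
    obtain ⟨y, hy⟩ := Int.dvd_of_emod_eq_zero h1
    obtain ⟨z, hz⟩ := Int.dvd_of_emod_eq_zero h2
    refine ⟨![x, y, z], ?_⟩
    simp at hx hy hz ⊢
    simp [hx, hy, hz, mul_comm]
  · rintro ⟨m, h⟩
    simp at h ⊢
    simp [h]

theorem isFaceCentred_iff (n : ℤ) (u : Fin 3 → ℤ) : IsFaceCentred n u ↔
    ∃ m : Fin 3 → ℤ, u = ∑ b, m b • (![![0, n, n], ![n, 0, n], ![n, n, 0]] : Fin 3 → Fin 3 → ℤ) b := by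
  simp only [IsFaceCentred, Fin.forall_fin_succ, Fin.sum_univ_three, funext_iff]
  constructor
  · rintro ⟨⟨h0, h1, h2, -⟩, h3⟩
    obtain ⟨x, hx⟩ := Int.dvd_of_emod_eq_zero h0
    obtain ⟨y, hy⟩ := Int.dvd_of_emod_eq_zero h1
    obtain ⟨z, hz⟩ := Int.dvd_of_emod_eq_zero h2
    obtain ⟨w, hw⟩ := Int.dvd_of_emod_eq_zero h3
    -- The sum of the coefficients is `w`, and the coordinate in direction `a` is `n` times the sum
    -- of the other two coefficients.
    refine ⟨![w - x, w - y, w - z], ?_⟩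
    simp at hx hy hz ⊢
    refine ⟨?_, ?_, ?_⟩ <;> linarith
  · rintro ⟨m, h⟩
    simp at h ⊢
    obtain ⟨h0, h1, h2⟩ := h
    refine ⟨⟨?_, ?_, ?_⟩, ?_⟩
    · rw [h0, ← add_mul]; exact dvd_mul_left _ _
    · rw [h1, ← add_mul]; exact dvd_mul_left _ _
    · rw [h2, ← add_mul]; exact dvd_mul_left _ _
    · rw [h0, h1, h2]; exact ⟨m 0 + m 1 + m 2, by ring⟩

/-! #### Mucube -/

theorem mucube_sameEdge_iff (f i g j) :
    mucube.SameEdge (f, i) (g, j) ↔ IntSameEdge mucubeVertex (IsCubic 2) f i g j := by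
  refine sameEdge_iff (X := mucube) (fun _ _ _ => rfl) (fun b a => ?_) (isCubic_iff 2) f i g j
  fin_cases b <;> fin_cases a <;> simp [mucube]

/-- The edge labels of Mucube. -/
def mucubeLabel : Fin 3 → Fin 4 → Fin 4 → Fin 4 :=
  ![![![0, 1, 2, 3], ![2, 0, 3, 1], ![3, 2, 1, 0], ![1, 3, 0, 2]],
    ![![3, 1, 0, 2], ![0, 3, 2, 1], ![2, 0, 1, 3], ![1, 2, 3, 0]],
    ![![2, 1, 3, 0], ![3, 2, 0, 1], ![0, 3, 1, 2], ![1, 0, 2, 3]]]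

theorem isClosedSurface_mucube : mucube.IsClosedSurface := by
  have h : ∀ f i, ∃ g j, IntSameEdge mucubeVertex (IsCubic 2) f i g j := by decide +kernel
  intro f i
  obtain ⟨g, j, h⟩ := h f i
  exact ⟨g, j, (mucube_sameEdge_iff f i g j).2 h⟩

/-- Here `R` is a 4-cycle, `E` a transposition and `E * R` has order 3. After three corners the
label at a vertex returns, but the direction does not: 8 does not divide 18. -/
def mucubeLabelling : EdgeLabelling mucube (Perm (Fin 4)) where
  face f := tablePerm (mucubeLabel f.1 f.2)
  R := tablePerm ![1, 2, 3, 0]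
  E := tablePerm ![0, 1, 3, 2]
  R_pow := by decide +kernel
  E_mul_E := by decide +kernel
  sameEdge := by
    have h : ∀ f i g j, IntSameEdge mucubeVertex (IsCubic 2) f i g j →
        tablePerm (mucubeLabel f.1 f.2) * tablePerm ![1, 2, 3, 0] ^ (i : ℕ) * tablePerm ![0, 1, 3, 2] =
          tablePerm (mucubeLabel g.1 g.2) * tablePerm ![1, 2, 3, 0] ^ (j : ℕ) := by
      decide +kernel
    exact fun f i g j hs => h f i g j ((mucube_sameEdge_iff f i g j).1 hs)

/-! #### Muoctahedron -/

theorem muoctahedron_sameEdge_iff (f i g j) :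
    muoctahedron.SameEdge (f, i) (g, j) ↔ IntSameEdge muoctahedronVertex (IsCubic 4) f i g j := by
  refine sameEdge_iff (X := muoctahedron) (fun _ _ _ => rfl) (fun b a => ?_) (isCubic_iff 4) f i g j
  fin_cases b <;> fin_cases a <;> simp [muoctahedron]

/-- The edge labels of Muoctahedron. -/
def muoctahedronLabel : Fin 4 ⊕ Fin 4 → Fin 4 → Fin 4 :=
  Sum.elim ![![0, 1, 2, 3], ![3, 2, 1, 0], ![2, 3, 0, 1], ![1, 0, 3, 2]]
    ![![0, 3, 2, 1], ![3, 0, 1, 2], ![2, 1, 0, 3], ![1, 2, 3, 0]]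

theorem isClosedSurface_muoctahedron : muoctahedron.IsClosedSurface := by
  have h : ∀ f i, ∃ g j, IntSameEdge muoctahedronVertex (IsCubic 4) f i g j := by decide +kernel
  intro f i
  obtain ⟨g, j, h⟩ := h f i
  exact ⟨g, j, (muoctahedron_sameEdge_iff f i g j).2 h⟩

/-- Here `R` has order 3 although the faces have six edges, so opposite edges of a hexagon have the
same label. All crossings are odd, as `E` is a transposition and `R` is even; `E * R` is a 4-cycle.
-/
def muoctahedronLabelling : EdgeLabelling muoctahedron (Perm (Fin 4)) where
  face f := tablePerm (muoctahedronLabel f)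
  R := tablePerm ![0, 2, 3, 1]
  E := tablePerm ![1, 0, 2, 3]
  R_pow := by decide +kernel
  E_mul_E := by decide +kernel
  sameEdge := by
    have h : ∀ f i g j, IntSameEdge muoctahedronVertex (IsCubic 4) f i g j →
        tablePerm (muoctahedronLabel f) * tablePerm ![0, 2, 3, 1] ^ (i : ℕ) * tablePerm ![1, 0, 2, 3] =
          tablePerm (muoctahedronLabel g) * tablePerm ![0, 2, 3, 1] ^ (j : ℕ) := by
      decide +kernel
    exact fun f i g j hs => h f i g j ((muoctahedron_sameEdge_iff f i g j).1 hs)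

/-! #### Mutetrahedron -/

/-- The vertices of the faces of Mutetrahedron, as integral vectors. -/
def mutetrahedronVertex (d : Fin 4) (i : Fin 6) : Fin 3 → ℤ := tetraSign d * truncatedHexagon i

theorem mutetrahedron_sameEdge_iff (f i g j) :
    mutetrahedron.SameEdge (f, i) (g, j) ↔
      IntSameEdge mutetrahedronVertex (IsFaceCentred 4) f i g j := by
  refine sameEdge_iff (X := mutetrahedron) (fun _ _ _ => rfl) (fun b a => ?_) (isFaceCentred_iff 4) f i g j
  fin_cases b <;> fin_cases a <;> simp [mutetrahedron]

/-- The edge labels of Mutetrahedron. -/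
def mutetrahedronLabel : Fin 4 → Fin 4 → Fin 4 :=
  ![![0, 1, 2, 3], ![3, 2, 1, 0], ![1, 0, 3, 2], ![2, 3, 0, 1]]

theorem isClosedSurface_mutetrahedron : mutetrahedron.IsClosedSurface := by
  have h : ∀ f i, ∃ g j, IntSameEdge mutetrahedronVertex (IsFaceCentred 4) f i g j := by
    decide +kernel
  intro f i
  obtain ⟨g, j, h⟩ := h f i
  exact ⟨g, j, (mutetrahedron_sameEdge_iff f i g j).2 h⟩

/-- Here `E * R` has order 3, and three angles of a hexagon make `2 * π`. This labelling therefore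
sees the vertices as regular points: its model is flat, which helps with the direction of paths, and
singularity needs the other labelling below. -/
def mutetrahedronLabelling : EdgeLabelling mutetrahedron (Perm (Fin 4)) where
  face f := tablePerm (mutetrahedronLabel f)
  R := tablePerm ![0, 2, 3, 1]
  E := tablePerm ![1, 0, 3, 2]
  R_pow := by decide +kernel
  E_mul_E := by decide +kernel
  sameEdge := by
    have h : ∀ f i g j, IntSameEdge mutetrahedronVertex (IsFaceCentred 4) f i g j →
        tablePerm (mutetrahedronLabel f) * tablePerm ![0, 2, 3, 1] ^ (i : ℕ) * tablePerm ![1, 0, 3, 2] =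
          tablePerm (mutetrahedronLabel g) * tablePerm ![0, 2, 3, 1] ^ (j : ℕ) := by
      decide +kernel
    exact fun f i g j hs => h f i g j ((mutetrahedron_sameEdge_iff f i g j).1 hs)

/-- The labelling of the edges of Mutetrahedron by the parity of their numbers. -/
def mutetrahedronParity : EdgeLabelling mutetrahedron ℤˣ where
  face _ := 1
  R := -1
  E := 1
  R_pow := by decide +kernel
  E_mul_E := by decide +kernel
  sameEdge := by
    have h : ∀ f i g j, IntSameEdge mutetrahedronVertex (IsFaceCentred 4) f i g j →
        (1 : ℤˣ) * (-1) ^ (i : ℕ) * 1 = 1 * (-1) ^ (j : ℕ) := by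
      decide +kernel
    exact fun f i g j hs => h f i g j ((mutetrahedron_sameEdge_iff f i g j).1 hs)

/-! #### Octa-4 -/

theorem octa4_sameEdge_iff (f i g j) :
    octa4.SameEdge (f, i) (g, j) ↔ IntSameEdge octa4Vertex (IsFaceCentred 8) f i g j := by
  refine sameEdge_iff (X := octa4) (fun _ _ _ => rfl) (fun b a => ?_) (isFaceCentred_iff 8) f i g j
  fin_cases b <;> fin_cases a <;> simp [octa4]

/-- The edge labels of Octa-4. -/
def octa4Label : (Fin 4 × Fin 3 ⊕ Fin 4 × Fin 3) ⊕ (Fin 4 ⊕ Fin 4) → Fin 4 → Fin 4 :=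
  Sum.elim
    (Sum.elim (fun f => ![![0, 1, 2, 3], ![3, 1, 0, 2], ![2, 1, 3, 0]] f.2)
      (fun f => ![![0, 1, 3, 2], ![3, 1, 2, 0], ![2, 1, 0, 3]] f.2))
    (Sum.elim (fun _ => ![1, 3, 0, 2]) (fun _ => ![1, 2, 0, 3]))

theorem isClosedSurface_octa4 : octa4.IsClosedSurface := by
  have h : ∀ f i, ∃ g j, IntSameEdge octa4Vertex (IsFaceCentred 8) f i g j := by decide +kernel
  intro f i
  obtain ⟨g, j, h⟩ := h f i
  exact ⟨g, j, (octa4_sameEdge_iff f i g j).2 h⟩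

/-- Here `E * R` is a 4-cycle. After four corners the label returns without the direction: 6 does
not divide 20. -/
def octa4Labelling : EdgeLabelling octa4 (Perm (Fin 4)) where
  face f := tablePerm (octa4Label f)
  R := tablePerm ![0, 2, 3, 1]
  E := tablePerm ![1, 0, 2, 3]
  R_pow := by decide +kernel
  E_mul_E := by decide +kernel
  sameEdge := by
    have h : ∀ f i g j, IntSameEdge octa4Vertex (IsFaceCentred 8) f i g j →
        tablePerm (octa4Label f) * tablePerm ![0, 2, 3, 1] ^ (i : ℕ) * tablePerm ![1, 0, 2, 3] =
          tablePerm (octa4Label g) * tablePerm ![0, 2, 3, 1] ^ (j : ℕ) := by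
      decide +kernel
    exact fun f i g j hs => h f i g j ((octa4_sameEdge_iff f i g j).1 hs)

/-! #### Truncated Octa-8 -/

theorem irrational_sqrt_two_div_three : Irrational (Real.sqrt (2 / 3)) := by
  have h : Real.sqrt (2 / 3) = Real.sqrt (6 : ℕ) / (3 : ℕ) := by
    rw [show (2 / 3 : ℝ) = (6 : ℕ) / (3 : ℕ) ^ 2 by norm_num, Real.sqrt_div (by norm_num),
      Real.sqrt_sq (by norm_num)]
  rw [h]
  refine Irrational.div_natCast ?_ three_ne_zero
  rw [irrational_sqrt_natCast_iff]
  rintro ⟨n, hn⟩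
  have : n < 3 := by nlinarith
  interval_cases n <;> omega

theorem add_sqrt_mul_eq_iff (u w u' w' : ℤ) :
    (u : ℝ) + Real.sqrt (2 / 3) * w = u' + Real.sqrt (2 / 3) * w' ↔ u = u' ∧ w = w' := by
  constructor
  · intro h
    have hw : w = w' := by
      by_contra hw
      have h1 : ((w - w' : ℤ) : ℝ) ≠ 0 := by exact_mod_cast sub_ne_zero.2 hw
      refine irrational_sqrt_two_div_three ⟨((u' - u : ℤ) : ℚ) / ((w - w' : ℤ) : ℚ), ?_⟩
      push_cast at h1 ⊢
      rw [div_eq_iff h1]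
      linarith
    subst hw
    exact ⟨by exact_mod_cast add_right_cancel h, rfl⟩
  · rintro ⟨rfl, rfl⟩
    rfl

/-- For the pairs `(u, w)` that stand for `u + √(2/3) * w`, the difference is a period. -/
def OctaCongr (x y : (Fin 3 → ℤ) × (Fin 3 → ℤ)) : Prop :=
  (∀ a, x.1 a - 2 * x.2 a = y.1 a - 2 * y.2 a) ∧
    (x.2 1 - y.2 1 - (x.2 0 - y.2 0)) % 2 = 0 ∧ (x.2 2 - y.2 2 - (x.2 0 - y.2 0)) % 2 = 0

instance (x y) : Decidable (OctaCongr x y) := inferInstanceAs (Decidable (_ ∧ _ ∧ _))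

/-- The edges of Truncated Octa-8 agree up to a period. -/
def OctaSameEdge (f : (Fin 3 ⊕ Fin 3) ⊕ Fin 4 × Fin 6) (i : Fin 4)
    (g : (Fin 3 ⊕ Fin 3) ⊕ Fin 4 × Fin 6) (j : Fin 4) : Prop :=
  OctaCongr (truncatedOcta8Vertex f i) (truncatedOcta8Vertex g (j + 1)) ∧
  OctaCongr (truncatedOcta8Vertex f (i + 1)) (truncatedOcta8Vertex g j) ∧
  ∀ a, (truncatedOcta8Vertex f i).2 a - (truncatedOcta8Vertex g (j + 1)).2 a =
    (truncatedOcta8Vertex f (i + 1)).2 a - (truncatedOcta8Vertex g j).2 a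

instance (f i g j) : Decidable (OctaSameEdge f i g j) := inferInstanceAs (Decidable (_ ∧ _ ∧ _))

/-- A period is `(2 + √(2/3)) * v` with `v` integral, so its rational and irrational parts are `2 *
v` and `v`. By irrationality the two parts can be compared separately. -/
theorem truncatedOcta8_vertex_eq_iff (f g : truncatedOcta8.Face) (i j : Fin 4)
    (m : Fin 3 → ℤ) :
    truncatedOcta8.vertex f i =
        truncatedOcta8.vertex g j + ∑ a, (m a : ℝ) • truncatedOcta8.period a ↔
      ∀ a, (truncatedOcta8Vertex f i).1 a - 2 * (truncatedOcta8Vertex f i).2 a =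
          (truncatedOcta8Vertex g j).1 a - 2 * (truncatedOcta8Vertex g j).2 a ∧
        (truncatedOcta8Vertex f i).2 a - (truncatedOcta8Vertex g j).2 a =
          ![-m 0 + m 1 + m 2, m 0 - m 1 + m 2, m 0 + m 1 - m 2] a := by
  rw [funext_iff]
  refine forall_congr' fun a => ?_
  have hD : (∑ b, (m b : ℝ) • truncatedOcta8.period b) a = (2 + Real.sqrt (2 / 3)) *
      ((![-m 0 + m 1 + m 2, m 0 - m 1 + m 2, m 0 + m 1 - m 2] a : ℤ) : ℝ) := by
    fin_cases a <;> simp [truncatedOcta8, Fin.sum_univ_three] <;> ring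
  have hv : ∀ f i, truncatedOcta8.vertex f i a = ((truncatedOcta8Vertex f i).1 a : ℝ) +
      Real.sqrt (2 / 3) * ((truncatedOcta8Vertex f i).2 a : ℝ) := fun _ _ => rfl
  rw [Pi.add_apply, hD, hv, hv]
  generalize ![-m 0 + m 1 + m 2, m 0 - m 1 + m 2, m 0 + m 1 - m 2] a = v
  have e : ∀ u w : ℤ, (u : ℝ) + Real.sqrt (2 / 3) * w + (2 + Real.sqrt (2 / 3)) * v =
      ((u + 2 * v : ℤ) : ℝ) + Real.sqrt (2 / 3) * ((w + v : ℤ) : ℝ) := fun u w => by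
    push_cast; ring
  rw [e, add_sqrt_mul_eq_iff]
  constructor <;> rintro ⟨h1, h2⟩ <;> constructor <;> linarith

/-- The body-centred lattice consists of the vectors whose coordinates have the same parity; the
coefficients are half sums of two coordinates. -/
theorem eq_of_same_parity (v : Fin 3 → ℤ) (h1 : (v 1 - v 0) % 2 = 0) (h2 : (v 2 - v 0) % 2 = 0)
    (a : Fin 3) : v a = (fun m : Fin 3 → ℤ => ![-m 0 + m 1 + m 2, m 0 - m 1 + m 2, m 0 + m 1 - m 2])
      ![(v 1 + v 2) / 2, (v 2 + v 0) / 2, (v 0 + v 1) / 2] a := by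
  fin_cases a <;> simp <;> omega

theorem truncatedOcta8_sameEdge_iff (f : truncatedOcta8.Face) (i : Fin 4) (g : truncatedOcta8.Face)
    (j : Fin 4) :
    truncatedOcta8.SameEdge (f, i) (g, j) ↔ OctaSameEdge f i g j := by
  constructor
  · rintro ⟨m, h1, h2⟩
    replace h1 := (truncatedOcta8_vertex_eq_iff f g i (j + 1) m).1 h1
    replace h2 := (truncatedOcta8_vertex_eq_iff f g (i + 1) j m).1 h2
    have h10 := (h1 0).2
    have h11 := (h1 1).2
    have h12 := (h1 2).2
    have h20 := (h2 0).2
    have h21 := (h2 1).2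
    have h22 := (h2 2).2
    refine ⟨⟨fun a => (h1 a).1, ?_, ?_⟩, ⟨fun a => (h2 a).1, ?_, ?_⟩,
      fun a => (h1 a).2.trans (h2 a).2.symm⟩ <;> simp at h10 h11 h12 h20 h21 h22 <;> omega
  · rintro ⟨⟨h1, h2, h3⟩, ⟨h4, h5, h6⟩, h7⟩
    have h := eq_of_same_parity
      (fun a => (truncatedOcta8Vertex f i).2 a - (truncatedOcta8Vertex g (j + 1)).2 a) h2 h3
    exact ⟨_, (truncatedOcta8_vertex_eq_iff f g i (j + 1) _).2 fun a => ⟨h1 a, h a⟩,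
      (truncatedOcta8_vertex_eq_iff f g (i + 1) j _).2 fun a => ⟨h4 a, (h7 a).symm.trans (h a)⟩⟩

/-- The edge labels of Truncated Octa-8. -/
def truncatedOcta8Label : (Fin 3 ⊕ Fin 3) ⊕ Fin 4 × Fin 6 → Fin 5 → Fin 5 :=
  Sum.elim
    (Sum.elim ![![0, 1, 2, 3, 4], ![0, 4, 1, 3, 2], ![0, 2, 4, 3, 1]]
      ![![0, 2, 1, 4, 3], ![0, 1, 4, 2, 3], ![0, 4, 2, 1, 3]])
    (fun f => ![![![2, 0, 4, 3, 1], ![4, 3, 1, 0, 2], ![1, 0, 2, 3, 4],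
        ![2, 3, 4, 0, 1], ![4, 0, 1, 3, 2], ![1, 3, 2, 0, 4]],
      ![![4, 0, 2, 1, 3], ![2, 1, 3, 0, 4], ![3, 0, 4, 1, 2],
        ![4, 1, 2, 0, 3], ![2, 0, 3, 1, 4], ![3, 1, 4, 0, 2]],
      ![![1, 0, 3, 4, 2], ![3, 4, 2, 0, 1], ![2, 0, 1, 4, 3],
        ![1, 4, 3, 0, 2], ![3, 0, 2, 4, 1], ![2, 4, 1, 0, 3]],
      ![![3, 0, 1, 2, 4], ![1, 2, 4, 0, 3], ![4, 0, 3, 2, 1],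
        ![3, 2, 1, 0, 4], ![1, 0, 4, 2, 3], ![4, 2, 3, 0, 1]]] f.1 f.2)

theorem isClosedSurface_truncatedOcta8 : truncatedOcta8.IsClosedSurface := by
  have h : ∀ f i, ∃ g j, OctaSameEdge f i g j := by decide +kernel
  intro f i
  obtain ⟨g, j, h⟩ := h f i
  exact ⟨g, j, (truncatedOcta8_sameEdge_iff f i g j).2 h⟩

def truncatedOcta8Labelling : EdgeLabelling truncatedOcta8 (Perm (Fin 5)) where
  face f := tablePerm (truncatedOcta8Label f)
  R := tablePerm ![0, 2, 3, 4, 1]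
  E := tablePerm ![1, 0, 2, 3, 4]
  R_pow := by decide +kernel
  E_mul_E := by decide +kernel
  sameEdge := by
    have h : ∀ f i g j, OctaSameEdge f i g j →
        tablePerm (truncatedOcta8Label f) * tablePerm ![0, 2, 3, 4, 1] ^ (i : ℕ) *
            tablePerm ![1, 0, 2, 3, 4] =
          tablePerm (truncatedOcta8Label g) * tablePerm ![0, 2, 3, 4, 1] ^ (j : ℕ) := by
      decide +kernel
    exact fun f i g j hs => h f i g j ((truncatedOcta8_sameEdge_iff f i g j).1 hs)

end PeriodicPolyhedralSurface

end

noncomputable section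

open Set Equiv

/-! ### Coordinates adapted to triangles and hexagons -/

/-- The primitive sixth root of unity in the upper right quadrant. -/
def sixthRoot : ℂ := ⟨1 / 2, Real.sqrt 3 / 2⟩

/-- The first coordinate with respect to the basis `1`, `sixthRoot`. -/
def hexX : ℂ →ₗ[ℝ] ℝ := Complex.reLm - (Real.sqrt 3)⁻¹ • Complex.imLm

/-- The second coordinate with respect to the basis `1`, `sixthRoot`. -/
def hexY : ℂ →ₗ[ℝ] ℝ := (2 * (Real.sqrt 3)⁻¹) • Complex.imLm

theorem hexX_apply (z : ℂ) : hexX z = z.re - (Real.sqrt 3)⁻¹ * z.im := rfl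

theorem hexY_apply (z : ℂ) : hexY z = 2 * (Real.sqrt 3)⁻¹ * z.im := rfl

theorem inv_sqrt_three_pos : 0 < (Real.sqrt 3)⁻¹ := by positivity

theorem hex_ext {z w : ℂ} (h1 : hexX z = hexX w) (h2 : hexY z = hexY w) : z = w := by
  have h := inv_sqrt_three_pos
  simp only [hexX_apply, hexY_apply] at h1 h2
  have him : z.im = w.im := mul_left_cancel₀ (by positivity) h2
  rw [him] at h1
  exact Complex.ext (by linarith) him

@[simp] theorem hexX_one : hexX 1 = 1 := by simp [hexX_apply]

@[simp] theorem hexY_one : hexY 1 = 0 := by simp [hexY_apply]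

@[simp] theorem hexX_sixthRoot : hexX sixthRoot = 0 := by
  have : (Real.sqrt 3) ≠ 0 := by positivity
  simp only [hexX_apply, sixthRoot]
  field_simp
  ring

@[simp] theorem hexY_sixthRoot : hexY sixthRoot = 1 := by
  have : (Real.sqrt 3) ≠ 0 := by positivity
  simp only [hexY_apply, sixthRoot]
  field_simp

theorem hexX_ofReal_mul (s : ℝ) (z : ℂ) : hexX (s * z) = s * hexX z := by
  rw [← Complex.real_smul, map_smul, smul_eq_mul]

theorem hexY_ofReal_mul (s : ℝ) (z : ℂ) : hexY (s * z) = s * hexY z := by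
  rw [← Complex.real_smul, map_smul, smul_eq_mul]

theorem sixthRoot_pow_two : sixthRoot ^ 2 = sixthRoot - 1 := by
  have : Real.sqrt 3 * Real.sqrt 3 = 3 := Real.mul_self_sqrt (by norm_num)
  apply Complex.ext <;> simp [sixthRoot, pow_two]
  · linarith
  · ring

theorem sixthRoot_pow_three : sixthRoot ^ 3 = -1 := by
  rw [pow_succ, sixthRoot_pow_two, sub_mul, ← pow_two, sixthRoot_pow_two]; ring

theorem sixthRoot_pow_four : sixthRoot ^ 4 = -sixthRoot := by
  rw [pow_succ, sixthRoot_pow_three]; ring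

theorem sixthRoot_pow_five : sixthRoot ^ 5 = 1 - sixthRoot := by
  rw [pow_succ, sixthRoot_pow_four, neg_mul, ← pow_two, sixthRoot_pow_two]; ring

theorem sixthRoot_pow_six : sixthRoot ^ 6 = 1 := by
  rw [show 6 = 3 * 2 by norm_num, pow_mul, sixthRoot_pow_three]; norm_num

theorem sixthRoot_pow_mod (k : ℕ) : sixthRoot ^ k = sixthRoot ^ (k % 6) :=
  pow_eq_pow_mod k sixthRoot_pow_six

theorem unitPoint_three (n : ℕ) : unitPoint 3 n = sixthRoot ^ n := by
  rw [← one_mul n, unitPoint_mul, one_mul]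
  congr 1
  rw [unitPoint, Complex.exp_mul_I, ← Complex.ofReal_cos, ← Complex.ofReal_sin]
  simp only [Nat.cast_one, mul_one, Nat.cast_ofNat, Real.cos_pi_div_three, Real.sin_pi_div_three]
  apply Complex.ext <;> simp [sixthRoot]

theorem unitPoint_six_two_mul (n : ℕ) : unitPoint 6 (2 * n) = sixthRoot ^ n := by
  rw [← unitPoint_three, unitPoint, unitPoint]
  push_cast
  congr 2
  ring

theorem RegularPolygonGluing.hex_nonneg_of_vertex {p : ℕ} [NeZero p] {S : RegularPolygonGluing p}
    {f : S.Face} (α β δ : ℝ) (h : ∀ i, 0 ≤ α * hexX (S.vertex f i) + β * hexY (S.vertex f i) + δ)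
    {x : ℂ} (hx : x ∈ S.polygon f) : 0 ≤ α * hexX x + β * hexY x + δ := by
  have key : ∀ z : ℂ, α * hexX z + β * hexY z + δ =
      α * z.re + (2 * β - α) * (Real.sqrt 3)⁻¹ * z.im + δ := fun z => by
    rw [hexX_apply, hexY_apply]; ring
  rw [key]
  exact S.affine_nonneg_of_vertex _ _ _ (fun i => by rw [← key]; exact h i) hx

theorem hex_of_mem_segment {x v w : ℂ} (h : x ∈ segment ℝ v w) :
    ∃ t ∈ Icc (0 : ℝ) 1, hexX x = hexX v + t * (hexX w - hexX v) ∧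
      hexY x = hexY v + t * (hexY w - hexY v) := by
  rw [segment_eq_image'] at h
  obtain ⟨t, ht, rfl⟩ := h
  exact ⟨t, ht, by simp [hexX_ofReal_mul], by simp [hexY_ofReal_mul]⟩

namespace PeriodicPolyhedralSurface

/-! ### Surfaces tiled by triangles -/

section Triangle

variable {X : PeriodicPolyhedralSurface 3} {f₀ : X.Face} {G : Type} [Group G]

/-- The first coordinate in a unit square of a point of an equilateral triangle whose turning index
is `m`; the square consists of two triangles. -/
def triangleX (m : ℕ) (z : ℂ) : ℝ := (2 * hexX z + hexY z + 1 + (m % 2 : ℕ)) / 3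

/-- The second coordinate in a unit square of a point of an equilateral triangle. -/
def triangleY (m : ℕ) (z : ℂ) : ℝ := (hexY z - hexX z + 1 + (m % 2 : ℕ)) / 3

theorem triangle_mem_Icc {c : (X.translationCover f₀).Face} {x : ℂ}
    (hx : x ∈ (X.translationCover f₀).polygon c) :
    triangleX c.1.2 x ∈ Icc (0 : ℝ) 1 ∧ triangleY c.1.2 x ∈ Icc (0 : ℝ) 1 ∧
      ((c.1.2 : ℕ) % 2 = 0 → triangleX c.1.2 x + triangleY c.1.2 x ≤ 1) ∧
      ((c.1.2 : ℕ) % 2 = 1 → 1 ≤ triangleX c.1.2 x + triangleY c.1.2 x) := by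
  have key : ∀ α β δ : ℝ, (∀ n < 6, n % 2 = (c.1.2 : ℕ) % 2 →
      0 ≤ α * hexX (sixthRoot ^ n) + β * hexY (sixthRoot ^ n) + δ) →
      0 ≤ α * hexX x + β * hexY x + δ := by
    intro α β δ h
    refine RegularPolygonGluing.hex_nonneg_of_vertex α β δ (fun i => ?_) hx
    rw [translationCover_vertex, unitPoint_three, sixthRoot_pow_mod]
    exact h _ (Nat.mod_lt _ (by norm_num)) (by simp only [normalIndex]; omega)
  have key2 : ∀ α β δ : ℝ, (∀ n < 6, n % 2 = (c.1.2 : ℕ) % 2 →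
      0 ≤ α * triangleX c.1.2 (sixthRoot ^ n) + β * triangleY c.1.2 (sixthRoot ^ n) + δ) →
      0 ≤ α * triangleX c.1.2 x + β * triangleY c.1.2 x + δ := by
    intro α β δ h
    have e : ∀ z, α * triangleX c.1.2 z + β * triangleY c.1.2 z + δ = (2 * α - β) / 3 * hexX z +
        (α + β) / 3 * hexY z + ((α + β) * (1 + ((c.1.2 : ℕ) % 2 : ℕ)) / 3 + δ) := fun z => by
      rw [triangleX, triangleY]; ring
    rw [e]
    exact key _ _ _ fun n hn hn' => by rw [← e]; exact h n hn hn'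
  have key3 : ∀ α β δ : ℝ, 0 ≤ α + δ → 0 ≤ β + δ → ((c.1.2 : ℕ) % 2 = 0 → 0 ≤ δ) →
      ((c.1.2 : ℕ) % 2 = 1 → 0 ≤ α + β + δ) →
      0 ≤ α * triangleX c.1.2 x + β * triangleY c.1.2 x + δ := by
    intro α β δ h1 h2 h3 h4
    refine key2 α β δ fun n hn hn' => ?_
    interval_cases n <;> simp only [triangleX, triangleY, ← hn', sixthRoot_pow_two,
      sixthRoot_pow_three, sixthRoot_pow_four, sixthRoot_pow_five] <;> norm_num at hn' ⊢ <;>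
      first
        | linarith [h3 hn'.symm]
        | linarith [h4 hn'.symm]
  have h1 := key3 1 0 0 (by norm_num) (by norm_num) (by norm_num) (by norm_num)
  have h2 := key3 (-1) 0 1 (by norm_num) (by norm_num) (by norm_num) (by norm_num)
  have h3 := key3 0 1 0 (by norm_num) (by norm_num) (by norm_num) (by norm_num)
  have h4 := key3 0 (-1) 1 (by norm_num) (by norm_num) (by norm_num) (by norm_num)
  refine ⟨⟨?_, ?_⟩, ⟨?_, ?_⟩, fun hm => ?_, fun hm => ?_⟩ <;> try linarith
  · have := key3 (-1) (-1) 1 (by norm_num) (by norm_num) (by norm_num) (by simp [hm])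
    linarith
  · have := key3 1 1 (-1) (by norm_num) (by norm_num) (by simp [hm]) (by norm_num)
    linarith

variable (l : EdgeLabelling X G)

namespace EdgeLabelling

/-- The passage across an edge with normal index `n`. -/
def cross (n : ℕ) : G := (l.R ^ n)⁻¹ * l.E * l.R ^ n

theorem cross_mul_cross (n : ℕ) : l.cross n * l.cross n = 1 := by
  have : l.cross n * l.cross n = (l.R ^ n)⁻¹ * (l.E * l.E) * l.R ^ n := by
    rw [cross]; group
  rw [this, l.E_mul_E]; group

theorem cross_zero : l.cross 0 = l.E := by simp [cross]

theorem cross_congr {m n : ℕ} (h : m % 3 = n % 3) : l.cross m = l.cross n := by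
  have : l.R ^ m = l.R ^ n := pow_eq_pow_of_modEq h l.R_pow
  rw [cross, cross, this]

/-- The label of a placed triangle. -/
def turned (c : X.PlacedFace) : G := l.face c.1 * l.R ^ (c.2 : ℕ)

/-- Modulo 3 the exponent `-m / 2` is `m`, so `turned` is the label of the edge whose normal index
is divisible by 3, that is, of the diagonal of the square. Half turns are invisible modulo 3, so a
triangle and its neighbour are treated alike. -/
theorem turned_of_glued {c c' : X.PlacedFace} {i j : Fin 3} (h : X.SameEdge (c.1, i) (c'.1, j))
    (hn : X.normalIndex c' j ≡ X.normalIndex c i + 3 [MOD 2 * 3]) :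
    l.turned c' = l.turned c * l.cross (X.normalIndex c i) := by
  have h3 := l.sameEdge _ _ _ _ h
  have hR := l.R_pow
  have e1 : l.R ^ (c.2 : ℕ) * (l.R ^ X.normalIndex c i)⁻¹ = l.R ^ (i : ℕ) := by
    rw [mul_inv_eq_iff_eq_mul, ← pow_add]
    exact pow_eq_pow_of_modEq (by simp only [Nat.ModEq, normalIndex]; omega) hR
  have e2 : l.R ^ (j : ℕ) * l.R ^ X.normalIndex c i = l.R ^ (c'.2 : ℕ) := by
    rw [← pow_add]
    refine pow_eq_pow_of_modEq ?_ hR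
    simp only [Nat.ModEq, normalIndex] at hn ⊢
    omega
  rw [turned, turned, cross, ← e2, ← mul_assoc, ← h3, ← e1]
  group

/-- The label of the square that contains a placed triangle. -/
def triangleSquare (c : X.PlacedFace) : G := l.turned c * l.E ^ ((c.2 : ℕ) % 2)

end EdgeLabelling

/-- The chart for a surface tiled by triangles whose edges are labelled by a group. -/
def triangleChart := SquareChart.ofPerms (Equiv.mulRight (l.E * l.cross 2))
  (Equiv.mulRight (l.E * l.cross 1))

/-- Normal indices 0 and 3 belong to the diagonal between the two triangles of a square. Indices 1
and 4 are passages upwards and downwards, and 5 and 2 are passages to the right and to the left. -/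
theorem triangleChart_identified {x y : (X.translationCover f₀).PolygonPoint}
    (h : (X.translationCover f₀).Identified x y) :
    (triangleChart l).cell (l.triangleSquare x.1.1.1) (triangleX x.1.1.1.2 x.1.2)
        (triangleY x.1.1.1.2 x.1.2) =
      (triangleChart l).cell (l.triangleSquare y.1.1.1) (triangleX y.1.1.1.2 y.1.2)
        (triangleY y.1.1.1.2 y.1.2) := by
  obtain ⟨i, j, he, hn, hs, hy⟩ := translationCover_identified (by norm_num) h
  have hl := l.turned_of_glued he hn
  have hright : ∀ g s, s ∈ Icc (0 : ℝ) 1 → (triangleChart l).cell g 1 s =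
      (triangleChart l).cell (g * (l.E * l.cross 2)) 0 s := fun g s hs =>
    (triangleChart l).cell_right g s hs
  have hup : ∀ g s, s ∈ Icc (0 : ℝ) 1 → (triangleChart l).cell g s 1 =
      (triangleChart l).cell (g * (l.E * l.cross 1)) s 0 := fun g s hs =>
    (triangleChart l).cell_up g s hs
  have hEE : ∀ g, l.E * (l.E * g) = g := fun g => by rw [← mul_assoc, l.E_mul_E, one_mul]
  have fin : ∀ {g g' : G} {a b a' b' : ℝ} (u v u' v' : ℝ), a = u → b = v → a' = u' → b' = v' →
      (triangleChart l).cell g u v = (triangleChart l).cell g' u' v' →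
      (triangleChart l).cell g a b = (triangleChart l).cell g' a' b' := by
    rintro _ _ _ _ _ _ _ _ _ _ rfl rfl rfl rfl h
    exact h
  rw [unitPoint_three, unitPoint_three, sixthRoot_pow_mod, sixthRoot_pow_mod (_ + 2),
    Nat.add_mod] at hs hy
  have hX' := congrArg hexX hy
  have hY' := congrArg hexY hy
  obtain ⟨t, ht, hX, hY⟩ := hex_of_mem_segment hs
  have ht' : 1 - t ∈ Icc (0 : ℝ) 1 := ⟨by linarith [ht.2], by linarith [ht.1]⟩
  have hm : (x.1.1.1.2 : ℕ) % 2 = X.normalIndex x.1.1.1 i % 6 % 2 := by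
    simp only [normalIndex]; omega
  have hm' : (y.1.1.1.2 : ℕ) % 2 = 1 - X.normalIndex x.1.1.1 i % 6 % 2 := by
    simp only [normalIndex, Nat.ModEq] at hn ⊢; omega
  have hc : l.cross (X.normalIndex x.1.1.1 i) = l.cross (X.normalIndex x.1.1.1 i % 6) :=
    l.cross_congr (by omega)
  rw [EdgeLabelling.triangleSquare, EdgeLabelling.triangleSquare, hl, hc]
  simp only [triangleX, triangleY]
  rw [hm, hm']
  set L := l.turned x.1.1.1
  have hlt := Nat.mod_lt (X.normalIndex x.1.1.1 i) (show 6 > 0 by norm_num)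
  have c0 : l.cross 0 = l.E := l.cross_zero
  have c3 : l.cross 3 = l.E := c0 ▸ l.cross_congr rfl
  have c4 : l.cross 4 = l.cross 1 := l.cross_congr rfl
  have c5 : l.cross 5 = l.cross 2 := l.cross_congr rfl
  have cc1 := l.cross_mul_cross 1
  have cc2 := l.cross_mul_cross 2
  interval_cases X.normalIndex x.1.1.1 i % 6 <;>
    simp [sixthRoot_pow_two, sixthRoot_pow_three, sixthRoot_pow_four,
      sixthRoot_pow_five] at hX hY hX' hY' ⊢
  · refine fin (1 - t) t (1 - t) t ?_ ?_ ?_ ?_ ?_ <;> try linarith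
    simp [c0, mul_assoc, l.E_mul_E]
  · refine fin (1 - t) 1 (1 - t) 0 ?_ ?_ ?_ ?_ ?_ <;> try linarith
    rw [hup _ _ ht']
    simp [mul_assoc, hEE]
  · refine fin 0 (1 - t) 1 (1 - t) ?_ ?_ ?_ ?_ ?_ <;> try linarith
    rw [hright _ _ ht']
    simp [mul_assoc, hEE, cc2]
  · refine fin t (1 - t) t (1 - t) ?_ ?_ ?_ ?_ ?_ <;> try linarith
    rw [c3]
  · refine fin t 0 t 1 ?_ ?_ ?_ ?_ ?_ <;> try linarith
    rw [hup _ _ ht]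
    simp [mul_assoc, hEE, cc1, c4]
  · refine fin 1 t 0 t ?_ ?_ ?_ ?_ ?_ <;> try linarith
    rw [hright _ _ ht]
    simp [mul_assoc, hEE, c5]

/-- The map of a surface tiled by triangles to the model given by its labelling. -/
def triangleMap (P : (X.translationCover f₀).Point) :
    Set G × AddCircle (1 : ℝ) × AddCircle (1 : ℝ) :=
  Quot.lift (fun x : (X.translationCover f₀).PolygonPoint =>
    (triangleChart l).cell (l.triangleSquare x.1.1.1) (triangleX x.1.1.1.2 x.1.2)
      (triangleY x.1.1.1.2 x.1.2))
    (fun _ _ h => triangleChart_identified l h) P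

theorem triangleMap_of_represents {c : (X.translationCover f₀).Face} {x : ℂ}
    {P : (X.translationCover f₀).Point} (h : (X.translationCover f₀).Represents c x P) :
    triangleMap l P =
      (triangleChart l).cell (l.triangleSquare c.1) (triangleX c.1.2 x) (triangleY c.1.2 x) := by
  obtain ⟨hx, rfl⟩ := h
  rfl

theorem triangle_coe_eq_zero (c : (X.translationCover f₀).Face) (i : Fin 3) :
    (triangleX c.1.2 ((X.translationCover f₀).vertex c i) : AddCircle (1 : ℝ)) = 0 ∧
      (triangleY c.1.2 ((X.translationCover f₀).vertex c i) : AddCircle (1 : ℝ)) = 0 := by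
  rw [triangleX, triangleY, translationCover_vertex, unitPoint_three, sixthRoot_pow_mod,
    show (c.1.2 : ℕ) % 2 = X.normalIndex c.1 i % 6 % 2 by simp only [normalIndex]; omega]
  have hlt := Nat.mod_lt (X.normalIndex c.1 i) (show 6 > 0 by norm_num)
  have h1 : ((1 : ℝ) : AddCircle (1 : ℝ)) = 0 := AddCircle.coe_period 1
  interval_cases X.normalIndex c.1 i % 6 <;>
    simp only [sixthRoot_pow_two, sixthRoot_pow_three, sixthRoot_pow_four, sixthRoot_pow_five,
      map_sub, map_neg, pow_zero, pow_one, hexX_one, hexY_one, hexX_sixthRoot, hexY_sixthRoot] <;>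
    norm_num [h1]

/-- As for squares, both conditions single out the vertices; at least seven angles of `π / 3` meet
at each. The diagonal decides which corners of the square belong to which of its two triangles. -/
theorem triangleMap_eq_corner [Finite X.Face] (hX : X.IsClosedSurface)
    (hl : ∀ i, 0 < i → i < 7 → (l.E * l.R) ^ i = 1 → ¬ 6 ∣ i * 5)
    (P : (X.translationCover f₀).Point) :
    (X.translationCover f₀).IsSingular P ↔
      ∃ q ∈ (univ : Set G), triangleMap l P = (triangleChart l).cell q 0 0 := by
  constructor
  · intro h
    obtain ⟨⟨c, i⟩, hc⟩ := h.corners_nonempty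
    have hx := triangle_mem_Icc hc.1
    have hpos : (triangleChart l).pos (triangleMap l P) = 0 := by
      rw [triangleMap_of_represents l hc, (triangleChart l).pos_cell _ _ hx.1 _ hx.2.1,
        Prod.mk_eq_zero]
      exact triangle_coe_eq_zero c i
    rw [triangleMap_of_represents l hc] at hpos ⊢
    obtain ⟨q, hq⟩ := SquareChart.exists_cell_zero_of_pos_eq_zero hx.1 hx.2.1 hpos
    exact ⟨q, mem_univ _, hq⟩
  · rintro ⟨q, -, hq⟩
    refine isSingular_of_vertex (by norm_num) l hX 7 (by norm_num) hl ?_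
    obtain ⟨⟨⟨c, x⟩, hx⟩, rfl⟩ := Quot.exists_rep P
    have hx' := triangle_mem_Icc hx
    have hpos : (triangleChart l).pos ((triangleChart l).cell (l.triangleSquare c.1)
        (triangleX c.1.2 x) (triangleY c.1.2 x)) = 0 := by
      have : (triangleChart l).cell (l.triangleSquare c.1) (triangleX c.1.2 x)
        (triangleY c.1.2 x) = _ := hq
      rw [this, (triangleChart l).pos_cell _ _ (by simp) _ (by simp)]
      rfl
    rw [(triangleChart l).pos_cell _ _ hx'.1 _ hx'.2.1, Prod.mk_eq_zero] at hpos
    have hvert : ∃ i, (X.translationCover f₀).vertex c i = x := by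
      have h01 := SquareChart.eq_zero_or_one_of_coe_eq_zero hx'.1 hpos.1
      have h01' := SquareChart.eq_zero_or_one_of_coe_eq_zero hx'.2.1 hpos.2
      have key : ∀ k : ℕ, k % 2 = (c.1.2 : ℕ) % 2 → hexX (sixthRoot ^ k) = hexX x →
          hexY (sixthRoot ^ k) = hexY x → ∃ i, (X.translationCover f₀).vertex c i = x := by
        intro k hk h1 h2
        rw [← hex_ext h1 h2, ← unitPoint_three]
        exact translationCover_exists_vertex c hk
      obtain ⟨-, -, h3, h4⟩ := hx'
      rcases Nat.mod_two_eq_zero_or_one c.1.2 with hm | hm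
      · have h3 := h3 hm
        simp only [triangleX, triangleY, hm] at h01 h01' h3 key
        rcases h01 with h1 | h1 <;> rcases h01' with h2 | h2
        · refine key 4 rfl ?_ ?_ <;> simp [sixthRoot_pow_four] <;> linarith
        · refine key 2 rfl ?_ ?_ <;> simp [sixthRoot_pow_two] <;> linarith
        · refine key 0 rfl ?_ ?_ <;> simp <;> linarith
        · linarith
      · have h4 := h4 hm
        simp only [triangleX, triangleY, hm] at h01 h01' h4 key
        rcases h01 with h1 | h1 <;> rcases h01' with h2 | h2
        · linarith
        · refine key 3 rfl ?_ ?_ <;> simp [sixthRoot_pow_three] <;> linarith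
        · refine key 5 rfl ?_ ?_ <;> simp [sixthRoot_pow_five] <;> linarith
        · refine key 1 rfl ?_ ?_ <;> simp <;> linarith
    obtain ⟨i, rfl⟩ := hvert
    exact ⟨(c, i), hx, rfl⟩

theorem triangle_not_exists_isClosedSaddleConnection [Finite X.Face] (hX : X.IsClosedSurface)
    (hl : ∀ i, 0 < i → i < 7 → (l.E * l.R) ^ i = 1 → ¬ 6 ∣ i * 5)
    {H : Perm G → Perm G → Prop} (hH : SquareChart.MoveInvariant H) {c₀ : G}
    (hc₀ : (l.E * l.cross 2)⁻¹ * (l.E * l.cross 1)⁻¹ * (l.E * l.cross 2) * (l.E * l.cross 1) = c₀)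
    (hret : ∀ h v, H h v → SquareChart.NoReturn (Equiv.mulRight c₀) univ h)
    (hC : H (Equiv.mulRight (l.E * l.cross 2)) (Equiv.mulRight (l.E * l.cross 1))) :
    ¬ ∃ γ, (X.translationCover f₀).IsClosedSaddleConnection γ := by
  refine RegularPolygonGluing.not_exists_isClosedSaddleConnection _ (triangleChart l) hH (T := univ)
    (fun q hq => absurd (mem_univ q) hq) (fun h v hv => ?_) hC (triangleMap l)
    (fun z => (2 * hexX z + hexY z) / 3) (fun z => (hexY z - hexX z) / 3) (fun z => ?_) (fun z => ?_)
    (fun z h1 h2 => ?_) (fun γ c x z ε hε h => ?_) (triangleMap_eq_corner l hX hl)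
  · rw [mulRight_commutator, hc₀]
    exact hret h v hv
  · simp; ring
  · simp; ring
  · apply hex_ext <;> simp <;> linarith
  · refine ⟨l.triangleSquare c.1, triangleX c.1.2 x, triangleY c.1.2 x, ε, hε, fun s hs => ?_⟩
    have e1 : triangleX c.1.2 (x + s * z) =
        triangleX c.1.2 x + s * ((2 * hexX z + hexY z) / 3) := by
      simp only [triangleX, map_add, hexX_ofReal_mul, hexY_ofReal_mul]; ring
    have e2 : triangleY c.1.2 (x + s * z) = triangleY c.1.2 x + s * ((hexY z - hexX z) / 3) := by
      simp only [triangleY, map_add, hexX_ofReal_mul, hexY_ofReal_mul]; ring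
    obtain ⟨hx, -⟩ := h s hs
    have hmem := triangle_mem_Icc hx
    rw [← e1, ← e2]
    exact ⟨hmem.1, hmem.2.1, triangleMap_of_represents l (h s hs)⟩

end Triangle

end PeriodicPolyhedralSurface

end

noncomputable section

open Set Equiv

/-- The permutation that shifts the second component by `α` and multiplies the first one by an
element depending on the second one. -/
def wreath {G : Type} [Group G] (α : ZMod 3) (H : ZMod 3 → G) : Perm (G × ZMod 3) where
  toFun q := (q.1 * H q.2, q.2 + α)
  invFun q := (q.1 * (H (q.2 - α))⁻¹, q.2 - α)
  left_inv q := by simp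
  right_inv q := by simp

@[simp] theorem wreath_apply {G : Type} [Group G] (α : ZMod 3) (H : ZMod 3 → G) (q : G × ZMod 3) :
    wreath α H q = (q.1 * H q.2, q.2 + α) := rfl

@[simp] theorem wreath_inv_apply {G : Type} [Group G] (α : ZMod 3) (H : ZMod 3 → G)
    (q : G × ZMod 3) : (wreath α H)⁻¹ q = (q.1 * (H (q.2 - α))⁻¹, q.2 - α) := rfl

namespace PeriodicPolyhedralSurface

/-! ### Surfaces tiled by hexagons -/

section Hexagon

variable {X : PeriodicPolyhedralSurface 6} {f₀ : X.Face} {G : Type} [Group G]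

theorem hexagon_mem_Icc {c : (X.translationCover f₀).Face} {x : ℂ}
    (hx : x ∈ (X.translationCover f₀).polygon c) :
    hexX x ∈ Icc (-1 : ℝ) 1 ∧ hexY x ∈ Icc (-1 : ℝ) 1 ∧ hexX x + hexY x ∈ Icc (-1 : ℝ) 1 := by
  have hev := even_of_reachable (by norm_num) (by decide) c
  have key : ∀ α β δ : ℝ, 0 ≤ α + δ → 0 ≤ β + δ → 0 ≤ -α + β + δ → 0 ≤ -α + δ → 0 ≤ -β + δ →
      0 ≤ α - β + δ → 0 ≤ α * hexX x + β * hexY x + δ := by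
    intro α β δ h0 h1 h2 h3 h4 h5
    refine RegularPolygonGluing.hex_nonneg_of_vertex α β δ (fun i => ?_) hx
    obtain ⟨m, hm⟩ := hev
    rw [translationCover_vertex, normalIndex, hm, ← two_mul, ← mul_add, unitPoint_six_two_mul,
      sixthRoot_pow_mod]
    have hlt := Nat.mod_lt (m + (i : ℕ)) (show 6 > 0 by norm_num)
    interval_cases (m + (i : ℕ)) % 6 <;> simp [sixthRoot_pow_two, sixthRoot_pow_three,
      sixthRoot_pow_four, sixthRoot_pow_five] <;> linarith
  have h1 := key 1 0 1 (by norm_num) (by norm_num) (by norm_num) (by norm_num) (by norm_num)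
    (by norm_num)
  have h2 := key (-1) 0 1 (by norm_num) (by norm_num) (by norm_num) (by norm_num) (by norm_num)
    (by norm_num)
  have h3 := key 0 1 1 (by norm_num) (by norm_num) (by norm_num) (by norm_num) (by norm_num)
    (by norm_num)
  have h4 := key 0 (-1) 1 (by norm_num) (by norm_num) (by norm_num) (by norm_num) (by norm_num)
    (by norm_num)
  have h5 := key 1 1 1 (by norm_num) (by norm_num) (by norm_num) (by norm_num) (by norm_num)
    (by norm_num)
  have h6 := key (-1) (-1) 1 (by norm_num) (by norm_num) (by norm_num) (by norm_num) (by norm_num)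
    (by norm_num)
  refine ⟨⟨?_, ?_⟩, ⟨?_, ?_⟩, ?_, ?_⟩ <;> linarith

variable (l : EdgeLabelling X G)

namespace EdgeLabelling

/-- The passage across the edge number `k` of a placed hexagon. -/
def hexCross (k : ℕ) : G := l.R ^ k * l.E * (l.R ^ k)⁻¹

theorem hexCross_mul_hexCross (k : ℕ) : l.hexCross k * l.hexCross k = 1 := by
  have : l.hexCross k * l.hexCross k = l.R ^ k * (l.E * l.E) * (l.R ^ k)⁻¹ := by
    rw [hexCross]; group
  rw [this, l.E_mul_E]; group

/-- The passage to the right between the squares into which three rhombi of the hexagons turn. -/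
def hexRight : Perm (G × ZMod 3) := wreath 2 ![l.hexCross 0, 1, l.hexCross 2]

/-- The passage upwards between the squares. -/
def hexUp : Perm (G × ZMod 3) := wreath 1 ![l.hexCross 0, l.hexCross 1, 1]

/-- The loop around a corner of the squares. -/
def hexLoop : Perm (G × ZMod 3) := l.hexUp * l.hexRight * l.hexUp⁻¹ * l.hexRight⁻¹

end EdgeLabelling

/-- The chart for a surface tiled by hexagons whose edges are labelled by a group. -/
def hexChart : SquareChart (Set (G × ZMod 3) × AddCircle (1 : ℝ) × AddCircle (1 : ℝ)) (G × ZMod 3)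
    l.hexLoop := SquareChart.ofPerms l.hexRight l.hexUp

open Classical in
/-- The point with coordinates `a`, `b` in the hexagon with label `g`. -/
def hexCell (g : G) (a b : ℝ) : Set (G × ZMod 3) × AddCircle (1 : ℝ) × AddCircle (1 : ℝ) :=
  -- The axes through the centre cut the hexagon into two full unit squares, of types 1 and 2, in
  -- the quadrants of mixed sign, and two triangles in the other two. The first triangle is half of
  -- the square `(g, 0)`; the last one is the other half of the square of type 0 of the neighbour
  -- across edge 0.
  if 0 ≤ a then
    if 0 ≤ b then (hexChart l).cell (g, 0) a b else (hexChart l).cell (g, 2) a (b + 1)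
  else
    if 0 ≤ b then (hexChart l).cell (g, 1) (a + 1) b
    else (hexChart l).cell (g * l.hexCross 0, 0) (a + 1) (b + 1)

theorem hexChart_right_zero (g : G) {s : ℝ} (hs : s ∈ Icc (0 : ℝ) 1) :
    (hexChart l).cell (g, 0) 1 s = (hexChart l).cell (g * l.hexCross 0, 2) 0 s :=
  (hexChart l).cell_right (g, 0) s hs

theorem hexChart_right_one (g : G) {s : ℝ} (hs : s ∈ Icc (0 : ℝ) 1) :
    (hexChart l).cell (g, 1) 1 s = (hexChart l).cell (g, 0) 0 s :=
  ((hexChart l).cell_right (g, 1) s hs).trans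
    (congrArg (fun q => (hexChart l).cell q 0 s) (Prod.ext (mul_one g) rfl))

theorem hexChart_right_two (g : G) {s : ℝ} (hs : s ∈ Icc (0 : ℝ) 1) :
    (hexChart l).cell (g, 2) 1 s = (hexChart l).cell (g * l.hexCross 2, 1) 0 s :=
  (hexChart l).cell_right (g, 2) s hs

theorem hexChart_up_zero (g : G) {s : ℝ} (hs : s ∈ Icc (0 : ℝ) 1) :
    (hexChart l).cell (g, 0) s 1 = (hexChart l).cell (g * l.hexCross 0, 1) s 0 :=
  (hexChart l).cell_up (g, 0) s hs

theorem hexChart_up_one (g : G) {s : ℝ} (hs : s ∈ Icc (0 : ℝ) 1) :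
    (hexChart l).cell (g, 1) s 1 = (hexChart l).cell (g * l.hexCross 1, 2) s 0 :=
  (hexChart l).cell_up (g, 1) s hs

theorem hexChart_up_two (g : G) {s : ℝ} (hs : s ∈ Icc (0 : ℝ) 1) :
    (hexChart l).cell (g, 2) s 1 = (hexChart l).cell (g, 0) s 0 :=
  ((hexChart l).cell_up (g, 2) s hs).trans
    (congrArg (fun q => (hexChart l).cell q s 0) (Prod.ext (mul_one g) rfl))

theorem hexCell_of_nonneg_of_nonneg (g : G) {a b : ℝ} (ha : 0 ≤ a) (hb : 0 ≤ b) :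
    hexCell l g a b = (hexChart l).cell (g, 0) a b := by
  rw [hexCell, if_pos ha, if_pos hb]

theorem hexCell_of_nonneg_of_nonpos (g : G) {a b : ℝ} (ha : a ∈ Icc (0 : ℝ) 1) (hb : b ≤ 0) :
    hexCell l g a b = (hexChart l).cell (g, 2) a (b + 1) := by
  rcases hb.lt_or_eq with hb | rfl
  · rw [hexCell, if_pos ha.1, if_neg hb.not_ge]
  · rw [hexCell, if_pos ha.1, if_pos le_rfl, zero_add, hexChart_up_two l g ha]

theorem hexCell_of_nonpos_of_nonneg (g : G) {a b : ℝ} (ha : a ≤ 0) (hb : b ∈ Icc (0 : ℝ) 1) :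
    hexCell l g a b = (hexChart l).cell (g, 1) (a + 1) b := by
  rcases ha.lt_or_eq with ha | rfl
  · rw [hexCell, if_neg ha.not_ge, if_pos hb.1]
  · rw [hexCell, if_pos le_rfl, if_pos hb.1, zero_add, hexChart_right_one l g hb]

theorem hexCell_of_nonpos_of_nonpos (g : G) {a b : ℝ} (ha : a ∈ Icc (-1 : ℝ) 0)
    (hb : b ∈ Icc (-1 : ℝ) 0) :
    hexCell l g a b = (hexChart l).cell (g * l.hexCross 0, 0) (a + 1) (b + 1) := by
  have hc : g * l.hexCross 0 * l.hexCross 0 = g := by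
    rw [mul_assoc, l.hexCross_mul_hexCross, mul_one]
  rcases ha.2.lt_or_eq with ha' | rfl
  · rcases hb.2.lt_or_eq with hb' | rfl
    · rw [hexCell, if_neg ha'.not_ge, if_neg hb'.not_ge]
    · rw [hexCell_of_nonpos_of_nonneg l g ha.2 (by simp), zero_add,
        hexChart_up_zero l _ ⟨by linarith [ha.1], by linarith⟩, hc]
  · rw [hexCell_of_nonneg_of_nonpos l g (by simp) hb.2, zero_add,
      hexChart_right_zero l _ ⟨by linarith [hb.1], by linarith [hb.2]⟩, hc]

theorem pos_hexCell (g : G) {a b : ℝ} (ha : a ∈ Icc (-1 : ℝ) 1) (hb : b ∈ Icc (-1 : ℝ) 1) :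
    (hexChart l).pos (hexCell l g a b) = (↑a, ↑b) := by
  have h1 : ((1 : ℝ) : AddCircle (1 : ℝ)) = 0 := AddCircle.coe_period 1
  rcases le_total 0 a with ha' | ha' <;> rcases le_total 0 b with hb' | hb'
  · rw [hexCell_of_nonneg_of_nonneg l g ha' hb',
      (hexChart l).pos_cell _ _ ⟨ha', ha.2⟩ _ ⟨hb', hb.2⟩]
  · rw [hexCell_of_nonneg_of_nonpos l g ⟨ha', ha.2⟩ hb',
      (hexChart l).pos_cell _ _ ⟨ha', ha.2⟩ _ ⟨by linarith [hb.1], by linarith⟩,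
      AddCircle.coe_add, h1, add_zero]
  · rw [hexCell_of_nonpos_of_nonneg l g ha' ⟨hb', hb.2⟩,
      (hexChart l).pos_cell _ _ ⟨by linarith [ha.1], by linarith⟩ _ ⟨hb', hb.2⟩,
      AddCircle.coe_add, h1, add_zero]
  · rw [hexCell_of_nonpos_of_nonpos l g ⟨ha.1, ha'⟩ ⟨hb.1, hb'⟩,
      (hexChart l).pos_cell _ _ ⟨by linarith [ha.1], by linarith⟩ _
        ⟨by linarith [hb.1], by linarith⟩, AddCircle.coe_add, h1, add_zero,
      AddCircle.coe_add, h1, add_zero]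

/-- Since `R ^ 3 = 1`, the half turn between the two sides of an edge disappears, and crossing an
edge becomes multiplication by an involution. -/
theorem placed_eq_mul_hexCross {l : EdgeLabelling X G} (hR : l.R ^ 3 = 1)
    {c c' : (X.translationCover f₀).Face} {i j : Fin 6} (h : X.SameEdge (c.1.1, i) (c'.1.1, j))
    (hn : X.normalIndex c'.1 j ≡ X.normalIndex c.1 i + 6 [MOD 2 * 6]) :
    ∃ k : ℕ, X.normalIndex c.1 i = 2 * k ∧ l.placed c'.1 = l.placed c.1 * l.hexCross (k % 6) := by
  obtain ⟨k, hk, hl⟩ := l.placed_of_glued (r := 3) (by norm_num)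
    (even_of_reachable (by norm_num) (by decide) c)
    (even_of_reachable (by norm_num) (by decide) c') h hn
  refine ⟨k, hk, ?_⟩
  rw [hl, EdgeLabelling.hexCross, ← pow_eq_pow_mod k l.R_pow, pow_add, hR, mul_one]
  simp only [mul_assoc]

theorem hexCross_add_three (hR : l.R ^ 3 = 1) (k : ℕ) : l.hexCross (k + 3) = l.hexCross k := by
  rw [EdgeLabelling.hexCross, pow_add, hR, mul_one, EdgeLabelling.hexCross]

theorem hexCell_edge_zero (g : G) {t : ℝ} (ht : t ∈ Icc (0 : ℝ) 1) :
    hexCell l g (1 - t) t = hexCell l (g * l.hexCross 0) (-t) (t - 1) := by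
  rw [hexCell_of_nonneg_of_nonneg l g (by linarith [ht.2]) ht.1,
    hexCell_of_nonpos_of_nonpos l _ ⟨by linarith [ht.2], by linarith [ht.1]⟩
      ⟨by linarith [ht.1], by linarith [ht.2]⟩, mul_assoc, l.hexCross_mul_hexCross, mul_one,
    sub_add_cancel, neg_add_eq_sub]

theorem hexCell_edge_one (g : G) {t : ℝ} (ht : t ∈ Icc (0 : ℝ) 1) :
    hexCell l g (-t) 1 = hexCell l (g * l.hexCross 1) (1 - t) (-1) := by
  have ht' : 1 - t ∈ Icc (0 : ℝ) 1 := ⟨by linarith [ht.2], by linarith [ht.1]⟩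
  rw [hexCell_of_nonpos_of_nonneg l g (by linarith [ht.1]) (by simp),
    hexCell_of_nonneg_of_nonpos l _ ht' (by norm_num), neg_add_cancel, neg_add_eq_sub,
    hexChart_up_one l g ht']

theorem hexCell_edge_two (g : G) {t : ℝ} (ht : t ∈ Icc (0 : ℝ) 1) :
    hexCell l g (-1) (1 - t) = hexCell l (g * l.hexCross 2) 1 (-t) := by
  have ht' : 1 - t ∈ Icc (0 : ℝ) 1 := ⟨by linarith [ht.2], by linarith [ht.1]⟩
  rw [hexCell_of_nonpos_of_nonneg l g (by norm_num) ht',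
    hexCell_of_nonneg_of_nonpos l _ (by simp) (by linarith [ht.1]), neg_add_cancel, neg_add_eq_sub,
    hexChart_right_two l _ ht', mul_assoc, l.hexCross_mul_hexCross, mul_one]

/-- Opposite edges have the same crossing, so edges 3, 4, 5 are edges 0, 1, 2 seen from the
neighbour, with the parameter `t` reversed. -/
theorem hexChart_identified (hR : l.R ^ 3 = 1) {x y : (X.translationCover f₀).PolygonPoint}
    (h : (X.translationCover f₀).Identified x y) :
    hexCell l (l.placed x.1.1.1) (hexX x.1.2) (hexY x.1.2) =
      hexCell l (l.placed y.1.1.1) (hexX y.1.2) (hexY y.1.2) := by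
  obtain ⟨i, j, he, hn, hs, hy⟩ := translationCover_identified (by norm_num) h
  obtain ⟨k, hk, hl⟩ := placed_eq_mul_hexCross hR he hn
  rw [hl]
  set L := l.placed x.1.1.1
  have h3 : l.hexCross 3 = l.hexCross 0 := hexCross_add_three l hR 0
  have h4 : l.hexCross 4 = l.hexCross 1 := hexCross_add_three l hR 1
  have h5 : l.hexCross 5 = l.hexCross 2 := hexCross_add_three l hR 2
  have hc : ∀ k, L * l.hexCross k * l.hexCross k = L := fun k => by
    rw [mul_assoc, l.hexCross_mul_hexCross, mul_one]
  rw [hk, show 2 * k + 2 = 2 * (k + 1) by ring, unitPoint_six_two_mul, unitPoint_six_two_mul,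
    sixthRoot_pow_mod, sixthRoot_pow_mod (_ + 1), Nat.add_mod] at hs hy
  have hX' := congrArg hexX hy
  have hY' := congrArg hexY hy
  obtain ⟨t, ht, hX, hY⟩ := hex_of_mem_segment hs
  have ht' : 1 - t ∈ Icc (0 : ℝ) 1 := ⟨by linarith [ht.2], by linarith [ht.1]⟩
  have hlt := Nat.mod_lt k (show 6 > 0 by norm_num)
  have fin : ∀ {g g' : G} {a b a' b' : ℝ} (u v u' v' : ℝ), a = u → b = v → a' = u' → b' = v' →
      hexCell l g u v = hexCell l g' u' v' → hexCell l g a b = hexCell l g' a' b' := by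
    rintro _ _ _ _ _ _ _ _ _ _ rfl rfl rfl rfl h
    exact h
  interval_cases k % 6 <;>
    simp [sixthRoot_pow_two, sixthRoot_pow_three, sixthRoot_pow_four,
      sixthRoot_pow_five] at hX hY hX' hY'
  · refine fin _ _ _ _ ?_ ?_ ?_ ?_ (hexCell_edge_zero l L ht) <;> linarith
  · refine fin _ _ _ _ ?_ ?_ ?_ ?_ (hexCell_edge_one l L ht) <;> linarith
  · refine fin _ _ _ _ ?_ ?_ ?_ ?_ (hexCell_edge_two l L ht) <;> linarith
  · have e := hexCell_edge_zero l (L * l.hexCross 0) ht'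
    rw [hc] at e
    rw [h3]
    refine fin _ _ _ _ ?_ ?_ ?_ ?_ e.symm <;> linarith
  · have e := hexCell_edge_one l (L * l.hexCross 1) ht'
    rw [hc] at e
    rw [h4]
    refine fin _ _ _ _ ?_ ?_ ?_ ?_ e.symm <;> linarith
  · have e := hexCell_edge_two l (L * l.hexCross 2) ht'
    rw [hc] at e
    rw [h5]
    refine fin _ _ _ _ ?_ ?_ ?_ ?_ e.symm <;> linarith

/-- The map of a surface tiled by hexagons to the model given by its labelling. -/
def hexMap (hR : l.R ^ 3 = 1) (P : (X.translationCover f₀).Point) :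
    Set (G × ZMod 3) × AddCircle (1 : ℝ) × AddCircle (1 : ℝ) :=
  Quot.lift (fun x : (X.translationCover f₀).PolygonPoint =>
    hexCell l (l.placed x.1.1.1) (hexX x.1.2) (hexY x.1.2))
    (fun _ _ h => hexChart_identified l hR h) P

theorem hexMap_of_represents (hR : l.R ^ 3 = 1) {c : (X.translationCover f₀).Face} {x : ℂ}
    {P : (X.translationCover f₀).Point} (h : (X.translationCover f₀).Represents c x P) :
    hexMap l hR P = hexCell l (l.placed c.1) (hexX x) (hexY x) := by
  obtain ⟨hx, rfl⟩ := h
  rfl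

/-- The lower left corner of a square of type 0 is the centre of a hexagon, and a small loop around
it stays in this hexagon. -/
theorem hexLoop_apply_zero (g : G) : l.hexLoop (g, 0) = (g, 0) := by
  have hc : g * l.hexCross 0 * l.hexCross 0 = g := by
    rw [mul_assoc, l.hexCross_mul_hexCross, mul_one]
  have e1 : l.hexRight (g, 1) = (g, 0) := Prod.ext (mul_one g) rfl
  have e2 : l.hexUp (g * l.hexCross 0, 0) = (g, 1) := Prod.ext hc rfl
  have e3 : l.hexRight (g * l.hexCross 0, 0) = (g, 2) := Prod.ext hc rfl
  have e4 : l.hexUp (g, 2) = (g, 0) := Prod.ext (mul_one g) rfl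
  rw [EdgeLabelling.hexLoop, Perm.mul_apply, Perm.mul_apply, Perm.mul_apply,
    Perm.inv_eq_iff_eq.2 e1.symm, Perm.inv_eq_iff_eq.2 e2.symm, e3, e4]

/-- The vertices of a hexagon are corners that are not of type `0`. -/
theorem hexCell_vertex (g : G) {k : ℕ} (hk : k < 6) :
    ∃ q : G × ZMod 3, q.2 ≠ 0 ∧
      hexCell l g (hexX (sixthRoot ^ k)) (hexY (sixthRoot ^ k)) = (hexChart l).cell q 0 0 := by
  have h0 : (0 : ℝ) ∈ Icc (0 : ℝ) 1 := by simp
  have h1 : (1 : ℝ) ∈ Icc (0 : ℝ) 1 := by simp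
  have t1 : (1 : ZMod 3) ≠ 0 := by decide
  have t2 : (2 : ZMod 3) ≠ 0 := by decide
  interval_cases k <;> simp only [sixthRoot_pow_two, sixthRoot_pow_three, sixthRoot_pow_four,
    sixthRoot_pow_five, map_sub, map_neg, pow_zero, pow_one, hexX_one, hexY_one, hexX_sixthRoot,
    hexY_sixthRoot, sub_zero, zero_sub, neg_zero]
  · rw [hexCell_of_nonneg_of_nonneg l g one_pos.le le_rfl, hexChart_right_zero l g h0]
    exact ⟨_, t2, rfl⟩
  · rw [hexCell_of_nonneg_of_nonneg l g le_rfl one_pos.le, hexChart_up_zero l g h0]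
    exact ⟨_, t1, rfl⟩
  · rw [hexCell_of_nonpos_of_nonneg l g (by norm_num) h1, neg_add_cancel, hexChart_up_one l g h0]
    exact ⟨_, t2, rfl⟩
  · rw [hexCell_of_nonpos_of_nonneg l g (by norm_num) h0, neg_add_cancel]
    exact ⟨_, t1, rfl⟩
  · rw [hexCell_of_nonneg_of_nonpos l g h0 (by norm_num), neg_add_cancel]
    exact ⟨_, t2, rfl⟩
  · rw [hexCell_of_nonneg_of_nonpos l g h1 (by norm_num), neg_add_cancel, hexChart_right_two l g h0]
    exact ⟨_, t1, rfl⟩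

theorem eq_neg_one_or_zero_or_one_of_coe_eq_zero {u : ℝ} (hu : u ∈ Icc (-1 : ℝ) 1)
    (h : (u : AddCircle (1 : ℝ)) = 0) : u = -1 ∨ u = 0 ∨ u = 1 := by
  rcases le_total 0 u with h0 | h0
  · exact Or.inr (SquareChart.eq_zero_or_one_of_coe_eq_zero ⟨h0, hu.2⟩ h)
  · have h' : ((-u : ℝ) : AddCircle (1 : ℝ)) = 0 := by rw [AddCircle.coe_neg, h, neg_zero]
    rcases SquareChart.eq_zero_or_one_of_coe_eq_zero ⟨by linarith, by linarith [hu.1]⟩ h' with h | h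
    · right; left; linarith
    · left; linarith

/-- The labelling `l` provides the model and `l'` counts corners: four angles of `2 * π / 3` exceed
`2 * π`. Two labellings are allowed because the one suited to the model may not detect the cone
angle. -/
theorem hexMap_eq_corner (hR : l.R ^ 3 = 1) [Finite X.Face] (hX : X.IsClosedSurface)
    {G' : Type} [Group G'] (l' : EdgeLabelling X G')
    (hl : ∀ i, 0 < i → i < 4 → (l'.E * l'.R) ^ i = 1 → ¬ 12 ∣ i * 8)
    (P : (X.translationCover f₀).Point) :
    (X.translationCover f₀).IsSingular P ↔
      ∃ q ∈ {q : G × ZMod 3 | q.2 ≠ 0}, hexMap l hR P = (hexChart l).cell q 0 0 := by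
  constructor
  · intro h
    obtain ⟨⟨c, i⟩, hc⟩ := h.corners_nonempty
    obtain ⟨m, hm⟩ := even_of_reachable (by norm_num) (by decide) c
    rw [hexMap_of_represents l hR hc]
    simp only
    rw [translationCover_vertex, normalIndex, hm, ← two_mul, ← mul_add, unitPoint_six_two_mul,
      sixthRoot_pow_mod]
    exact hexCell_vertex l _ (Nat.mod_lt _ (by norm_num))
  · rintro ⟨q, hq0, hq⟩
    refine isSingular_of_vertex (by norm_num) l' hX 4 (by norm_num) hl ?_
    obtain ⟨⟨⟨c, x⟩, hx⟩, rfl⟩ := Quot.exists_rep P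
    obtain ⟨hx1, hx2, hx3, hx4⟩ := hexagon_mem_Icc hx
    have hev := even_of_reachable (by norm_num) (by decide) c
    have hq : hexCell l (l.placed c.1) (hexX x) (hexY x) = (hexChart l).cell q 0 0 := hq
    have hpos := congrArg (hexChart l).pos hq
    rw [pos_hexCell l _ hx1 hx2, (hexChart l).pos_cell _ _ (by simp) _ (by simp),
      Prod.mk_inj] at hpos
    have hvert : ∃ i, (X.translationCover f₀).vertex c i = x := by
      have key : ∀ k : ℕ, hexX (sixthRoot ^ k) = hexX x → hexY (sixthRoot ^ k) = hexY x →
          ∃ i, (X.translationCover f₀).vertex c i = x := by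
        intro k h1 h2
        rw [← hex_ext h1 h2, ← unitPoint_six_two_mul]
        refine translationCover_exists_vertex c ?_
        rw [Nat.even_iff] at hev
        simp [Nat.ModEq, hev]
      rcases eq_neg_one_or_zero_or_one_of_coe_eq_zero hx1 hpos.1 with h1 | h1 | h1 <;>
        rcases eq_neg_one_or_zero_or_one_of_coe_eq_zero hx2 hpos.2 with h2 | h2 | h2 <;>
        rw [h1, h2] at hx3 hx4 key
      · norm_num at hx3
      · exact key 3 (by simp [sixthRoot_pow_three]) (by simp [sixthRoot_pow_three])
      · exact key 2 (by simp [sixthRoot_pow_two]) (by simp [sixthRoot_pow_two])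
      · exact key 4 (by simp [sixthRoot_pow_four]) (by simp [sixthRoot_pow_four])
      -- The centre of a hexagon is also at an integral position, but it is a corner of type 0 and a
      -- cycle of its own.
      · rw [h1, h2, hexCell_of_nonneg_of_nonneg l _ le_rfl le_rfl] at hq
        have hs := (hexChart l).corner _ _ hq
        have := hs.eq_of_left (hexLoop_apply_zero l _)
        exact absurd (congrArg Prod.snd this).symm hq0
      · exact key 1 (by simp) (by simp)
      · exact key 5 (by simp [sixthRoot_pow_five]) (by simp [sixthRoot_pow_five])
      · exact key 0 (by simp) (by simp)
      · norm_num at hx4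
    obtain ⟨i, rfl⟩ := hvert
    exact ⟨(c, i), hx, rfl⟩

theorem hex_not_exists_isClosedSaddleConnection (hR : l.R ^ 3 = 1) [Finite X.Face]
    (hX : X.IsClosedSurface) {G' : Type} [Group G'] (l' : EdgeLabelling X G')
    (hl : ∀ i, 0 < i → i < 4 → (l'.E * l'.R) ^ i = 1 → ¬ 12 ∣ i * 8)
    {H : Perm (G × ZMod 3) → Perm (G × ZMod 3) → Prop} (hH : SquareChart.MoveInvariant H)
    (hret : ∀ h v, H h v → SquareChart.NoReturn l.hexLoop {q | q.2 ≠ 0} h)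
    (hC : H l.hexRight l.hexUp) : ¬ ∃ γ, (X.translationCover f₀).IsClosedSaddleConnection γ := by
  refine RegularPolygonGluing.not_exists_isClosedSaddleConnection _ (hexChart l) hH
    (T := {q | q.2 ≠ 0}) (fun q hq => ?_) hret hC (hexMap l hR) hexX hexY (fun z => map_neg _ z)
    (fun z => map_neg _ z) (fun z h1 h2 => hex_ext (by simpa using h1) (by simpa using h2))
    (fun γ c x z ε hε h => ?_) (hexMap_eq_corner l hR hX l' hl)
  · obtain ⟨g, i⟩ := q
    have : i = 0 := by simpa using hq
    subst this
    exact hexLoop_apply_zero l g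
  -- The initial piece is shortened until it stays in one quadrant of the hexagon, hence in one
  -- square.
  · obtain ⟨δ, hδ, hδε, h1⟩ := affine_nonneg_or_nonpos (hexX x) (hexX z) ε hε
    obtain ⟨η, hη, hηδ, h2⟩ := affine_nonneg_or_nonpos (hexY x) (hexY z) δ hδ
    have key : ∀ s ∈ Icc 0 η, hexX x + s * hexX z ∈ Icc (-1 : ℝ) 1 ∧
        hexY x + s * hexY z ∈ Icc (-1 : ℝ) 1 ∧ hexMap l hR (γ s) =
          hexCell l (l.placed c.1) (hexX x + s * hexX z) (hexY x + s * hexY z) := by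
      intro s hs
      have hs' := h s ⟨hs.1, by linarith [hs.2]⟩
      have hm := hexagon_mem_Icc hs'.1
      rw [hexMap_of_represents l hR hs']
      rw [map_add, map_add, hexX_ofReal_mul, hexY_ofReal_mul] at hm ⊢
      exact ⟨hm.1, hm.2.1, rfl⟩
    have h1' : (∀ s ∈ Icc 0 η, 0 ≤ hexX x + s * hexX z) ∨ ∀ s ∈ Icc 0 η, hexX x + s * hexX z ≤ 0 :=
      h1.imp (fun h s hs => h s ⟨hs.1, hs.2.trans hηδ⟩) (fun h s hs => h s ⟨hs.1, hs.2.trans hηδ⟩)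
    rcases h1' with h1 | h1 <;> rcases h2 with h2 | h2
    · refine ⟨(l.placed c.1, 0), hexX x, hexY x, η, hη, fun s hs => ?_⟩
      obtain ⟨k1, k2, k3⟩ := key s hs
      have a1 := h1 s hs
      have a2 := h2 s hs
      rw [hexCell_of_nonneg_of_nonneg l _ a1 a2] at k3
      exact ⟨⟨a1, k1.2⟩, ⟨a2, k2.2⟩, k3⟩
    · refine ⟨(l.placed c.1, 2), hexX x, hexY x + 1, η, hη, fun s hs => ?_⟩
      obtain ⟨k1, k2, k3⟩ := key s hs
      have a1 := h1 s hs
      have a2 := h2 s hs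
      rw [hexCell_of_nonneg_of_nonpos l _ ⟨a1, k1.2⟩ a2] at k3
      rw [add_right_comm (hexY x)]
      exact ⟨⟨a1, k1.2⟩, ⟨by linarith [k2.1], by linarith⟩, k3⟩
    · refine ⟨(l.placed c.1, 1), hexX x + 1, hexY x, η, hη, fun s hs => ?_⟩
      obtain ⟨k1, k2, k3⟩ := key s hs
      have a1 := h1 s hs
      have a2 := h2 s hs
      rw [hexCell_of_nonpos_of_nonneg l _ a1 ⟨a2, k2.2⟩] at k3
      rw [add_right_comm (hexX x)]
      exact ⟨⟨by linarith [k1.1], by linarith⟩, ⟨a2, k2.2⟩, k3⟩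
    · refine ⟨(l.placed c.1 * l.hexCross 0, 0), hexX x + 1, hexY x + 1, η, hη, fun s hs => ?_⟩
      obtain ⟨k1, k2, k3⟩ := key s hs
      have a1 := h1 s hs
      have a2 := h2 s hs
      rw [hexCell_of_nonpos_of_nonpos l _ ⟨k1.1, a1⟩ ⟨k2.1, a2⟩] at k3
      rw [add_right_comm (hexX x), add_right_comm (hexY x)]
      exact ⟨⟨by linarith [k1.1], by linarith⟩, ⟨by linarith [k2.1], by linarith⟩, k3⟩

end Hexagon

end PeriodicPolyhedralSurface

end

noncomputable section

open Set Equiv SquareChart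

/-! ### Square-tiled surfaces with a group of translations that has three orbits on the squares -/

section ThreeOrbits

variable {G : Type} [Group G]

/-- The data of a composition of two maps `wreath`. -/
def shiftMul (a b : ZMod 3 × (ZMod 3 → G)) : ZMod 3 × (ZMod 3 → G) :=
  (b.1 + a.1, fun i => b.2 i * a.2 (i + b.1))

/-- The data of the inverse of a map `wreath`. -/
def shiftInv (a : ZMod 3 × (ZMod 3 → G)) : ZMod 3 × (ZMod 3 → G) :=
  (-a.1, fun i => (a.2 (i - a.1))⁻¹)

theorem wreath_mul (a b : ZMod 3 × (ZMod 3 → G)) :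
    wreath a.1 a.2 * wreath b.1 b.2 = wreath (shiftMul a b).1 (shiftMul a b).2 := by
  ext q <;> simp [shiftMul, mul_assoc, add_assoc]

theorem wreath_inv (a : ZMod 3 × (ZMod 3 → G)) :
    (wreath a.1 a.2)⁻¹ = wreath (shiftInv a).1 (shiftInv a).2 := by
  ext q
  · rfl
  · exact sub_eq_add_neg _ _

/-- The image of the data of a map `wreath` under a homomorphism. -/
def shiftMap {G' : Type} [Group G'] (χ : G →* G') (a : ZMod 3 × (ZMod 3 → G)) :
    ZMod 3 × (ZMod 3 → G') := (a.1, fun i => χ (a.2 i))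

theorem shiftMap_mul {G' : Type} [Group G'] (χ : G →* G') (a b : ZMod 3 × (ZMod 3 → G)) :
    shiftMap χ (shiftMul a b) = shiftMul (shiftMap χ a) (shiftMap χ b) := by
  simp [shiftMap, shiftMul]

theorem shiftMap_inv {G' : Type} [Group G'] (χ : G →* G') (a : ZMod 3 × (ZMod 3 → G)) :
    shiftMap χ (shiftInv a) = shiftInv (shiftMap χ a) := by
  simp [shiftMap, shiftInv]

theorem wreath_zero_zpow (K : ZMod 3 → G) (k : ℤ) (q : G × ZMod 3) :
    ((wreath 0 K) ^ k) q = (q.1 * K q.2 ^ k, q.2) := by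
  induction k with
  | zero => simp
  | succ k ih =>
    rw [zpow_add_one, zpow_add_one, (Commute.zpow_self (wreath 0 K) _).eq, Perm.mul_apply, ih]
    simp [mul_assoc]
  | pred k ih =>
    rw [zpow_sub_one, zpow_sub_one, (Commute.zpow_self (wreath 0 K) _).inv_right.eq, Perm.mul_apply, ih]
    simp [mul_assoc]

/-- A path that runs from a vertex into a centre leads next to a vertex of the third type, neither
centre nor of the initial type. -/
theorem ZMod.three_cases_of_ne {α : ZMod 3} : ∀ {i : ZMod 3}, i + α = 0 → i ≠ 0 →
    i + α + α ≠ 0 ∧ i + α + α ≠ i := by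
  revert α; decide

/-! #### Commuting gluing maps -/

/-- Two commuting gluing maps, compatible with the translations, that move the orbits of the
translations and satisfy some conditions on their powers. -/
def CommutingPair (h v : Perm (G × ZMod 3)) : Prop :=
  ∃ a b : ZMod 3 × (ZMod 3 → G), h = wreath a.1 a.2 ∧ v = wreath b.1 b.2 ∧
    (a.1 ≠ 0 ∨ b.1 ≠ 0) ∧ Commute h v ∧ h ^ 6 = 1 ∧ v ^ 6 = 1 ∧ h ^ 3 ≠ 1 ∧ v ^ 3 ≠ 1 ∧
    h ^ 3 ≠ v ^ 3

/-- The cubes of `h` and `v` are distinct commuting involutions. Together with their product they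
are the nontrivial elements of a Klein four-group, and the moves only permute them. -/
theorem moveInvariant_commutingPair : MoveInvariant (CommutingPair (G := G)) where
  shearRight := by
    rintro h v ⟨a, b, rfl, rfl, h0, hc, h6, v6, h3, v3, hv⟩
    have e : ∀ n, (wreath b.1 b.2 * wreath a.1 a.2) ^ n = wreath b.1 b.2 ^ n * wreath a.1 a.2 ^ n :=
      hc.symm.mul_pow
    refine ⟨a, shiftMul b a, rfl, wreath_mul _ _, ?_, hc.mul_right (Commute.refl _), h6, ?_, h3,
      ?_, ?_⟩
    · by_contra! h
      obtain ⟨ha, hb⟩ := h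
      simp only [shiftMul, ha, zero_add] at hb
      exact h0.elim (fun h' => h' ha) (fun h' => h' hb)
    · rw [e, h6, v6, one_mul]
    · rw [e]
      intro h
      refine hv ?_
      rw [← mul_one (wreath a.1 a.2 ^ 3), ← h, ← mul_assoc, (hc.pow_pow 3 3).eq, mul_assoc, ← pow_add,
        h6, mul_one]
    · rw [e]
      exact fun h => v3 (mul_eq_right.1 h.symm)
  shearUp := by
    rintro h v ⟨a, b, rfl, rfl, h0, hc, h6, v6, h3, v3, hv⟩
    have e : ∀ n, (wreath a.1 a.2 * wreath b.1 b.2) ^ n = wreath a.1 a.2 ^ n * wreath b.1 b.2 ^ n :=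
      hc.mul_pow
    refine ⟨shiftMul a b, b, wreath_mul _ _, rfl, ?_, hc.mul_left (Commute.refl _), ?_, v6, ?_,
      v3, ?_⟩
    · by_contra! h
      obtain ⟨ha, hb⟩ := h
      simp only [shiftMul, hb, zero_add] at ha
      exact h0.elim (fun h' => h' ha) (fun h' => h' hb)
    · rw [e, h6, v6, one_mul]
    · rw [e]
      intro h
      refine hv ?_
      rw [← mul_one (wreath a.1 a.2 ^ 3), ← v6, pow_add _ 3 3, ← mul_assoc, h, one_mul]
    · rw [e]
      exact fun h => h3 (mul_eq_right.1 h)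
  quarterTurn := by
    rintro h v ⟨a, b, rfl, rfl, h0, hc, h6, v6, h3, v3, hv⟩
    rw [hc.eq, mul_inv_cancel_right]
    refine ⟨b, shiftInv a, rfl, wreath_inv _, ?_, hc.symm.inv_right, v6, by rw [inv_pow, h6, inv_one],
      v3, ?_, ?_⟩
    · simpa [shiftInv] using h0.symm
    · simpa using h3
    · have : (wreath a.1 a.2)⁻¹ ^ 3 = wreath a.1 a.2 ^ 3 := by
        rw [inv_pow, inv_eq_iff_mul_eq_one, ← pow_add, h6]
      rw [this]
      exact hv.symm

/-- If `h` preserves types and fixes one square, it fixes all squares of that type, as it commutes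
with left multiplications. It also commutes with `v`, which permutes the types cyclically, so it
would be the identity, against `h ^ 3 ≠ 1`. -/
theorem noReturn_of_commutingPair {h v : Perm (G × ZMod 3)} (hP : CommutingPair h v) :
    NoReturn 1 {q | q.2 ≠ 0} h := by
  obtain ⟨a, b, rfl, rfl, h0, hc, -, -, h3, -, -⟩ := hP
  refine fun q hq => ⟨fun _ hs => ?_, fun hn => ?_⟩
  · rw [Perm.sameCycle_one] at hs
    have e1 : a.1 = 0 := by simpa using congrArg Prod.snd hs
    have e2 : a.2 q.2 = 1 := by simpa using congrArg Prod.fst hs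
    have hb := h0.resolve_left (not_not.2 e1)
    have fix : ∀ p : G × ZMod 3, p.2 = q.2 → wreath a.1 a.2 p = p := by
      rintro ⟨g, i⟩ rfl
      simp [e1, e2]
    have step : ∀ p, wreath a.1 a.2 (wreath b.1 b.2 p) = wreath b.1 b.2 p → wreath a.1 a.2 p = p := by
      intro p h
      rw [← Perm.mul_apply, hc.eq, Perm.mul_apply] at h
      exact (wreath b.1 b.2).injective h
    have types : ∀ β : ZMod 3, β ≠ 0 → ∀ i j : ZMod 3, i = j ∨ i + β = j ∨ i + β + β = j := by
      decide
    have : wreath a.1 a.2 = 1 := by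
      refine Equiv.ext fun p => ?_
      rcases types b.1 hb p.2 q.2 with h | h | h
      · exact fix p h
      · exact step p (fix _ h)
      · exact step p (step _ (fix _ h))
    exact h3 (by rw [this, one_pow])
  · have hn : q.2 + a.1 = 0 := by simpa using hn
    obtain ⟨h1, h2⟩ := ZMod.three_cases_of_ne hn hq
    refine ⟨h1, fun hs => ?_⟩
    rw [Perm.sameCycle_one] at hs
    exact h2 (congrArg Prod.snd hs).symm

/-! #### Gluing maps with a rotation -/

/-- The possible signs of the gluing maps of a surface tiled by hexagons all of whose edges have
odd labels, after changes of the lattice basis. -/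
def signStates : List ((ZMod 3 × (ZMod 3 → ℤˣ)) × (ZMod 3 × (ZMod 3 → ℤˣ))) :=
  [((0, ![-1, 1, -1]), (1, ![1, -1, -1])), ((0, ![-1, 1, -1]), (1, ![-1, -1, 1])),
   ((0, ![-1, -1, 1]), (2, ![1, 1, 1])), ((0, ![-1, -1, 1]), (2, ![-1, -1, 1])),
   ((1, ![1, 1, 1]), (0, ![-1, 1, -1])), ((1, ![1, 1, 1]), (1, ![1, -1, -1])),
   ((1, ![1, 1, 1]), (2, ![-1, -1, 1])), ((1, ![-1, 1, -1]), (0, ![-1, 1, -1])),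
   ((1, ![-1, 1, -1]), (1, ![-1, -1, 1])), ((1, ![-1, 1, -1]), (2, ![1, 1, 1])),
   ((2, ![1, -1, -1]), (0, ![-1, -1, 1])), ((2, ![1, -1, -1]), (1, ![1, -1, -1])),
   ((2, ![1, -1, -1]), (2, ![1, 1, 1])), ((2, ![-1, 1, -1]), (0, ![-1, -1, 1])),
   ((2, ![-1, 1, -1]), (1, ![-1, -1, 1])), ((2, ![-1, 1, -1]), (2, ![-1, -1, 1]))]

/-- The list is closed under the three moves; being finite, it is an invariant that can be checked
entry by entry. -/
theorem signStates_moves : ∀ s ∈ signStates, (s.1, shiftMul s.2 s.1) ∈ signStates ∧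
    (shiftMul s.1 s.2, s.2) ∈ signStates ∧
    (shiftMul (shiftMul s.1 s.2) (shiftInv s.1), shiftInv s.1) ∈ signStates := by
  decide +kernel

theorem signStates_of_fst_eq_zero : ∀ s ∈ signStates, s.1.1 = 0 → s.1.2 0 = -1 ∧ s.2.1 ≠ 0 := by
  decide +kernel

/-- Two gluing maps with the commutator `c`, compatible with the translations, whose signs are
admissible, and a rotation around the corners of type `0` that inverts both. -/
def RotationPair (χ : G →* ℤˣ) (c : Perm (G × ZMod 3)) (h v : Perm (G × ZMod 3)) : Prop :=
  ∃ a b : ZMod 3 × (ZMod 3 → G), h = wreath a.1 a.2 ∧ v = wreath b.1 b.2 ∧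
    (shiftMap χ a, shiftMap χ b) ∈ signStates ∧ v * h * v⁻¹ * h⁻¹ = c ∧
    ∃ ρ : G × ZMod 3 → G × ZMod 3, (∀ q, ρ (h q) = h⁻¹ (ρ q)) ∧ (∀ q, ρ (v q) = v⁻¹ (ρ q)) ∧
      ∀ g, ρ (g, 0) = h⁻¹ (v⁻¹ (g, 0))

/-- The half turn takes the cell at a centre to the opposite cell. In a new basis that cell is
numbered by another lower left corner, so `ρ` is corrected by `h⁻¹`, `v⁻¹` or `h * h`. -/
theorem moveInvariant_rotationPair (χ : G →* ℤˣ) (c : Perm (G × ZMod 3)) :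
    MoveInvariant (RotationPair χ c) where
  shearRight := by
    rintro h v ⟨a, b, rfl, rfl, hs, hc, ρ, h1, h2, h3⟩
    refine ⟨a, shiftMul b a, rfl, wreath_mul _ _, ?_, by rw [← hc]; group, fun q =>
      (wreath a.1 a.2)⁻¹ (ρ q), fun q => ?_, fun q => ?_, fun g => ?_⟩
    · rw [shiftMap_mul]
      exact (signStates_moves _ hs).1
    · simp only [h1]
    · simp only [Perm.mul_apply, h2, h1, mul_inv_rev]
    · simp only [h3, mul_inv_rev, Perm.mul_apply]
  shearUp := by
    rintro h v ⟨a, b, rfl, rfl, hs, hc, ρ, h1, h2, h3⟩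
    refine ⟨shiftMul a b, b, wreath_mul _ _, rfl, ?_, by rw [← hc]; group, fun q =>
      (wreath b.1 b.2)⁻¹ (ρ q), fun q => ?_, fun q => ?_, fun g => ?_⟩
    · rw [shiftMap_mul]
      exact (signStates_moves _ hs).2.1
    · simp only [Perm.mul_apply, h2, h1, mul_inv_rev]
    · simp only [h2]
    · simp only [h3, mul_inv_rev, Perm.mul_apply]
  quarterTurn := by
    rintro h v ⟨a, b, rfl, rfl, hs, hc, ρ, h1, h2, h3⟩
    have i1 : ∀ (f : Perm (G × ZMod 3)) q, f (f⁻¹ q) = q := fun f q => f.apply_symm_apply q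
    have i2 : ∀ (f : Perm (G × ZMod 3)) q, f⁻¹ (f q) = q := fun f q => f.symm_apply_apply q
    have h1' : ∀ q, ρ ((wreath a.1 a.2)⁻¹ q) = wreath a.1 a.2 (ρ q) := fun q => by
      rw [← Perm.inv_eq_iff_eq, ← h1, i1]
    refine ⟨shiftMul (shiftMul a b) (shiftInv a), shiftInv a, ?_, wreath_inv _, ?_,
      by rw [← hc]; group, fun q => wreath a.1 a.2 (wreath a.1 a.2 (ρ q)), fun q => ?_, fun q => ?_,
      fun g => ?_⟩
    · rw [← wreath_mul, ← wreath_mul, ← wreath_inv]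
    · rw [shiftMap_mul, shiftMap_mul, shiftMap_inv]
      exact (signStates_moves _ hs).2.2
    · simp only [Perm.mul_apply, h1, h2, h1', mul_inv_rev, inv_inv, i1, i2]
    · simp only [h1', inv_inv]
    · simp only [h3, mul_inv_rev, inv_inv, Perm.mul_apply, i1, i2]

/-- If `h` preserves types and returns at `q`, its factor there is a power of `K q.2`. Commuting
past `v` shows that the factor `a.2 0` at the centres is conjugate to a power of `K q.2` too. It is
an involution by the half turn, hence even by `hK`, but odd by the list of signs. -/
theorem noReturn_of_rotationPair {χ : G →* ℤˣ} {K : ZMod 3 → G} (hK0 : K 0 = 1)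
    (hK : ∀ i, i ≠ 0 → ∀ k : ℤ, (K i ^ k) * (K i ^ k) = 1 → χ (K i ^ k) = 1)
    {h v : Perm (G × ZMod 3)}
    (hP : RotationPair χ (wreath 0 K) h v) : NoReturn (wreath 0 K) {q | q.2 ≠ 0} h := by
  obtain ⟨a, b, rfl, rfl, hs, hc, ρ, h1, h2, h3⟩ := hP
  refine fun q hq => ⟨fun _ hcyc => ?_, fun hn => ?_⟩
  · obtain ⟨k, hk⟩ := hcyc
    rw [wreath_zero_zpow] at hk
    have e1 : a.1 = 0 := by simpa using (congrArg Prod.snd hk).symm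
    have e2 : a.2 q.2 = K q.2 ^ k := by simpa using (congrArg Prod.fst hk).symm
    obtain ⟨hsign, hb⟩ := signStates_of_fst_eq_zero _ hs e1
    -- The commutator relation, read off on the group component at type `i`.
    have hcomm : ∀ i, a.2 i * b.2 i = b.2 i * a.2 (i + b.1) * K (i + b.1) := fun i => by
      have : wreath b.1 b.2 * wreath a.1 a.2 = wreath 0 K * (wreath a.1 a.2 * wreath b.1 b.2) := by
        rw [← hc]; group
      simpa [e1] using congrArg Prod.fst (Equiv.congr_fun this (1, i))
    -- The half turn inverts `h`. Applied at a centre and combined with `hcomm`, where `K 0 = 1`,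
    -- this gives that `a.2 0` is its own inverse.
    have hsq : a.2 0 * a.2 0 = 1 := by
      have h4 : ρ (1 * a.2 0, 0 + a.1) = _ := h1 (1, 0)
      rw [e1, add_zero, h3, h3] at h4
      have h5 := congrArg Prod.fst h4
      simp [e1] at h5
      have h6 := hcomm (-b.1)
      simp [hK0] at h6
      calc a.2 0 * a.2 0 = a.2 0 * (b.2 (-b.1))⁻¹ * (b.2 (-b.1) * a.2 0) := by group
        _ = 1 := by rw [h5, ← h6]; group
    have main : ∀ (u : G) (m : ℤ), a.2 0 = u * K q.2 ^ m * u⁻¹ → False := by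
      intro u m hu
      have h4 : K q.2 ^ m * K q.2 ^ m = 1 := by
        rw [← conj_eq_one_iff (a := u), ← hsq, hu]
        group
      have h5 := hK _ hq m h4
      have h6 : χ (a.2 0) = -1 := hsign
      rw [hu, map_mul, map_mul, h5, mul_one, ← map_mul, mul_inv_cancel, map_one] at h6
      exact absurd h6 (by decide)
    -- Either `v` leads from type 0 to the type of `q` or from the type of `q` to type 0. In the
    -- first case `hcomm` contributes one more factor `K q.2`, in the second none.
    have types : ∀ A β : ZMod 3, A ≠ 0 → β ≠ 0 → 0 + β = A ∨ A + β = 0 := by decide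
    rcases types _ _ hq hb with h | h
    · have h4 := hcomm 0
      have h' : 0 + b.1 = q.2 := h
      rw [h', e2] at h4
      refine main (b.2 0) (k + 1) ?_
      rw [eq_mul_inv_iff_mul_eq, h4, zpow_add_one, mul_assoc]
    · have h4 := hcomm q.2
      have h' : q.2 + b.1 = 0 := h
      rw [h', e2, hK0, mul_one] at h4
      refine main (b.2 q.2)⁻¹ k ?_
      rw [mul_assoc, inv_inv, h4, inv_mul_cancel_left]
  · have hn : q.2 + a.1 = 0 := by simpa using hn
    obtain ⟨h1, h2⟩ := ZMod.three_cases_of_ne hn hq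
    refine ⟨h1, fun hs => ?_⟩
    obtain ⟨k, hk⟩ := hs
    rw [wreath_zero_zpow] at hk
    exact h2 (congrArg Prod.snd hk).symm

end ThreeOrbits

end

noncomputable section

open Set Equiv PeriodicPolyhedralSurface SquareChart

/-! ### The five surfaces -/

instance : Finite mucube.Face := inferInstanceAs (Finite (Fin 3 × Fin 4))
instance : Finite truncatedOcta8.Face := inferInstanceAs (Finite ((Fin 3 ⊕ Fin 3) ⊕ Fin 4 × Fin 6))

/-- The commutator has order 3, and `g` is the first gluing element, which lies in the generated
subgroup trivially and does not normalize the cyclic group of the commutator. -/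
theorem mucube_not_exists (f₀) : ¬ ∃ γ, (mucube.translationCover f₀).IsClosedSaddleConnection γ := by
  refine square_not_exists_isClosedSaddleConnection mucubeLabelling isClosedSurface_mucube
    ?_ (moveInvariant_rightMulPair _ _) rfl (fun h v => noReturn_of_prime_order (n := 3)
      (g := mucubeLabelling.E * mucubeLabelling.R ^ 2) (by norm_num) ?_ ?_ ?_)
    ⟨_, _, rfl, rfl, rfl, fun H ha _ => ha⟩ 
  · intro i h0 h1; interval_cases i <;> decide +kernel
  all_goals decide +kernel

theorem truncatedOcta8_not_exists (f₀) :
    ¬ ∃ γ, (truncatedOcta8.translationCover f₀).IsClosedSaddleConnection γ := by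
  refine square_not_exists_isClosedSaddleConnection truncatedOcta8Labelling isClosedSurface_truncatedOcta8
    ?_ (moveInvariant_rightMulPair _ _) rfl (fun h v => noReturn_of_prime_order (n := 5)
      (g := truncatedOcta8Labelling.E * truncatedOcta8Labelling.R ^ 2) (by norm_num) ?_ ?_ ?_)
    ⟨_, _, rfl, rfl, rfl, fun H ha _ => ha⟩ 
  · intro i h0 h1; interval_cases i <;> decide +kernel
  all_goals decide +kernel

instance : Finite octa4.Face :=
  inferInstanceAs (Finite ((Fin 4 × Fin 3 ⊕ Fin 4 × Fin 3) ⊕ (Fin 4 ⊕ Fin 4)))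

/-- The commutator is an involution; the condition on a generated element plays no role, so `g` is
taken to be 1. -/
theorem octa4_not_exists (f₀) : ¬ ∃ γ, (octa4.translationCover f₀).IsClosedSaddleConnection γ := by
  refine triangle_not_exists_isClosedSaddleConnection octa4Labelling isClosedSurface_octa4
    ?_ (moveInvariant_rightMulPair _ 1) rfl (fun h v => noReturn_of_sq_eq_one ?_ ?_)
    ⟨_, _, rfl, rfl, rfl, fun H _ _ => H.one_mem⟩
  · intro i h0 h1; interval_cases i <;> decide +kernel
  all_goals decide +kernel

instance : Finite muoctahedron.Face := inferInstanceAs (Finite (Fin 4 ⊕ Fin 4))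
instance : Finite mutetrahedron.Face := inferInstanceAs (Finite (Fin 4))

/-- The commutator of the gluing maps is trivial, so the model is a union of flat tori. Singularity
of the vertices is seen by the parity of the edges: after two corners the parity returns, but 12
does not divide 16. -/
theorem mutetrahedron_not_exists (f₀) :
    ¬ ∃ γ, (mutetrahedron.translationCover f₀).IsClosedSaddleConnection γ := by
  have hloop : mutetrahedronLabelling.hexLoop = 1 := by decide +kernel
  refine hex_not_exists_isClosedSaddleConnection mutetrahedronLabelling (by decide +kernel)
    isClosedSurface_mutetrahedron mutetrahedronParity ?_ moveInvariant_commutingPair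
    (fun h v hP => hloop ▸ noReturn_of_commutingPair hP)
    ⟨(2, _), (1, _), rfl, rfl, Or.inl (by decide), ?_, ?_, ?_, ?_, ?_, ?_⟩
  · intro i h0 h1; interval_cases i <;> decide +kernel
  · show _ * _ = _ * _
    decide +kernel
  all_goals decide +kernel

/-- The rotation by a half turn around the centre of a hexagon. -/
def hexRotation {G : Type} [Group G] {X : PeriodicPolyhedralSurface 6} (l : EdgeLabelling X G)
    (q : G × ZMod 3) : G × ZMod 3 := (q.1 * (![l.hexCross 0, 1, 1] : ZMod 3 → G) q.2, -q.2)

theorem muoctahedron_not_exists (f₀) :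
    ¬ ∃ γ, (muoctahedron.translationCover f₀).IsClosedSaddleConnection γ := by
  have hloop : ∃ K : ZMod 3 → Perm (Fin 4), muoctahedronLabelling.hexLoop = wreath 0 K ∧
      K 0 = 1 ∧ ∀ i, i ≠ 0 → K i ^ 4 = 1 ∧ K i ^ 2 ≠ 1 := by
    refine ⟨fun i => (muoctahedronLabelling.hexLoop (1, i)).1, ?_, ?_, ?_⟩ <;> decide +kernel
  obtain ⟨K, hK, hK0, hK1⟩ := hloop
  refine hex_not_exists_isClosedSaddleConnection muoctahedronLabelling (by decide +kernel)
    isClosedSurface_muoctahedron muoctahedronLabelling ?_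
    (moveInvariant_rotationPair Perm.sign (wreath 0 K))
    (fun h v hP => hK ▸ noReturn_of_rotationPair hK0 ?_ hP)
    ⟨(2, _), (1, _), rfl, rfl, ?_, hK, hexRotation muoctahedronLabelling, ?_, ?_, ?_⟩
  · intro i h0 h1; interval_cases i <;> decide +kernel
  -- An odd power of an element of order 4 is not an involution or the identity, so `k` is even and
  -- the power is a square, of sign 1.
  · intro i hi k hk
    obtain ⟨h4, h2⟩ := hK1 i hi
    rcases Int.even_or_odd' k with ⟨j, rfl | rfl⟩
    · rw [map_zpow, zpow_mul]
      simp
    · refine absurd ?_ h2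
      rw [← zpow_add, show 2 * j + 1 + (2 * j + 1) = 4 * j + 2 by ring, zpow_add, zpow_mul] at hk
      have h4' : K i ^ (4 : ℤ) = 1 := h4
      rw [h4', one_zpow, one_mul] at hk
      exact hk
  all_goals decide +kernel

end

theorem mainTheorem3 :
    (∀ f₀, ¬ ∃ γ, (mucube.translationCover f₀).IsClosedSaddleConnection γ) ∧
    (∀ f₀, ¬ ∃ γ, (muoctahedron.translationCover f₀).IsClosedSaddleConnection γ) ∧
    (∀ f₀, ¬ ∃ γ, (mutetrahedron.translationCover f₀).IsClosedSaddleConnection γ) ∧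
    (∀ f₀, ¬ ∃ γ, (octa4.translationCover f₀).IsClosedSaddleConnection γ) ∧
    (∀ f₀, ¬ ∃ γ, (truncatedOcta8.translationCover f₀).IsClosedSaddleConnection γ) := by
  exact ⟨mucube_not_exists, muoctahedron_not_exists, mutetrahedron_not_exists, octa4_not_exists,
    truncatedOcta8_not_exists⟩
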